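/- Let $K$ be a field and let $\ell\ge n\ge 0$ be integers. Let $\mathscr H=\mathscr H_{\ell,n}^{(0)}$ be the cyclotomic nilHecke algebra: the unital associative $K$-algebra with generators $\psi_1,\dots,\psi_{n-1},y_1,\dots,y_n$ and relations $\psi_r^2=0$; $\psi_r\psi_k=\psi_k\psi_r$ for $|r-k|>1$; $\psi_r\psi_{r+1}\psi_r=\psi_{r+1}\psi_r\psi_{r+1}$; $y_ry_k=y_ky_r$; $\psi_ry_k=y_k\psi_r$ for $k\ne r,r+1$; $\psi_ry_{r+1}=y_r\psi_r+1$; $y_{r+1}\psi_r=\psi_ry_r+1$; $y_1^\ell=0$. It is $\mathbb Z$-graded with $\deg\psi_r=-2$, $\deg y_r=2$. Let $*$ be the anti-automorphism fixing all generators. For $w$ in the symmetric group $\mathfrak S_n$ with reduced expression $w=s_{i_1}\cdots s_{i_k}$ in the simple transpositions put $\psi_w=\psi_{i_1}\cdots\psi_{i_k}$ (this is independent of the choice of the reduced expression); let $\ell(w)$ be the length of $w$ and $w_0$ the longest element. For $z_1,z_2\in\mathfrak S_n$ put $$F'_{z_1,z_2}=\psi_{w_0z_1}^{*}\;y_1^{n-1}y_2^{n-2}\cdots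 y_{n-1}\;\psi_{w_0}\;y_1^{n-1}y_2^{n-2}\cdots y_{n-1}\;\psi_{z_2}.$$ Write $u\succeq w$ if some reduced expression of $w$ has an initial segment which is an expression for $u$, and $u\succ w$ if moreover $u\neq w$. List the elements of $\mathfrak S_n$ as $1=w_1,w_2,\dots,w_{n!}$ such that $w_i^{-1}\succ w_j^{-1}$ only if $i<j$, and define inductively on $i$ $$\mathfrak f_{w_i,w_j}=F'_{w_i,w_j}-\sum_{1\le k<i}\mathfrak f_{w_k,w_k}F'_{w_i,w_j}\qquad(1\le i,j\le n!).$$ For integers $1\le k_1<\dots<k_n\le\ell$ put $y_{\mathbf k}=y_1^{\ell-k_1}\cdots y_n^{\ell-k_n}$. Let $\mathbf k^{\min}=(\ell-n+1,\dots,\ell)$, so that $y_{\mathbf k^{\min}}=y_1^{n-1}\cdots y_{n-1}$, and let $\mathscr H^{>}$ be the two-sided ideal generated by all $y_{\mathbf k}$ with $\mathbf k\ne\mathbf k^{\min}$. Let $S$ be the right submodule of $\mathscr H/\mathscr H^{>}$ generated by the class of $y_{\mathbf k^{\min}}$, equipped with the bilinear form determined by $y_{\mathbf k^{\min}}ab^*y_{\mathbf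 k^{\min}}\equiv\langle y_{\mathbf k^{\min}}a,\,y_{\mathbf k^{\min}}b\rangle\, y_{\mathbf k^{\min}}\pmod{\mathscr H^{>}}$, and let $D_0=S/\operatorname{rad}\langle\,,\rangle$, graded so that the class of $y_{\mathbf k^{\min}}$ has degree $n(n-1)/2$. Theorem. (1) For all $1\le i,j\le n!$, the element $\mathfrak f_{w_i,w_j}$ is nonzero and homogeneous of degree $2\ell(w_i)-2\ell(w_j)$. (2) $\mathfrak f_{w_i,w_j}\mathfrak f_{w_k,w_l}=\delta_{j,k}\,\mathfrak f_{w_i,w_l}$ for all $1\le i,j,k,l\le n!$. (3) $D_0$ is simple, and every simple right $\mathscr H$-module is isomorphic to $D_0$ as an ungraded module. $D_0$ has a projective cover $P_0$ in the category of graded right $\mathscr H$-modules, and for every such $P_0$ and every $i$ one has $\mathfrak f_{w_i,w_i}\mathscr H\cong P_0$ as ungraded right $\mathscr H$-modules. (4) $1=\sum_{i=1}^{n!}\mathfrak f_{w_i,w_i}$, and $\{\mathfrak f_{w_i,w_i}\mid 1\le i\le n!\}$ is a complete set of pairwise orthogonal primitive idempotents of $\mathscr H$. -/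

import Mathlib

universe u v

noncomputable section

namespace NilHecke

open MulOpposite

/-! ### Words in the symmetric group

`Equiv.Perm (Fin n)` is the symmetric group on `n` letters; the letters `1, …, n` of the usual
notation are the elements `0, …, n - 1` of `Fin n`, and the indices `1 ≤ r < n` of the simple
transpositions are the elements `0, …, n - 2` of `Fin (n - 1)`. -/

/-- The letter `r`, for `1 ≤ r < n`. -/
def lo {n : ℕ} (r : Fin (n - 1)) : Fin n := ⟨r.1, by omega⟩

/-- The letter `r + 1`, for `1 ≤ r < n`. -/
def hi {n : ℕ} (r : Fin (n - 1)) : Fin n := ⟨r.1 + 1, by omega⟩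

/-- The simple transposition `s_r = (r, r + 1)`. -/
def simpleRefl {n : ℕ} (r : Fin (n - 1)) : Equiv.Perm (Fin n) := Equiv.swap (lo r) (hi r)

/-- The product `s_{i₁} ⋯ s_{iₖ}` of a word `i₁, …, iₖ`. -/
def wordProd {n : ℕ} (l : List (Fin (n - 1))) : Equiv.Perm (Fin n) := (l.map simpleRefl).prod

theorem exists_word {n : ℕ} (w : Equiv.Perm (Fin n)) :
    ∃ l : List (Fin (n - 1)), wordProd l = w := by
  cases n with
  | zero => exact ⟨[], Subsingleton.elim _ _⟩
  | succ m =>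
    have h : w ∈ Submonoid.closure
        (Set.range fun i : Fin m => Equiv.swap i.castSucc i.succ) := by
      rw [Equiv.Perm.mclosure_swap_castSucc_succ]; trivial
    induction h using Submonoid.closure_induction with
    | mem x hx =>
      obtain ⟨i, rfl⟩ := hx
      exact ⟨[i], by simp [wordProd, simpleRefl, lo, hi, Fin.castSucc, Fin.succ]; rfl⟩
    | one => exact ⟨[], rfl⟩
    | mul x y _ _ hx hy =>
      obtain ⟨a, rfl⟩ := hx
      obtain ⟨b, rfl⟩ := hy
      exact ⟨a ++ b, by simp [wordProd]⟩

/-- The length of a permutation: the least length of a word in the simple transpositions. -/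
def len {n : ℕ} (w : Equiv.Perm (Fin n)) : ℕ :=
  sInf {k : ℕ | ∃ l : List (Fin (n - 1)), l.length = k ∧ wordProd l = w}

/-- `l` is a reduced expression for `w`. -/
def IsReducedWord {n : ℕ} (l : List (Fin (n - 1))) (w : Equiv.Perm (Fin n)) : Prop :=
  wordProd l = w ∧ l.length = len w

theorem exists_reducedWord {n : ℕ} (w : Equiv.Perm (Fin n)) :
    ∃ l : List (Fin (n - 1)), IsReducedWord l w := by
  obtain ⟨l, hl⟩ := exists_word w
  obtain ⟨l', h1, h2⟩ := Nat.sInf_mem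
    (s := {k : ℕ | ∃ l : List (Fin (n - 1)), l.length = k ∧ wordProd l = w}) ⟨_, l, rfl, hl⟩
  exact ⟨l', h2, h1⟩

/-- A reduced expression of `w`. -/
def reducedWord {n : ℕ} (w : Equiv.Perm (Fin n)) : List (Fin (n - 1)) :=
  (exists_reducedWord w).choose

/-- The longest element `w₀` of the symmetric group, the order-reversing permutation. -/
def longest (n : ℕ) : Equiv.Perm (Fin n) := Fin.revPerm

/-- The weak Bruhat order `u ⪰ w`: some reduced expression of `w` has an initial segment with
product `u`. (So the identity is the largest element.) -/
def WeakGE {n : ℕ} (u w : Equiv.Perm (Fin n)) : Prop :=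
  ∃ l₁ l₂ : List (Fin (n - 1)), IsReducedWord (l₁ ++ l₂) w ∧ wordProd l₁ = u

/-- The strict weak Bruhat order `u ≻ w`. -/
def WeakGT {n : ℕ} (u w : Equiv.Perm (Fin n)) : Prop := WeakGE u w ∧ u ≠ w

/-! ### The cyclotomic nilHecke algebra -/

/-- The generators `ψ_1, …, ψ_{n-1}` (left summand) and `y_1, …, y_n` (right summand). -/
abbrev Gen (n : ℕ) : Type := Fin (n - 1) ⊕ Fin n

/-- The defining relations of the cyclotomic nilHecke algebra, in the free algebra. -/
inductive Rel (K : Type*) [Field K] (ℓ n : ℕ) :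
    FreeAlgebra K (Gen n) → FreeAlgebra K (Gen n) → Prop
  | psi_sq (r : Fin (n - 1)) :
      Rel K ℓ n (FreeAlgebra.ι K (Sum.inl r) * FreeAlgebra.ι K (Sum.inl r)) 0
  | psi_comm (k r : Fin (n - 1)) (h : k.1 + 1 < r.1) :
      Rel K ℓ n (FreeAlgebra.ι K (Sum.inl r) * FreeAlgebra.ι K (Sum.inl k))
        (FreeAlgebra.ι K (Sum.inl k) * FreeAlgebra.ι K (Sum.inl r))
  | braid (r t : Fin (n - 1)) (h : t.1 = r.1 + 1) :
      Rel K ℓ n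
        (FreeAlgebra.ι K (Sum.inl r) * FreeAlgebra.ι K (Sum.inl t) * FreeAlgebra.ι K (Sum.inl r))
        (FreeAlgebra.ι K (Sum.inl t) * FreeAlgebra.ι K (Sum.inl r) * FreeAlgebra.ι K (Sum.inl t))
  | y_comm (r k : Fin n) :
      Rel K ℓ n (FreeAlgebra.ι K (Sum.inr r) * FreeAlgebra.ι K (Sum.inr k))
        (FreeAlgebra.ι K (Sum.inr k) * FreeAlgebra.ι K (Sum.inr r))
  | psi_y_far (r : Fin (n - 1)) (k : Fin n) (h₁ : k ≠ lo r) (h₂ : k ≠ hi r) :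
      Rel K ℓ n (FreeAlgebra.ι K (Sum.inl r) * FreeAlgebra.ι K (Sum.inr k))
        (FreeAlgebra.ι K (Sum.inr k) * FreeAlgebra.ι K (Sum.inl r))
  | psi_y (r : Fin (n - 1)) :
      Rel K ℓ n (FreeAlgebra.ι K (Sum.inl r) * FreeAlgebra.ι K (Sum.inr (hi r)))
        (FreeAlgebra.ι K (Sum.inr (lo r)) * FreeAlgebra.ι K (Sum.inl r) + 1)
  | y_psi (r : Fin (n - 1)) :
      Rel K ℓ n (FreeAlgebra.ι K (Sum.inr (hi r)) * FreeAlgebra.ι K (Sum.inl r))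
        (FreeAlgebra.ι K (Sum.inl r) * FreeAlgebra.ι K (Sum.inr (lo r)) + 1)
  | cyclotomic (i : Fin n) (h : i.1 = 0) :
      Rel K ℓ n (FreeAlgebra.ι K (Sum.inr i) ^ ℓ) 0

/-- The cyclotomic nilHecke algebra of type `A` with parameters `ℓ, n` over `K`. -/
def H (K : Type*) [Field K] (ℓ n : ℕ) : Type _ := RingQuot (Rel K ℓ n)

variable (K : Type*) [Field K] (ℓ n : ℕ)

instance : Ring (H K ℓ n) := inferInstanceAs (Ring (RingQuot (Rel K ℓ n)))

instance : Algebra K (H K ℓ n) := inferInstanceAs (Algebra K (RingQuot (Rel K ℓ n)))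

/-- The quotient map from the free algebra. -/
def mk : FreeAlgebra K (Gen n) →ₐ[K] H K ℓ n := RingQuot.mkAlgHom K (Rel K ℓ n)

/-- The image of a generator in the cyclotomic nilHecke algebra. -/
def gen (g : Gen n) : H K ℓ n := mk K ℓ n (FreeAlgebra.ι K g)

/-- The generator `ψ_r`. -/
def psi (r : Fin (n - 1)) : H K ℓ n := gen K ℓ n (Sum.inl r)

/-- The generator `y_i`. -/
def y (i : Fin n) : H K ℓ n := gen K ℓ n (Sum.inr i)

/-- Degrees of the generators: `deg ψ_r = -2`, `deg y_i = 2`. -/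
def genDeg {n : ℕ} : Gen n → ℤ
  | Sum.inl _ => -2
  | Sum.inr _ => 2

/-- The homogeneous component of degree `d`: the span of all monomials in the generators that have
degree `d`. -/
def homog (d : ℤ) : Submodule K (H K ℓ n) :=
  Submodule.span K {x | ∃ l : List (Gen n),
    (l.map genDeg).sum = d ∧ x = (l.map (gen K ℓ n)).prod}

/-- The `K`-algebra anti-automorphism `*` fixing all generators, as a homomorphism to the opposite
algebra. -/
def starHom : H K ℓ n →ₐ[K] (H K ℓ n)ᵐᵒᵖ :=
  RingQuot.liftAlgHom K ⟨FreeAlgebra.lift K (fun g => op (gen K ℓ n g)), by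
    have R : ∀ {a b}, Rel K ℓ n a b →
        mk K ℓ n a = mk K ℓ n b :=
      fun h => RingQuot.mkAlgHom_rel K h
    intro a b h
    induction h with
    | psi_sq r =>
      have := R (Rel.psi_sq r)
      simp only [map_mul, map_zero, FreeAlgebra.lift_ι_apply, ← op_mul, gen] at this ⊢
      rw [this, op_zero]
    | psi_comm k r h =>
      have := R (Rel.psi_comm k r h)
      simp only [map_mul, FreeAlgebra.lift_ι_apply, ← op_mul, gen] at this ⊢
      rw [this]
    | braid r t h =>
      have := R (Rel.braid r t h)
      simp only [map_mul, FreeAlgebra.lift_ι_apply, ← op_mul, gen, mul_assoc] at this ⊢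
      rw [this]
    | y_comm r k =>
      have := R (Rel.y_comm r k)
      simp only [map_mul, FreeAlgebra.lift_ι_apply, ← op_mul, gen] at this ⊢
      rw [this]
    | psi_y_far r k h₁ h₂ =>
      have := R (Rel.psi_y_far r k h₁ h₂)
      simp only [map_mul, FreeAlgebra.lift_ι_apply, ← op_mul, gen] at this ⊢
      rw [this]
    | psi_y r =>
      have := R (Rel.y_psi r)
      simp only [map_mul, map_add, map_one, FreeAlgebra.lift_ι_apply, ← op_mul, gen] at this ⊢
      rw [this, op_add, op_one]
    | y_psi r =>
      have := R (Rel.psi_y r)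
      simp only [map_mul, map_add, map_one, FreeAlgebra.lift_ι_apply, ← op_mul, gen] at this ⊢
      rw [this, op_add, op_one]
    | cyclotomic i h =>
      have := R (Rel.cyclotomic i h)
      simp only [map_pow, map_zero, FreeAlgebra.lift_ι_apply, ← op_pow, gen] at this ⊢
      rw [this, op_zero]⟩

/-- The anti-automorphism `*`, as a map from the algebra to itself. -/
def antiAut (x : H K ℓ n) : H K ℓ n := unop (starHom K ℓ n x)

theorem antiAut_mul (a b : H K ℓ n) :
    antiAut K ℓ n (a * b) = antiAut K ℓ n b * antiAut K ℓ n a := by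
  simp only [antiAut, map_mul, unop_mul]

theorem antiAut_gen (g : Gen n) : antiAut K ℓ n (gen K ℓ n g) = gen K ℓ n g := by
  change unop (RingQuot.liftAlgHom K _ (RingQuot.mkAlgHom K (Rel K ℓ n) (FreeAlgebra.ι K g))) = _
  rw [RingQuot.liftAlgHom_mkAlgHom_apply, FreeAlgebra.lift_ι_apply, unop_op]

theorem antiAut_antiAut (a : H K ℓ n) : antiAut K ℓ n (antiAut K ℓ n a) = a := by
  let φ : H K ℓ n →ₐ[K] H K ℓ n :=
    { toFun := fun x => antiAut K ℓ n (antiAut K ℓ n x)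
      map_one' := by simp only [antiAut, map_one, unop_one]
      map_mul' := fun x z => by rw [antiAut_mul, antiAut_mul]
      map_zero' := by simp only [antiAut, map_zero, unop_zero]
      map_add' := fun x z => by simp only [antiAut, map_add, unop_add]
      commutes' := fun c => by
        have h : antiAut K ℓ n (algebraMap K (H K ℓ n) c) = algebraMap K (H K ℓ n) c := by
          unfold antiAut
          rw [AlgHom.commutes, MulOpposite.algebraMap_apply, unop_op]
        change antiAut K ℓ n (antiAut K ℓ n (algebraMap K (H K ℓ n) c)) = _
        rw [h, h] }
  have h : φ = AlgHom.id K (H K ℓ n) := by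
    apply RingQuot.ringQuot_ext'
    apply FreeAlgebra.hom_ext
    funext g
    change antiAut K ℓ n (antiAut K ℓ n (gen K ℓ n g)) = gen K ℓ n g
    rw [antiAut_gen, antiAut_gen]
  exact DFunLike.congr_fun h a

/-- `ψ_w = ψ_{i₁} ⋯ ψ_{iₖ}` for a reduced expression `s_{i₁} ⋯ s_{iₖ}` of `w`; by the braid
relations it does not matter which one is taken. -/
def psiW (w : Equiv.Perm (Fin n)) : H K ℓ n := ((reducedWord w).map (psi K ℓ n)).prod

/-! ### Specht modules, the simple module and its projective cover

Right modules over `H` are modules over the opposite ring. An `ℓ`-multipartition of `n` all of whose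
components are `∅` or `(1)` is given by the positions `k_1 < ⋯ < k_n` of its components `(1)`,
i.e. by an order embedding `k : Fin n ↪o Fin ℓ` (position `k_i` is `(k i).1 + 1`). -/

/-- The multipartitions of `n` with `ℓ` components, each `∅` or `(1)`. -/
abbrev MPart (ℓ n : ℕ) : Type := Fin n ↪o Fin ℓ

/-- The dominance order `k' > k`: the components `(1)` of `k'` stand weakly further to the left,
and `k' ≠ k`. -/
def MPart.Dom {ℓ n : ℕ} (k' k : MPart ℓ n) : Prop := (∀ i, k' i ≤ k i) ∧ k' ≠ k

/-- The minimal multipartition `(∅, …, ∅, (1), …, (1))`. -/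
def MPart.min {ℓ n : ℕ} (h : n ≤ ℓ) : MPart ℓ n :=
  OrderEmbedding.ofStrictMono (fun i => (⟨ℓ - n + i.1, by omega⟩ : Fin ℓ))
    (fun i j hij => by
      change ℓ - n + i.1 < ℓ - n + j.1
      exact Nat.add_lt_add_left hij _)

variable {ℓ n} in
/-- `y_k = y_1^{ℓ - k_1} ⋯ y_n^{ℓ - k_n}`. -/
def yPart (k : MPart ℓ n) : H K ℓ n :=
  (List.ofFn fun i : Fin n => y K ℓ n i ^ (ℓ - ((k i).1 + 1))).prod

variable {ℓ n} in
/-- The degree `∑ (ℓ - k_i)` of the generator of the Specht module attached to `k`, which is half the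
degree of `y_k`. -/
def topDeg (k : MPart ℓ n) : ℤ := ∑ i : Fin n, ((ℓ : ℤ) - (((k i).1 : ℤ) + 1))

variable {ℓ n} in
/-- The two-sided ideal `H^{> k}` generated by the `y_{k'}` with `k' > k`, regarded as a right
submodule of `H`. (It is the linear span of the cellular basis elements `ψ_w^* y_{k'} ψ_u` with
`k' > k`.) -/
def cellIdeal (k : MPart ℓ n) : Submodule (H K ℓ n)ᵐᵒᵖ (H K ℓ n) :=
  Submodule.span _ {x | ∃ (a : H K ℓ n) (k' : MPart ℓ n), k'.Dom k ∧ x = a * yPart K k'}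

variable {ℓ n} in
/-- The class of `x` in `H / H^{> k}`. -/
def cellMk (k : MPart ℓ n) (x : H K ℓ n) : H K ℓ n ⧸ cellIdeal K k :=
  (cellIdeal K k).mkQ x

variable {ℓ n} in
/-- The Specht module `S^k`, the right submodule of `H / H^{> k}` generated by the class of `y_k`
(spanned over `K` by the classes of the elements `y_k ψ_w`). -/
def specht (k : MPart ℓ n) : Submodule (H K ℓ n)ᵐᵒᵖ (H K ℓ n ⧸ cellIdeal K k) :=
  Submodule.span _ {cellMk K k (yPart K k)}

variable {ℓ n} in
/-- The radical of the bilinear form on the Specht module. The form is determined by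
`y_k a b^* y_k ≡ ⟨y_k a, y_k b⟩ y_k` modulo `H^{> k}`, so that the class `x` of `y_k a` is in the
radical if and only if `x b^* y_k = 0` in `H / H^{> k}` for all `b`. -/
def spechtRad (k : MPart ℓ n) : Submodule (H K ℓ n)ᵐᵒᵖ (specht K k) where
  carrier := {x | ∀ b : H K ℓ n, op (antiAut K ℓ n b * yPart K k) • (x : H K ℓ n ⧸ cellIdeal K k) = 0}
  zero_mem' := fun b => by simp
  add_mem' := fun {x z} hx hz b => by
    rw [Submodule.coe_add, smul_add, hx b, hz b, add_zero]
  smul_mem' := fun c x hx b => by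
    have h := hx (b * antiAut K ℓ n (unop c))
    rw [antiAut_mul, antiAut_antiAut] at h
    rw [Submodule.coe_smul, smul_smul]
    rw [← h, mul_assoc, op_mul (unop c), op_unop]

variable {ℓ n} in
/-- The module `D^k = S^k / rad`. -/
abbrev cellHead (k : MPart ℓ n) : Type _ := specht K k ⧸ spechtRad K k

variable {ℓ n} in
/-- The class of `y_k` as an element of the Specht module. -/
def spechtGen (k : MPart ℓ n) : specht K k :=
  ⟨cellMk K k (yPart K k), Submodule.mem_span_singleton_self _⟩

variable {ℓ n} in
/-- The image in `D^k` of the class of `y_k a` in the Specht module. -/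
def cellHeadMk (k : MPart ℓ n) (a : H K ℓ n) : cellHead K k :=
  (spechtRad K k).mkQ (op a • spechtGen K k)

variable {ℓ n} in
/-- The grading of `D^k`: the image of `y_k` has degree `∑ (ℓ - k_i)`. -/
def cellHeadGrading (k : MPart ℓ n) (d : ℤ) : AddSubgroup (cellHead K k) where
  carrier := {x | ∃ a ∈ homog K ℓ n (d - topDeg k), x = cellHeadMk K k a}
  zero_mem' := ⟨0, zero_mem _, by simp [cellHeadMk]⟩
  add_mem' := by
    rintro _ _ ⟨a, ha, rfl⟩ ⟨b, hb, rfl⟩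
    exact ⟨a + b, add_mem ha hb, by simp only [cellHeadMk, op_add, add_smul, map_add]⟩
  neg_mem' := by
    rintro _ ⟨a, ha, rfl⟩
    exact ⟨-a, neg_mem ha, 
      (map_neg _ _).symm.trans (congrArg (spechtRad K k).mkQ (neg_smul (op a) (spechtGen K k)).symm)⟩

/-- `gr` makes the right module `P` into a `ℤ`-graded module. -/
structure IsGradedModule {P : Type*} [AddCommGroup P] [Module (H K ℓ n)ᵐᵒᵖ P]
    (gr : ℤ → AddSubgroup P) : Prop where
  internal : DirectSum.IsInternal gr
  smul_mem : ∀ (d e : ℤ) (x : P) (a : H K ℓ n),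
    x ∈ gr d → a ∈ homog K ℓ n e → op a • x ∈ gr (d + e)

/-- A submodule is graded if it is generated by homogeneous elements. -/
def IsGradedSubmodule {P : Type*} [AddCommGroup P] [Module (H K ℓ n)ᵐᵒᵖ P]
    (gr : ℤ → AddSubgroup P) (N : Submodule (H K ℓ n)ᵐᵒᵖ P) : Prop :=
  N = Submodule.span (H K ℓ n)ᵐᵒᵖ {x | x ∈ N ∧ ∃ d : ℤ, x ∈ gr d}

/-- `π : P → D` is a projective cover in the category of `ℤ`-graded right modules and homogeneous
maps of degree `0`: `P` is graded and projective (a graded module is projective in the graded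
category if and only if it is projective), and `π` is a surjective map of graded modules whose kernel
is superfluous. -/
structure IsGradedProjectiveCover {D P : Type*} [AddCommGroup D] [Module (H K ℓ n)ᵐᵒᵖ D]
    [AddCommGroup P] [Module (H K ℓ n)ᵐᵒᵖ P] (grD : ℤ → AddSubgroup D) (gr : ℤ → AddSubgroup P)
    (π : P →ₗ[(H K ℓ n)ᵐᵒᵖ] D) : Prop where
  gradedSource : IsGradedModule K ℓ n gr
  gradedTarget : IsGradedModule K ℓ n grD
  projective : Module.Projective (H K ℓ n)ᵐᵒᵖ P
  map_mem : ∀ (d : ℤ) (x : P), x ∈ gr d → π x ∈ grD d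
  surjective : Function.Surjective π
  superfluous : ∀ N : Submodule (H K ℓ n)ᵐᵒᵖ P, IsGradedSubmodule K ℓ n gr N →
    N ⊔ LinearMap.ker π = ⊤ → N = ⊤

/-! ### The elements `F'` and `f` -/

/-- `y_1^{n-1} y_2^{n-2} ⋯ y_{n-1}`. -/
def yDelta : H K ℓ n := (List.ofFn fun i : Fin n => y K ℓ n i ^ (n - 1 - i.1)).prod

variable {n} in
/-- `F'_{z₁,z₂} = ψ_{w₀z₁}^* y_1^{n-1}⋯y_{n-1} ψ_{w₀} y_1^{n-1}⋯y_{n-1} ψ_{z₂}`. -/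
def Fprime (z₁ z₂ : Equiv.Perm (Fin n)) : H K ℓ n :=
  antiAut K ℓ n (psiW K ℓ n (longest n * z₁)) * yDelta K ℓ n * psiW K ℓ n (longest n) *
    yDelta K ℓ n * psiW K ℓ n z₂

variable {n} in
/-- The elements `f_{w_i,w_j}`, for a list `w_1, …, w_{n!}` of the elements of the symmetric group:
`f_{w_i,w_j} = F'_{w_i,w_j} - ∑_{k < i} f_{w_k,w_k} F'_{w_i,w_j}`. -/
def f (w : Fin n.factorial → Equiv.Perm (Fin n)) (i j : Fin n.factorial) : H K ℓ n :=
  Fprime K ℓ (w i) (w j) -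
    ∑ k : {k : Fin n.factorial // k < i}, f w k.1 k.1 * Fprime K ℓ (w i) (w j)
termination_by i.1
decreasing_by exact k.2

/-- The right ideal `e H`. -/
def rightIdeal {R : Type*} [Ring R] (e : R) : Submodule Rᵐᵒᵖ R := Submodule.span Rᵐᵒᵖ {e}

/-- A primitive idempotent: a nonzero idempotent that is not a sum of two nonzero orthogonal
idempotents. -/
def IsPrimitiveIdempotent {R : Type*} [Ring R] (e : R) : Prop :=
  IsIdempotentElem e ∧ e ≠ 0 ∧
    ∀ a b : R, IsIdempotentElem a → IsIdempotentElem b → a * b = 0 → b * a = 0 → e = a + b →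
      a = 0 ∨ b = 0

end NilHecke

end

/-! Write x = ψ_{w₀}, D = y_1^{n-1}⋯y_{n-1} and Z for the image in H of the symmetric polynomials in
the y_i, which is central. Three facts about x carry the proof. Since ψ_r x = 0, every element of H
x is a polynomial in the y_i times x, on which ψ_r acts as a divided difference; hence x H x ⊆ Z x
(`psiW_longest_mul_mul_psiW_longest`). Next, x D x D x = x (`psiW_longest_yDelta_cancel`). Finally 1
= ∑ a_j x c_j with exactly n! terms (`one_eq_sum_psiW_longest`).

Now F'_{ij} = α_i x β_j with α_i = ψ_{w₀w_i}^* D and β_j = D ψ_{w_j}. The product ψ_{w_j}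
ψ_{w₀w_k}^* is x for j = k and vanishes unless w_j⁻¹ ⪰ w_k⁻¹, so the "Gram matrix" x β_j α_k x is
unitriangular for the chosen order. The recursion defining f is Gram–Schmidt: it yields f_{kl} = γ_k
x β_l with x β_j γ_k x = δ_{jk} x (`exists_dual_system`), so the f_{kl} multiply as matrix units.
They sum to 1 because the n!-term expression of 1 turns this duality into a one-sided inverse of a
square matrix over a commutative ring, which is then two-sided (`sum_dual_system_eq_one`). They are
nonzero because H ≠ 0, as H acts on the coinvariant algebra.

The corner f_{ii} H f_{ii} is Z f_{ii}, and each element of Z is a scalar plus a nilpotent. This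
local corner gives primitivity and the projective cover property. Modulo the ideal J generated by
the central nilpotents e_k(y), k ≥ 1, the f_{ij} become matrix units over K. As J kills simple
modules, there is only one; the degrees of the f_{ij} and the relation ∑ (-1)^j e_j y_1^{n-j} = 0
identify J with H^> (`mem_cellIdeal_iff`), so that D_0 is this simple module. -/

noncomputable section

namespace NilHecke

open MulOpposite

/-! ### Inversions, length, reduced words and the longest element. -/

section Permutations

variable {n : ℕ}

theorem lo_ne_hi (r : Fin (n - 1)) : lo r ≠ hi r := by simp [lo, hi]

theorem simpleRefl_val (r : Fin (n - 1)) (a : Fin n) :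
    (simpleRefl r a).1 = if a.1 = r.1 then r.1 + 1 else if a.1 = r.1 + 1 then r.1 else a.1 := by
  simp only [simpleRefl, Equiv.swap_apply_def, lo, hi, Fin.ext_iff]
  split_ifs <;> rfl

@[simp] theorem simpleRefl_lo (r : Fin (n - 1)) : simpleRefl r (lo r) = hi r :=
  Equiv.swap_apply_left _ _

@[simp] theorem simpleRefl_hi (r : Fin (n - 1)) : simpleRefl r (hi r) = lo r :=
  Equiv.swap_apply_right _ _

@[simp] theorem simpleRefl_inv (r : Fin (n - 1)) : (simpleRefl r)⁻¹ = simpleRefl r :=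
  Equiv.swap_inv _ _

@[simp] theorem simpleRefl_mul_self (r : Fin (n - 1)) : simpleRefl r * simpleRefl r = 1 :=
  Equiv.swap_mul_self _ _

@[simp] theorem simpleRefl_mul_cancel (r : Fin (n - 1)) (w : Equiv.Perm (Fin n)) :
    simpleRefl r * (simpleRefl r * w) = w := by
  rw [← mul_assoc, simpleRefl_mul_self, one_mul]

@[simp] theorem wordProd_nil : wordProd ([] : List (Fin (n - 1))) = 1 := rfl

@[simp] theorem wordProd_cons (r : Fin (n - 1)) (l : List (Fin (n - 1))) :
    wordProd (r :: l) = simpleRefl r * wordProd l := by simp [wordProd]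

@[simp] theorem wordProd_append (l l' : List (Fin (n - 1))) :
    wordProd (l ++ l') = wordProd l * wordProd l' := by simp [wordProd]

theorem wordProd_reverse (l : List (Fin (n - 1))) : wordProd l.reverse = (wordProd l)⁻¹ := by
  induction l with
  | nil => simp
  | cons r l ih => simp [ih]

/-- The inversions of a permutation. -/
def inversions (u : Equiv.Perm (Fin n)) : Finset (Fin n × Fin n) :=
  Finset.univ.filter fun p => p.1 < p.2 ∧ u p.2 < u p.1

theorem mem_inversions {u : Equiv.Perm (Fin n)} {a b : Fin n} :
    (a, b) ∈ inversions u ↔ a < b ∧ u b < u a := by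
  simp [inversions]

theorem inversions_one : inversions (1 : Equiv.Perm (Fin n)) = ∅ := by
  ext ⟨a, b⟩
  simp only [mem_inversions, Equiv.Perm.one_apply, Finset.notMem_empty, iff_false]
  exact fun h => lt_asymm h.1 h.2

/-- The transposition s_r preserves the order of every pair of letters except {r, r + 1}, so
inversions are merely relabelled and that one pair is new. -/
theorem inversions_mul_simpleRefl (u : Equiv.Perm (Fin n)) (r : Fin (n - 1))
    (h : u (lo r) < u (hi r)) :
    inversions (u * simpleRefl r) = insert (lo r, hi r)
      ((inversions u).map (Equiv.prodCongr (simpleRefl r) (simpleRefl r)).toEmbedding) := by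
  ext ⟨a, b⟩
  have hs : (simpleRefl r).symm = simpleRefl r := simpleRefl_inv r
  simp only [mem_inversions, Finset.mem_insert, Finset.mem_map_equiv, Equiv.prodCongr_symm, hs, Equiv.prodCongr_apply, Prod.map_apply,
    Equiv.Perm.mul_apply, Prod.mk.injEq]
  by_cases h1 : a = lo r ∧ b = hi r
  · obtain ⟨rfl, rfl⟩ := h1
    simp [h]
    simp [lo, hi]
  · by_cases h2 : a = hi r ∧ b = lo r
    · obtain ⟨rfl, rfl⟩ := h2
      have h3 : ¬ (hi r < lo r) := by simp [lo, hi]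
      simp [h3, h.le, (lo_ne_hi r).symm]
    · simp only [h1, false_or]
      refine and_congr_left fun _ => ?_
      have ha := simpleRefl_val r a
      have hb := simpleRefl_val r b
      simp only [lo, hi, Fin.ext_iff] at h1 h2
      rw [Fin.lt_def, Fin.lt_def, ha, hb]
      split_ifs <;> omega

theorem card_inversions_mul_of_lt (u : Equiv.Perm (Fin n)) (r : Fin (n - 1))
    (h : u (lo r) < u (hi r)) :
    (inversions (u * simpleRefl r)).card = (inversions u).card + 1 := by
  rw [inversions_mul_simpleRefl u r h, Finset.card_insert_of_notMem, Finset.card_map]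
  have hs : (simpleRefl r).symm = simpleRefl r := simpleRefl_inv r
  simp only [Finset.mem_map_equiv, Equiv.prodCongr_symm, hs, Equiv.prodCongr_apply,
    Prod.map_apply, mem_inversions, simpleRefl_lo, simpleRefl_hi]
  simp [lo, hi]

theorem card_inversions_mul_of_gt (u : Equiv.Perm (Fin n)) (r : Fin (n - 1))
    (h : u (hi r) < u (lo r)) :
    (inversions (u * simpleRefl r)).card + 1 = (inversions u).card := by
  have := card_inversions_mul_of_lt (u * simpleRefl r) r (by simpa using h)
  rw [mul_assoc, simpleRefl_mul_self, mul_one] at this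
  exact this.symm

theorem eq_one_of_ascents (u : Equiv.Perm (Fin n)) (h : ∀ r, u (lo r) < u (hi r)) : u = 1 := by
  cases n with
  | zero => exact Subsingleton.elim _ _
  | succ m =>
    have hm : StrictMono u := Fin.strictMono_iff_lt_succ.2 fun i => h i
    let e : Fin (m + 1) ≃o Fin (m + 1) := hm.orderIsoOfSurjective _ u.surjective
    have he : e = OrderIso.refl _ := Subsingleton.elim _ _
    ext1 x
    exact DFunLike.congr_fun he x

/-- Bubble sort: removing a descent on the right lowers the inversion number by one, and a
permutation without descents is the identity. -/
theorem exists_word_length_inversions (u : Equiv.Perm (Fin n)) :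
    ∃ l : List (Fin (n - 1)), l.length = (inversions u).card ∧ wordProd l = u := by
  induction hk : (inversions u).card generalizing u with
  | zero =>
    refine ⟨[], rfl, ?_⟩
    refine (eq_one_of_ascents u fun r => ?_).symm
    by_contra hc
    have := card_inversions_mul_of_gt u r (lt_of_le_of_ne (not_lt.1 hc)
      fun he => lo_ne_hi r (u.injective he).symm)
    omega
  | succ k ih =>
    by_cases hu : ∀ r, u (lo r) < u (hi r)
    · rw [eq_one_of_ascents u hu] at hk
      rw [inversions_one] at hk
      simp at hk
    · push Not at hu
      obtain ⟨r, hr⟩ := hu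
      have h1 := card_inversions_mul_of_gt u r (lt_of_le_of_ne hr
        fun he => lo_ne_hi r (u.injective he).symm)
      obtain ⟨l, hl, hlu⟩ := ih (u * simpleRefl r) (by omega)
      exact ⟨l ++ [r], by simp [hl], by simp [hlu, mul_assoc]⟩

theorem card_inversions_one : (inversions (1 : Equiv.Perm (Fin n))).card = 0 := by
  rw [inversions_one, Finset.card_empty]

theorem card_inversions_mul_le (u : Equiv.Perm (Fin n)) (r : Fin (n - 1)) :
    (inversions (u * simpleRefl r)).card ≤ (inversions u).card + 1 := by
  rcases lt_or_gt_of_ne (fun he => lo_ne_hi r (u.injective he)) with h | h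
  · exact (card_inversions_mul_of_lt u r h).le
  · have := card_inversions_mul_of_gt u r h
    omega

theorem card_inversions_wordProd_le (l : List (Fin (n - 1))) :
    (inversions (wordProd l)).card ≤ l.length := by
  induction l using List.reverseRecOn with
  | nil => simp [card_inversions_one]
  | append_singleton l r ih =>
    have := card_inversions_mul_le (wordProd l) r
    simp only [wordProd_append, wordProd_cons, wordProd_nil, mul_one, List.length_append,
      List.length_singleton]
    omega

theorem len_eq_card_inversions (w : Equiv.Perm (Fin n)) : len w = (inversions w).card := by
  apply le_antisymm
  · exact Nat.sInf_le (exists_word_length_inversions w)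
  · obtain ⟨l, h1, h2⟩ := exists_reducedWord w
    rw [← h2, ← h1]
    exact card_inversions_wordProd_le l

theorem len_wordProd_le (l : List (Fin (n - 1))) : len (wordProd l) ≤ l.length :=
  Nat.sInf_le ⟨l, rfl, rfl⟩

theorem len_inv (w : Equiv.Perm (Fin n)) : len w⁻¹ = len w := by
  have key : ∀ w : Equiv.Perm (Fin n), len w⁻¹ ≤ len w := fun w => by
    obtain ⟨l, h1, h2⟩ := exists_reducedWord w
    rw [← h2, ← h1, ← wordProd_reverse, ← List.length_reverse]
    exact len_wordProd_le _
  exact le_antisymm (key w) (by simpa using key w⁻¹)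

theorem len_simpleRefl_mul_of_lt (w : Equiv.Perm (Fin n)) (r : Fin (n - 1))
    (h : w⁻¹ (lo r) < w⁻¹ (hi r)) : len (simpleRefl r * w) = len w + 1 := by
  rw [← len_inv, ← len_inv w, mul_inv_rev, simpleRefl_inv, len_eq_card_inversions,
    len_eq_card_inversions, card_inversions_mul_of_lt _ _ h]

theorem len_simpleRefl_mul_of_gt (w : Equiv.Perm (Fin n)) (r : Fin (n - 1))
    (h : w⁻¹ (hi r) < w⁻¹ (lo r)) : len (simpleRefl r * w) + 1 = len w := by
  rw [← len_inv, ← len_inv w, mul_inv_rev, simpleRefl_inv, len_eq_card_inversions,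
    len_eq_card_inversions, card_inversions_mul_of_gt _ _ h]

theorem descent_or_ascent (w : Equiv.Perm (Fin n)) (r : Fin (n - 1)) :
    w⁻¹ (lo r) < w⁻¹ (hi r) ∨ w⁻¹ (hi r) < w⁻¹ (lo r) :=
  lt_or_gt_of_ne fun he => lo_ne_hi r (w⁻¹.injective he)

theorem descent_of_len_lt (w : Equiv.Perm (Fin n)) (r : Fin (n - 1))
    (h : len (simpleRefl r * w) < len w) : w⁻¹ (hi r) < w⁻¹ (lo r) := by
  rcases descent_or_ascent w r with h1 | h1
  · have := len_simpleRefl_mul_of_lt w r h1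
    omega
  · exact h1

theorem len_one : len (1 : Equiv.Perm (Fin n)) = 0 := by
  rw [len_eq_card_inversions, card_inversions_one]

theorem eq_one_of_len_eq_zero {w : Equiv.Perm (Fin n)} (h : len w = 0) : w = 1 := by
  obtain ⟨l, h1, h2⟩ := exists_reducedWord w
  rw [h, List.length_eq_zero_iff] at h2
  rw [← h1, h2, wordProd_nil]

theorem longest_mul_longest : longest n * longest n = 1 := by
  ext1 x
  exact Fin.rev_rev x

theorem longest_inv : (longest n)⁻¹ = longest n := inv_eq_of_mul_eq_one_right longest_mul_longest

theorem card_pairs_lt :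
    (Finset.univ.filter fun p : Fin n × Fin n => p.1 < p.2).card = ∑ i : Fin n, (n - 1 - i.1) := by
  rw [Finset.card_filter, Fintype.sum_prod_type]
  refine Finset.sum_congr rfl fun i _ => ?_
  rw [← Fin.card_Ioi, ← Finset.card_filter]
  congr 1
  ext j
  simp

/-- Composing with the order reversal exchanges inversions and non-inversions, which together are
all pairs. -/
theorem len_longest_mul_add (w : Equiv.Perm (Fin n)) :
    len (longest n * w) + len w = ∑ i : Fin n, (n - 1 - i.1) := by
  rw [← card_pairs_lt, len_eq_card_inversions, len_eq_card_inversions,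
    ← Finset.card_filter_add_card_filter_not (s := Finset.univ.filter
      fun p : Fin n × Fin n => p.1 < p.2) (fun p => w p.1 < w p.2)]
  congr 2
  · ext ⟨a, b⟩
    simp [inversions, longest, Fin.rev_lt_rev]
  · ext ⟨a, b⟩
    simp only [inversions, Finset.mem_filter, Finset.mem_univ, true_and, not_lt]
    refine and_congr_right fun hab => ⟨le_of_lt, fun h => lt_of_le_of_ne h ?_⟩
    exact fun he => hab.ne (w.injective he).symm

theorem len_longest : len (longest n) = ∑ i : Fin n, (n - 1 - i.1) := by
  rw [← len_longest_mul_add 1, mul_one, len_one, add_zero]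

theorem len_le_len_longest (w : Equiv.Perm (Fin n)) : len w ≤ len (longest n) := by
  rw [len_longest, ← len_longest_mul_add w]
  omega

theorem eq_longest_of_len_eq {w : Equiv.Perm (Fin n)} (h : len w = len (longest n)) :
    w = longest n := by
  have h1 := len_longest_mul_add w
  rw [h, ← len_longest] at h1
  have h2 := eq_one_of_len_eq_zero (w := longest n * w) (by omega)
  rw [← mul_left_cancel_iff (a := longest n), h2, longest_mul_longest]

theorem IsReducedWord.tail {r : Fin (n - 1)} {l : List (Fin (n - 1))} {w : Equiv.Perm (Fin n)}
    (h : IsReducedWord (r :: l) w) :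
    IsReducedWord l (simpleRefl r * w) ∧ len (simpleRefl r * w) + 1 = len w := by
  obtain ⟨h1, h2⟩ := h
  have hl : wordProd l = simpleRefl r * w := by rw [← h1]; simp
  have h3 := len_wordProd_le l
  rw [List.length_cons] at h2
  rw [hl] at h3
  have : len w ≤ len (simpleRefl r * w) + 1 := by
    rcases descent_or_ascent w r with h4 | h4
    · have := len_simpleRefl_mul_of_lt w r h4
      omega
    · exact (len_simpleRefl_mul_of_gt w r h4).ge
  exact ⟨⟨hl, by omega⟩, by omega⟩

theorem IsReducedWord.cons {r : Fin (n - 1)} {l : List (Fin (n - 1))} {w : Equiv.Perm (Fin n)}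
    (h : IsReducedWord l (simpleRefl r * w)) (hw : len (simpleRefl r * w) + 1 = len w) :
    IsReducedWord (r :: l) w :=
  ⟨by simp [h.1], by rw [List.length_cons, h.2, hw]⟩

end Permutations

/-! ### Matsumoto's theorem for nilCoxeter generators. -/

section Matsumoto

variable {n : ℕ}

theorem simpleRefl_apply_of_ne {r : Fin (n - 1)} {a : Fin n} (h₁ : a.1 ≠ r.1)
    (h₂ : a.1 ≠ r.1 + 1) : simpleRefl r a = a := by
  ext
  rw [simpleRefl_val, if_neg h₁, if_neg h₂]

theorem simpleRefl_comm {r t : Fin (n - 1)} (h : r.1 + 1 < t.1 ∨ t.1 + 1 < r.1) :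
    simpleRefl r * simpleRefl t = simpleRefl t * simpleRefl r := by
  ext x
  simp only [Equiv.Perm.mul_apply, simpleRefl_val]
  split_ifs <;> omega

theorem simpleRefl_braid {r t : Fin (n - 1)} (h : t.1 = r.1 + 1) :
    simpleRefl r * (simpleRefl t * simpleRefl r) =
      simpleRefl t * (simpleRefl r * simpleRefl t) := by
  have e0 : lo t = hi r := by ext; simp [lo, hi, h]
  have e1 : simpleRefl t (lo r) = lo r :=
    simpleRefl_apply_of_ne (by simp only [lo]; omega) (by simp only [lo]; omega)
  have e2 : simpleRefl r (hi t) = hi t :=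
    simpleRefl_apply_of_ne (by simp only [hi]; omega) (by simp only [hi]; omega)
  have h1 : simpleRefl t * simpleRefl r = Equiv.swap (lo r) (hi t) * simpleRefl t := by
    conv_lhs => rw [simpleRefl.eq_1 r, Equiv.mul_swap_eq_swap_mul, e1, ← e0, simpleRefl_lo]
  have h2 : simpleRefl r * Equiv.swap (lo r) (hi t) = simpleRefl t * simpleRefl r := by
    rw [Equiv.mul_swap_eq_swap_mul, simpleRefl_lo, e2, ← e0]
    rfl
  rw [h1, ← mul_assoc, h2, mul_assoc]

/-- Elements `ψ_1, …, ψ_{n-1}` of a ring that satisfy the nilCoxeter relations. -/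
structure IsNilCoxeter {A : Type*} [Ring A] (ψ : Fin (n - 1) → A) : Prop where
  sq : ∀ r, ψ r * ψ r = 0
  comm : ∀ k r : Fin (n - 1), k.1 + 1 < r.1 → ψ r * ψ k = ψ k * ψ r
  braid : ∀ r t : Fin (n - 1), t.1 = r.1 + 1 → ψ r * ψ t * ψ r = ψ t * ψ r * ψ t

variable {A : Type*} [Ring A] {ψ : Fin (n - 1) → A}

/-- **Matsumoto's theorem** for the symmetric group, in the form that the product of nilCoxeter
generators along a reduced word only depends on the permutation. -/
theorem IsNilCoxeter.prod_eq (hψ : IsNilCoxeter ψ) {w : Equiv.Perm (Fin n)}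
    {l l' : List (Fin (n - 1))} (hl : IsReducedWord l w) (hl' : IsReducedWord l' w) :
    (l.map ψ).prod = (l'.map ψ).prod := by
  induction hk : len w using Nat.strong_induction_on generalizing w l l' with
  | _ k ih =>
  subst hk
  -- Distant first letters: both are descents of w, so w also has reduced words starting with s t
  -- and with t s and ending alike; the induction hypothesis compares the tails.
  have far : ∀ (s t : Fin (n - 1)) (a b : List (Fin (n - 1))), IsReducedWord (s :: a) w →
      IsReducedWord (t :: b) w → (s.1 + 1 < t.1 ∨ t.1 + 1 < s.1) →
      ((s :: a).map ψ).prod = ((t :: b).map ψ).prod := by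
    intro s t a b ha hb hst
    obtain ⟨ha1, ha2⟩ := ha.tail
    obtain ⟨hb1, hb2⟩ := hb.tail
    have dt := descent_of_len_lt w t (by omega)
    have e1 : simpleRefl s (hi t) = hi t :=
      simpleRefl_apply_of_ne (by simp only [hi]; omega) (by simp only [hi]; omega)
    have e2 : simpleRefl s (lo t) = lo t :=
      simpleRefl_apply_of_ne (by simp only [lo]; omega) (by simp only [lo]; omega)
    have h1 := len_simpleRefl_mul_of_gt (simpleRefl s * w) t
      (by simpa [mul_inv_rev, e1, e2] using dt)
    obtain ⟨c, hc⟩ := exists_reducedWord (simpleRefl t * (simpleRefl s * w))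
    have hca := hc.cons h1
    have hcomm : simpleRefl t * (simpleRefl s * w) = simpleRefl s * (simpleRefl t * w) := by
      rw [← mul_assoc, ← mul_assoc, simpleRefl_comm hst]
    rw [hcomm] at hc h1
    have hcb := hc.cons (by omega)
    have i1 := ih _ (by omega) ha1 hca rfl
    have i2 := ih _ (by omega) hb1 hcb rfl
    simp only [List.map_cons, List.prod_cons] at i1 i2 ⊢
    rw [i1, i2, ← mul_assoc, ← mul_assoc]
    rcases hst with h | h
    · rw [hψ.comm _ _ h]
    · rw [hψ.comm _ _ h]
  -- Adjacent first letters: the two descents force reduced words starting with s t s and with t s t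
  -- and ending alike.
  have near : ∀ (s t : Fin (n - 1)) (a b : List (Fin (n - 1))), IsReducedWord (s :: a) w →
      IsReducedWord (t :: b) w → t.1 = s.1 + 1 →
      ((s :: a).map ψ).prod = ((t :: b).map ψ).prod := by
    intro s t a b ha hb hst
    obtain ⟨ha1, ha2⟩ := ha.tail
    obtain ⟨hb1, hb2⟩ := hb.tail
    have ds := descent_of_len_lt w s (by omega)
    have dt := descent_of_len_lt w t (by omega)
    have e1 : simpleRefl s (hi t) = hi t :=
      simpleRefl_apply_of_ne (by simp only [hi]; omega) (by simp only [hi]; omega)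
    have e0 : lo t = hi s := by ext; simp [lo, hi, hst]
    have e2 : simpleRefl t (lo s) = lo s :=
      simpleRefl_apply_of_ne (by simp only [lo]; omega) (by simp only [lo]; omega)
    have e3 : simpleRefl t (hi s) = hi t := by rw [← e0, simpleRefl_lo]
    have h1 := len_simpleRefl_mul_of_gt (simpleRefl s * w) t
      (by simpa [mul_inv_rev, e1, e0] using (dt.trans (e0 ▸ ds)))
    have h2 := len_simpleRefl_mul_of_gt (simpleRefl t * (simpleRefl s * w)) s
      (by simpa [mul_inv_rev, e1, e2, e3] using (e0 ▸ dt))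
    obtain ⟨c, hc⟩ := exists_reducedWord (simpleRefl s * (simpleRefl t * (simpleRefl s * w)))
    have hca := (hc.cons h2).cons h1
    have hbr : simpleRefl s * (simpleRefl t * (simpleRefl s * w)) =
        simpleRefl t * (simpleRefl s * (simpleRefl t * w)) := by
      simpa only [mul_assoc] using congrArg (· * w) (simpleRefl_braid hst)
    -- The total drop along t s t equals that along s t s, namely three; each step drops by at most
    -- one, so every step drops by exactly one.
    have key : len (simpleRefl s * (simpleRefl t * w)) + 1 = len (simpleRefl t * w) ∧
        len (simpleRefl t * (simpleRefl s * (simpleRefl t * w))) + 1 =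
          len (simpleRefl s * (simpleRefl t * w)) := by
      rw [← hbr]
      have bd : ∀ (r : Fin (n - 1)) (u : Equiv.Perm (Fin n)),
          len u ≤ len (simpleRefl r * u) + 1 := fun r u => by
        rcases descent_or_ascent u r with h | h
        · have := len_simpleRefl_mul_of_lt u r h
          omega
        · exact (len_simpleRefl_mul_of_gt u r h).ge
      have b1 := bd s (simpleRefl t * w)
      have b2 := bd t (simpleRefl s * (simpleRefl t * w))
      rw [← hbr] at b2
      constructor <;> omega
    rw [hbr] at hc
    have hcb := (hc.cons key.2).cons key.1
    have i1 := ih _ (by omega) ha1 hca rfl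
    have i2 := ih _ (by omega) hb1 hcb rfl
    simp only [List.map_cons, List.prod_cons] at i1 i2 ⊢
    rw [i1, i2, ← mul_assoc, ← mul_assoc, hψ.braid _ _ hst]
    simp only [mul_assoc]
  match l, l', hl, hl' with
  | [], l', hl, hl' =>
    have : l' = [] := by rw [← List.length_eq_zero_iff, hl'.2, ← hl.2]; rfl
    rw [this]
  | s :: a, [], hl, hl' =>
    exact absurd (hl.2.trans hl'.2.symm) (by simp)
  | s :: a, t :: b, hl, hl' =>
    rcases lt_trichotomy s.1 t.1 with h | h | h
    · rcases (Nat.succ_le_of_lt h).lt_or_eq with h' | h'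
      · exact far s t a b hl hl' (Or.inl h')
      · exact near s t a b hl hl' h'.symm
    · obtain rfl : s = t := Fin.ext h
      have h2 := hl.tail
      rw [List.map_cons, List.prod_cons, List.map_cons, List.prod_cons,
        ih _ (by omega) h2.1 hl'.tail.1 rfl]
    · rcases (Nat.succ_le_of_lt h).lt_or_eq with h' | h'
      · exact far s t a b hl hl' (Or.inr h')
      · exact (near t s b a hl' hl h'.symm).symm

/-- The product of nilCoxeter generators along a word that is not reduced vanishes. -/
theorem IsNilCoxeter.prod_eq_zero (hψ : IsNilCoxeter ψ) {l : List (Fin (n - 1))}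
    (hl : l.length ≠ len (wordProd l)) : (l.map ψ).prod = 0 := by
  induction l with
  | nil => simp [len_one] at hl
  | cons r l ih =>
    rw [List.map_cons, List.prod_cons]
    by_cases h : l.length = len (wordProd l)
    -- Here `l` is reduced but `r :: l` is not, so r is a descent; rewriting `l` to start with r
    -- produces the factor ψ_r² = 0.
    · have hgt := (descent_or_ascent (wordProd l) r).resolve_left fun h1 => hl (by
        rw [wordProd_cons, len_simpleRefl_mul_of_lt _ _ h1, List.length_cons, h])
      obtain ⟨c, hc⟩ := exists_reducedWord (simpleRefl r * wordProd l)
      rw [hψ.prod_eq ⟨rfl, h⟩ (hc.cons (len_simpleRefl_mul_of_gt _ _ hgt)), List.map_cons,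
        List.prod_cons, ← mul_assoc, hψ.sq, zero_mul]
    · rw [ih h, mul_zero]

end Matsumoto

/-! ### Divided differences and the coinvariant ideal. -/

section DividedDifferences

open MvPolynomial

variable {K : Type*} [Field K] {n : ℕ}

/-- The action of the simple transposition `s_r` on polynomials. -/
abbrev polyRefl (r : Fin (n - 1)) : MvPolynomial (Fin n) K →ₐ[K] MvPolynomial (Fin n) K :=
  rename (simpleRefl r)

/-- The linear form `x_{r+1} - x_r`. -/
abbrev polyRoot (r : Fin (n - 1)) : MvPolynomial (Fin n) K := X (hi r) - X (lo r)

theorem polyRoot_ne_zero (r : Fin (n - 1)) : (polyRoot r : MvPolynomial (Fin n) K) ≠ 0 :=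
  sub_ne_zero.2 fun h => lo_ne_hi r (X_injective h).symm

/-- The twisted Leibniz rule pX − s(pX) = (p − sp)X + s(p)(X − sX) reduces divisibility to the
variables. -/
theorem exists_divDiff (r : Fin (n - 1)) (p : MvPolynomial (Fin n) K) :
    ∃ q, polyRoot r * q = p - polyRefl r p := by
  induction p using MvPolynomial.induction_on with
  | C c => exact ⟨0, by simp⟩
  | add p q hp hq =>
    obtain ⟨a, ha⟩ := hp
    obtain ⟨b, hb⟩ := hq
    exact ⟨a + b, by rw [mul_add, ha, hb, map_add]; ring⟩
  | mul_X p i hp =>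
    obtain ⟨a, ha⟩ := hp
    have hX : ∃ q, polyRoot r * q = (X i - X (simpleRefl r i) : MvPolynomial (Fin n) K) := by
      by_cases h1 : i = lo r
      · exact ⟨-1, by rw [h1, simpleRefl_lo]; ring⟩
      · by_cases h2 : i = hi r
        · exact ⟨1, by rw [h2, simpleRefl_hi]; ring⟩
        · refine ⟨0, ?_⟩
          rw [simpleRefl_apply_of_ne (fun h => h1 (Fin.ext h)) (fun h => h2 (Fin.ext h))]
          ring
    obtain ⟨b, hb⟩ := hX
    refine ⟨a * X i + polyRefl r p * b, ?_⟩
    rw [map_mul, rename_X]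
    linear_combination X i * ha + polyRefl r p * hb

/-- The divided difference operator `p ↦ (p - s_r p) / (x_{r+1} - x_r)`. -/
def divDiff (r : Fin (n - 1)) : MvPolynomial (Fin n) K →ₗ[K] MvPolynomial (Fin n) K where
  toFun p := (exists_divDiff r p).choose
  map_add' p q := by
    apply mul_left_cancel₀ (polyRoot_ne_zero r)
    rw [mul_add, (exists_divDiff r p).choose_spec, (exists_divDiff r q).choose_spec,
      (exists_divDiff r (p + q)).choose_spec, map_add]
    ring
  map_smul' c p := by
    apply mul_left_cancel₀ (polyRoot_ne_zero r)
    rw [RingHom.id_apply, mul_smul_comm, (exists_divDiff r p).choose_spec,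
      (exists_divDiff r (c • p)).choose_spec, map_smul, smul_sub]

theorem polyRoot_mul_divDiff (r : Fin (n - 1)) (p : MvPolynomial (Fin n) K) :
    polyRoot r * divDiff r p = p - polyRefl r p :=
  (exists_divDiff r p).choose_spec

theorem divDiff_eq_iff {r : Fin (n - 1)} {p q : MvPolynomial (Fin n) K} :
    divDiff r p = q ↔ p - polyRefl r p = polyRoot r * q := by
  rw [← polyRoot_mul_divDiff, mul_right_inj' (polyRoot_ne_zero r)]

theorem polyRefl_polyRefl (r : Fin (n - 1)) (p : MvPolynomial (Fin n) K) :
    polyRefl r (polyRefl r p) = p := by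
  rw [rename_rename]
  have : (simpleRefl r ∘ simpleRefl r : Fin n → Fin n) = id := by
    rw [← Equiv.Perm.coe_mul, simpleRefl_mul_self, Equiv.Perm.coe_one]
  rw [this, rename_id_apply]

theorem polyRefl_polyRoot_self (r : Fin (n - 1)) :
    polyRefl r (polyRoot r : MvPolynomial (Fin n) K) = -polyRoot r := by
  simp

theorem divDiff_mul (r : Fin (n - 1)) (p q : MvPolynomial (Fin n) K) :
    divDiff r (p * q) = polyRefl r p * divDiff r q + divDiff r p * q := by
  rw [divDiff_eq_iff, map_mul]
  linear_combination -polyRefl r p * polyRoot_mul_divDiff r q - q * polyRoot_mul_divDiff r p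

theorem polyRefl_eq_self_of_divDiff {r : Fin (n - 1)} {p : MvPolynomial (Fin n) K}
    (h : divDiff r p = 0) : polyRefl r p = p := by
  rw [divDiff_eq_iff, mul_zero, sub_eq_zero] at h
  exact h.symm

theorem divDiff_eq_zero {r : Fin (n - 1)} {p : MvPolynomial (Fin n) K}
    (h : polyRefl r p = p) : divDiff r p = 0 := by
  rw [divDiff_eq_iff, h, sub_self, mul_zero]

theorem divDiff_mul_of_invariant {r : Fin (n - 1)} {p : MvPolynomial (Fin n) K}
    (h : polyRefl r p = p) (q : MvPolynomial (Fin n) K) :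
    divDiff r (p * q) = p * divDiff r q := by
  rw [divDiff_mul, h, divDiff_eq_zero h, zero_mul, add_zero]

theorem divDiff_X_hi (r : Fin (n - 1)) : divDiff r (X (hi r) : MvPolynomial (Fin n) K) = 1 := by
  rw [divDiff_eq_iff, rename_X, simpleRefl_hi, mul_one]

theorem divDiff_X_lo (r : Fin (n - 1)) : divDiff r (X (lo r) : MvPolynomial (Fin n) K) = -1 := by
  rw [divDiff_eq_iff, rename_X, simpleRefl_lo]
  ring

theorem divDiff_X_of_ne {r : Fin (n - 1)} {k : Fin n} (h₁ : k ≠ lo r) (h₂ : k ≠ hi r) :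
    divDiff r (X k : MvPolynomial (Fin n) K) = 0 :=
  divDiff_eq_zero (by
    rw [rename_X, simpleRefl_apply_of_ne (fun h => h₁ (Fin.ext h)) (fun h => h₂ (Fin.ext h))])

/-- Numerator and denominator both change sign under s_r. -/
theorem polyRefl_divDiff_self (r : Fin (n - 1)) (p : MvPolynomial (Fin n) K) :
    polyRefl r (divDiff r p) = divDiff r p := by
  apply mul_left_cancel₀ (polyRoot_ne_zero r)
  have h := congrArg (polyRefl r) (polyRoot_mul_divDiff r p)
  rw [map_mul, polyRefl_polyRoot_self, map_sub, polyRefl_polyRefl] at h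
  linear_combination -h - polyRoot_mul_divDiff r p

theorem polyRefl_comm {r k : Fin (n - 1)} (h : k.1 + 1 < r.1) (p : MvPolynomial (Fin n) K) :
    polyRefl r (polyRefl k p) = polyRefl k (polyRefl r p) := by
  rw [rename_rename, rename_rename, ← Equiv.Perm.coe_mul, ← Equiv.Perm.coe_mul,
    simpleRefl_comm (Or.inl h)]

theorem polyRefl_polyRoot_far {r k : Fin (n - 1)} (h : k.1 + 1 < r.1 ∨ r.1 + 1 < k.1) :
    polyRefl r (polyRoot k : MvPolynomial (Fin n) K) = polyRoot k := by
  rw [map_sub, rename_X, rename_X, simpleRefl_apply_of_ne, simpleRefl_apply_of_ne] <;>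
  simp only [lo, hi] <;> omega

theorem divDiff_comm {k r : Fin (n - 1)} (h : k.1 + 1 < r.1) (p : MvPolynomial (Fin n) K) :
    divDiff r (divDiff k p) = divDiff k (divDiff r p) := by
  have h1 : divDiff r (polyRefl k p) = polyRefl k (divDiff r p) := by
    rw [divDiff_eq_iff]
    have := congrArg (polyRefl k) (polyRoot_mul_divDiff r p)
    rw [map_mul, polyRefl_polyRoot_far (Or.inr h), map_sub, ← polyRefl_comm h] at this
    exact this.symm
  apply mul_left_cancel₀ (polyRoot_ne_zero k)
  rw [polyRoot_mul_divDiff, ← divDiff_mul_of_invariant (polyRefl_polyRoot_far (Or.inl h)),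
    polyRoot_mul_divDiff, map_sub, h1]

/-- With denominators cleared, the triple operator becomes the alternating sum over the symmetric
group on three letters, symmetric in s and t once sts = tst. The extra factor a on both sides is
needed because D f and s(D f) are compared only after multiplication by a; no cancellation is
available in R. -/
theorem divided_difference_braid_expansion {R : Type*} [CommRing R] (s t : R →+* R)
    (D E : R → R) {a b c : R} (hD : ∀ f, a * D f = f - s f) (hE : ∀ f, b * E f = f - t f)
    (hs : ∀ f, s (s f) = f) (sa : s a = -a) (sb : s b = c) (sc : s c = b) (ta : t a = c)
    (hc : c = a + b) (f : R) :
    a * (a * b * c * D (E (D f))) =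
      a * (f - s f - t f + t (s f) + s (t f) - s (t (s f))) := by
  have h1 := hD f
  have h1t := congrArg t h1
  have h1s := congrArg s h1
  have h2 := hE (D f)
  have h2s := congrArg s h2
  have h3 := hD (E (D f))
  simp only [map_mul, map_sub, sa, sb, ta, hs] at h1t h1s h2s
  have h1st := congrArg s h1t
  simp only [map_mul, map_sub, sc] at h1st
  linear_combination a * b * c * h3 + a * c * h2 + c * h1 - a * h1t - a * b * h2s + b * h1s +
    a * h1st + (f - s f) * hc

theorem divDiff_braid {r t : Fin (n - 1)} (h : t.1 = r.1 + 1) (p : MvPolynomial (Fin n) K) :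
    divDiff r (divDiff t (divDiff r p)) = divDiff t (divDiff r (divDiff t p)) := by
  have e0 : lo t = hi r := by ext; simp [lo, hi, h]
  have e1 : simpleRefl t (lo r) = lo r :=
    simpleRefl_apply_of_ne (by simp only [lo]; omega) (by simp only [lo]; omega)
  have e2 : simpleRefl r (hi t) = hi t :=
    simpleRefl_apply_of_ne (by simp only [hi]; omega) (by simp only [hi]; omega)
  have e3 : simpleRefl t (hi r) = hi t := by rw [← e0, simpleRefl_lo]
  set c : MvPolynomial (Fin n) K := X (hi t) - X (lo r) with hc
  have hc0 : c ≠ 0 := sub_ne_zero.2 fun h' => by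
    have := congrArg Fin.val (X_injective h')
    simp only [lo, hi] at this
    omega
  have H1 := divided_difference_braid_expansion (polyRefl r : _ →ₐ[K] _).toRingHom
    (polyRefl t : _ →ₐ[K] _).toRingHom (divDiff r) (divDiff t) (a := polyRoot r)
    (b := polyRoot t) (c := c) (polyRoot_mul_divDiff r) (polyRoot_mul_divDiff t)
    (polyRefl_polyRefl r) (polyRefl_polyRoot_self r) (by simp [e0, e2, hc])
    (by simp [e0, e2, hc]) (by simp [e1, e3, hc]) (by rw [hc, polyRoot, polyRoot, e0]; ring) p
  have H2 := divided_difference_braid_expansion (polyRefl t : _ →ₐ[K] _).toRingHom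
    (polyRefl r : _ →ₐ[K] _).toRingHom (divDiff t) (divDiff r) (a := polyRoot t)
    (b := polyRoot r) (c := c) (polyRoot_mul_divDiff t) (polyRoot_mul_divDiff r)
    (polyRefl_polyRefl t) (polyRefl_polyRoot_self t) (by simp [e1, e3, hc])
    (by simp [e1, hc, ← e0]) (by simp [e0, e2, hc]) (by rw [hc, polyRoot, polyRoot, e0]; ring) p
  replace H1 := mul_left_cancel₀ (polyRoot_ne_zero r) H1
  replace H2 := mul_left_cancel₀ (polyRoot_ne_zero t) H2
  have hb : polyRefl r (polyRefl t (polyRefl r p)) = polyRefl t (polyRefl r (polyRefl t p)) := by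
    simp only [rename_rename, ← Equiv.Perm.coe_mul]
    rw [simpleRefl_braid h]
  simp only [AlgHom.toRingHom_eq_coe, RingHom.coe_coe] at H1 H2
  have hne : polyRoot r * polyRoot t * c ≠ 0 :=
    mul_ne_zero (mul_ne_zero (polyRoot_ne_zero r) (polyRoot_ne_zero t)) hc0
  apply mul_left_cancel₀ hne
  rw [H1, mul_comm (polyRoot r), H2, hb]
  ring

theorem isNilCoxeter_divDiff :
    IsNilCoxeter (A := Module.End K (MvPolynomial (Fin n) K)) divDiff where
  sq r := LinearMap.ext fun p => divDiff_eq_zero (polyRefl_divDiff_self r p)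
  comm _ _ h := LinearMap.ext fun p => divDiff_comm h p
  braid _ _ h := LinearMap.ext fun p => divDiff_braid h p

theorem isSymmetric_of_polyRefl {p : MvPolynomial (Fin n) K} (h : ∀ r, polyRefl r p = p) :
    p.IsSymmetric := by
  intro w
  obtain ⟨l, rfl⟩ := exists_word w
  induction l with
  | nil => simp
  | cons r l ih =>
    rw [wordProd_cons, Equiv.Perm.coe_mul, ← rename_rename, ih]
    exact h r

/-- One more letter makes the word too long to be reduced, so every ∂_r kills the result, and ∂_r p
= 0 means that p is s_r-invariant. -/
theorem isSymmetric_divDiff_longest {l : List (Fin (n - 1))} (hl : IsReducedWord l (longest n))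
    (p : MvPolynomial (Fin n) K) : ((l.map divDiff).prod p).IsSymmetric := by
  refine isSymmetric_of_polyRefl fun r => polyRefl_eq_self_of_divDiff ?_
  have : ((r :: l).map (divDiff (K := K))).prod = 0 := isNilCoxeter_divDiff.prod_eq_zero (by
    have := len_le_len_longest (wordProd (r :: l))
    rw [List.length_cons, hl.2]
    omega)
  rw [List.map_cons, List.prod_cons] at this
  exact DFunLike.congr_fun this p

/-- X_i is a root of ∏ (T − X_j), expanded by Vieta's formula. -/
theorem sum_esymm_mul_X_pow (i : Fin n) :
    ∑ j ∈ Finset.range (n + 1), (-1) ^ j *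
      (esymm (Fin n) K j * (X i : MvPolynomial (Fin n) K) ^ (n - j)) = 0 := by
  have h := congrArg (Polynomial.eval (X i))
    (Multiset.prod_X_sub_X_eq_sum_esymm
      (Finset.univ.val.map (X : Fin n → MvPolynomial (Fin n) K)))
  rw [Multiset.card_map, Finset.card_val, Finset.card_univ, Fintype.card_fin,
    ← esymm_eq_multiset_esymm, Polynomial.eval_finsetSum] at h
  simp only [Polynomial.eval_mul, Polynomial.eval_pow, Polynomial.eval_neg, Polynomial.eval_one,
    Polynomial.eval_C, Polynomial.eval_X] at h
  rw [← h, Multiset.map_map]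
  change Polynomial.eval (X i) (∏ j : Fin n, (Polynomial.X - Polynomial.C (X j))) = 0
  rw [Polynomial.eval_prod]
  exact Finset.prod_eq_zero (Finset.mem_univ i) (by simp)

variable (K n) in
/-- The ideal generated by the symmetric polynomials without constant term. -/
def coinvariantIdeal : Ideal (MvPolynomial (Fin n) K) :=
  Ideal.span {p | p.IsSymmetric ∧ constantCoeff p = 0}

theorem divDiff_mem_coinvariantIdeal (r : Fin (n - 1)) {p : MvPolynomial (Fin n) K}
    (hp : p ∈ coinvariantIdeal K n) : divDiff r p ∈ coinvariantIdeal K n := by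
  induction hp using Submodule.span_induction with
  | mem x hx =>
    rw [divDiff_eq_zero (hx.1 (simpleRefl r))]
    exact zero_mem _
  | zero => rw [map_zero]; exact zero_mem _
  | add x y _ _ hx hy => rw [map_add]; exact add_mem hx hy
  | smul a x hx' hx =>
    rw [smul_eq_mul, divDiff_mul]
    exact add_mem (Ideal.mul_mem_left _ _ hx) (Ideal.mul_mem_left _ _ hx')

theorem constantCoeff_esymm {j : ℕ} (hj : j ≠ 0) : constantCoeff (esymm (Fin n) K j) = 0 := by
  rw [esymm, map_sum]
  refine Finset.sum_eq_zero fun t ht => ?_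
  rw [map_prod]
  obtain ⟨i, hi⟩ : t.Nonempty := by
    rw [← Finset.card_pos, (Finset.mem_powersetCard.1 ht).2]
    omega
  exact Finset.prod_eq_zero hi (by simp)

theorem one_notMem_coinvariantIdeal : (1 : MvPolynomial (Fin n) K) ∉ coinvariantIdeal K n := by
  have h : coinvariantIdeal K n ≤ RingHom.ker (constantCoeff (R := K)) :=
    Ideal.span_le.2 fun p hp => hp.2
  intro h1
  simpa using h h1

/-- Vieta's relation expresses X_i^n through elementary symmetric polynomials of positive degree.
This is where n ≤ ℓ makes the cyclotomic relation hold on the coinvariants. -/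
theorem X_pow_mem_coinvariantIdeal (i : Fin n) {ℓ : ℕ} (h : n ≤ ℓ) :
    (X i : MvPolynomial (Fin n) K) ^ ℓ ∈ coinvariantIdeal K n := by
  refine Ideal.mem_of_dvd _ (pow_dvd_pow _ h) ?_
  have h0 := sum_esymm_mul_X_pow (K := K) i
  rw [Finset.sum_range_succ'] at h0
  simp only [pow_zero, esymm_zero, one_mul, Nat.sub_zero] at h0
  rw [← add_eq_zero_iff_neg_eq.1 h0]
  refine neg_mem (sum_mem fun j _ => Ideal.mul_mem_left _ _ (Ideal.mul_mem_right _ _ ?_))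
  exact Ideal.subset_span ⟨esymm_isSymmetric _ _ _, constantCoeff_esymm (by omega)⟩

end DividedDifferences

/-! ### The defining relations inside H. -/

section Relations

variable {K : Type*} [Field K] {ℓ n : ℕ}

theorem mk_eq_of_rel {a b : FreeAlgebra K (Gen n)} (h : Rel K ℓ n a b) :
    mk K ℓ n a = mk K ℓ n b :=
  RingQuot.mkAlgHom_rel K h

theorem psi_mul_self (r : Fin (n - 1)) : psi K ℓ n r * psi K ℓ n r = 0 := by
  simpa [psi, y, gen] using mk_eq_of_rel (Rel.psi_sq (K := K) (ℓ := ℓ) r)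

theorem psi_mul_psi_comm {k r : Fin (n - 1)} (h : k.1 + 1 < r.1) :
    psi K ℓ n r * psi K ℓ n k = psi K ℓ n k * psi K ℓ n r := by
  simpa [psi, y, gen] using mk_eq_of_rel (Rel.psi_comm (K := K) (ℓ := ℓ) k r h)

theorem psi_braid {r t : Fin (n - 1)} (h : t.1 = r.1 + 1) :
    psi K ℓ n r * psi K ℓ n t * psi K ℓ n r = psi K ℓ n t * psi K ℓ n r * psi K ℓ n t := by
  simpa [psi, y, gen] using mk_eq_of_rel (Rel.braid (K := K) (ℓ := ℓ) r t h)

theorem y_mul_y_comm (r k : Fin n) : y K ℓ n r * y K ℓ n k = y K ℓ n k * y K ℓ n r := by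
  simpa [psi, y, gen] using mk_eq_of_rel (Rel.y_comm (K := K) (ℓ := ℓ) r k)

theorem psi_mul_y_of_ne {r : Fin (n - 1)} {k : Fin n} (h₁ : k ≠ lo r) (h₂ : k ≠ hi r) :
    psi K ℓ n r * y K ℓ n k = y K ℓ n k * psi K ℓ n r := by
  simpa [psi, y, gen] using mk_eq_of_rel (Rel.psi_y_far (K := K) (ℓ := ℓ) r k h₁ h₂)

theorem psi_mul_y_hi (r : Fin (n - 1)) :
    psi K ℓ n r * y K ℓ n (hi r) = y K ℓ n (lo r) * psi K ℓ n r + 1 := by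
  simpa [psi, y, gen] using mk_eq_of_rel (Rel.psi_y (K := K) (ℓ := ℓ) r)

theorem y_hi_mul_psi (r : Fin (n - 1)) :
    y K ℓ n (hi r) * psi K ℓ n r = psi K ℓ n r * y K ℓ n (lo r) + 1 := by
  simpa [psi, y, gen] using mk_eq_of_rel (Rel.y_psi (K := K) (ℓ := ℓ) r)

theorem psi_mul_y_lo (r : Fin (n - 1)) :
    psi K ℓ n r * y K ℓ n (lo r) = y K ℓ n (hi r) * psi K ℓ n r - 1 := by
  rw [y_hi_mul_psi, add_sub_cancel_right]

theorem y_zero_pow {i : Fin n} (h : i.1 = 0) : y K ℓ n i ^ ℓ = 0 := by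
  simpa [psi, y, gen] using mk_eq_of_rel (Rel.cyclotomic (K := K) (ℓ := ℓ) i h)

theorem isNilCoxeter_psi : IsNilCoxeter (psi K ℓ n) where
  sq := psi_mul_self
  comm _ _ := psi_mul_psi_comm
  braid _ _ := psi_braid

/-- Induction over the generators, multiplying from the left. -/
theorem gen_induction {P : H K ℓ n → Prop} (one : P 1)
    (add : ∀ a b, P a → P b → P (a + b)) (smul : ∀ (c : K) a, P a → P (c • a))
    (psi_mul : ∀ r a, P a → P (psi K ℓ n r * a)) (y_mul : ∀ i a, P a → P (y K ℓ n i * a))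
    (h : H K ℓ n) : P h := by
  obtain ⟨x, rfl⟩ : ∃ x, mk K ℓ n x = h := RingQuot.mkAlgHom_surjective K (Rel K ℓ n) h
  -- The arbitrary right factor a lets the induction pass through products in the free algebra.
  have key : ∀ a, P a → P (mk K ℓ n x * a) := by
    induction x using FreeAlgebra.induction with
    | grade0 c =>
      intro a ha
      rw [AlgHom.commutes, ← Algebra.smul_def]
      exact smul c a ha
    | grade1 g =>
      intro a ha
      cases g with
      | inl r => exact psi_mul r a ha
      | inr i => exact y_mul i a ha
    | mul p q hp hq =>
      intro a ha
      rw [map_mul, mul_assoc]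
      exact hp _ (hq _ ha)
    | add p q hp hq =>
      intro a ha
      rw [map_add, add_mul]
      exact add _ _ (hp _ ha) (hq _ ha)
  have := key 1 one
  rwa [mul_one] at this

end Relations

/-! ### The action on the coinvariant algebra, and H ≠ 0. -/

section Representation

open MvPolynomial

variable (K : Type*) [Field K] (n : ℕ)

/-- The coinvariant ideal as a `K`-subspace. -/
def coinvariantSubspace : Submodule K (MvPolynomial (Fin n) K) :=
  (coinvariantIdeal K n).restrictScalars K

theorem mem_coinvariantSubspace {p : MvPolynomial (Fin n) K} :
    p ∈ coinvariantSubspace K n ↔ p ∈ coinvariantIdeal K n := Iff.rfl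

/-- The action of the generators on the coinvariants. -/
def coinvariantGen : Gen n →
    Module.End K (MvPolynomial (Fin n) K ⧸ coinvariantSubspace K n)
  | Sum.inl r => (coinvariantSubspace K n).mapQ _ (divDiff r)
      fun _ hp => divDiff_mem_coinvariantIdeal r hp
  | Sum.inr i => (coinvariantSubspace K n).mapQ _ (LinearMap.mulLeft K (X i))
      fun _ hp => Ideal.mul_mem_left _ _ hp

theorem coinvariantGen_rel {ℓ : ℕ} (h : n ≤ ℓ) {a b : FreeAlgebra K (Gen n)}
    (hab : Rel K ℓ n a b) : FreeAlgebra.lift K (coinvariantGen K n) a =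
      FreeAlgebra.lift K (coinvariantGen K n) b := by
  have pow : ∀ (i : Fin n) (m : ℕ), coinvariantGen K n (Sum.inr i) ^ m =
      (coinvariantSubspace K n).mapQ _ (LinearMap.mulLeft K (X i ^ m))
        fun _ hp => Ideal.mul_mem_left _ _ hp := by
    intro i m
    induction m with
    | zero => apply Submodule.linearMap_qext; refine LinearMap.ext fun p => ?_; simp
    | succ m ih =>
      rw [pow_succ, ih]
      apply Submodule.linearMap_qext
      refine LinearMap.ext fun p => ?_
      exact congrArg (coinvariantSubspace K n).mkQ
        (by simp only [LinearMap.mulLeft_apply, pow_succ, mul_assoc])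
  have hq : ∀ p q : MvPolynomial (Fin n) K, p = q →
      (coinvariantSubspace K n).mkQ p = (coinvariantSubspace K n).mkQ q := fun _ _ => congrArg _
  induction hab with
  | psi_sq r =>
    apply Submodule.linearMap_qext
    refine LinearMap.ext fun p => ?_
    simp only [map_mul, map_zero, FreeAlgebra.lift_ι_apply]
    exact hq _ _ (divDiff_eq_zero (polyRefl_divDiff_self r p))
  | psi_comm k r h =>
    apply Submodule.linearMap_qext
    refine LinearMap.ext fun p => ?_
    simp only [map_mul, FreeAlgebra.lift_ι_apply]
    exact hq _ _ (divDiff_comm h p)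
  | braid r t h =>
    apply Submodule.linearMap_qext
    refine LinearMap.ext fun p => ?_
    simp only [map_mul, FreeAlgebra.lift_ι_apply]
    exact hq _ _ (divDiff_braid h p)
  | y_comm r k =>
    apply Submodule.linearMap_qext
    refine LinearMap.ext fun p => ?_
    simp only [map_mul, FreeAlgebra.lift_ι_apply]
    exact hq _ _ (mul_left_comm (X r) (X k) p)
  | psi_y_far r k h₁ h₂ =>
    apply Submodule.linearMap_qext
    refine LinearMap.ext fun p => ?_
    have := divDiff_mul r (X k) p
    rw [divDiff_X_of_ne h₁ h₂, rename_X, simpleRefl_apply_of_ne (fun h => h₁ (Fin.ext h))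
      (fun h => h₂ (Fin.ext h)), zero_mul, add_zero] at this
    simp only [map_mul, FreeAlgebra.lift_ι_apply]
    exact hq _ _ this
  | psi_y r =>
    apply Submodule.linearMap_qext
    refine LinearMap.ext fun p => ?_
    have := divDiff_mul r (X (hi r)) p
    rw [divDiff_X_hi, rename_X, simpleRefl_hi, one_mul] at this
    simp only [map_mul, map_add, map_one, FreeAlgebra.lift_ι_apply]
    exact hq _ _ this
  | y_psi r =>
    apply Submodule.linearMap_qext
    refine LinearMap.ext fun p => ?_
    have := divDiff_mul r (X (lo r)) p
    rw [divDiff_X_lo, rename_X, simpleRefl_lo, neg_one_mul, ← sub_eq_add_neg,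
      eq_sub_iff_add_eq] at this
    simp only [map_mul, map_add, map_one, FreeAlgebra.lift_ι_apply]
    exact hq _ _ this.symm
  | cyclotomic i hi =>
    rw [map_pow, FreeAlgebra.lift_ι_apply, pow, map_zero]
    apply Submodule.linearMap_qext
    refine LinearMap.ext fun p => ?_
    exact (Submodule.Quotient.mk_eq_zero _).2
      (Ideal.mul_mem_right p _ (X_pow_mem_coinvariantIdeal i h))

variable {K n}

theorem nontrivial_H {ℓ : ℕ} (h : n ≤ ℓ) : Nontrivial (H K ℓ n) := by
  let φ : H K ℓ n →ₐ[K] Module.End K (MvPolynomial (Fin n) K ⧸ coinvariantSubspace K n) :=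
    RingQuot.liftAlgHom K ⟨FreeAlgebra.lift K (coinvariantGen K n),
      fun _ _ hab => coinvariantGen_rel K n h hab⟩
  have : Nontrivial (MvPolynomial (Fin n) K ⧸ coinvariantSubspace K n) :=
    Submodule.Quotient.nontrivial_iff.2 fun hT =>
      one_notMem_coinvariantIdeal (K := K) (n := n)
        (by rw [← mem_coinvariantSubspace, hT]; trivial)
  exact φ.toRingHom.domain_nontrivial

end Representation

/-! ### Polynomials in the y_i: commutation with ψ_r, centrality, nilpotency. -/

section PolynomialSubalgebra

open MvPolynomial

variable (K : Type*) [Field K] (ℓ n : ℕ)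

/-- The commutative subalgebra generated by `y_1, …, y_n`. -/
abbrev yAlg : Subalgebra K (H K ℓ n) := Algebra.adjoin K (Set.range (y K ℓ n))

instance : CommRing (yAlg K ℓ n) where
  mul_comm := (Algebra.isMulCommutative_adjoin K
    (by rintro _ ⟨i, rfl⟩ _ ⟨j, rfl⟩; exact y_mul_y_comm i j)).is_comm.comm

/-- The substitution of `y_1, …, y_n` into a polynomial. -/
def polyHom : MvPolynomial (Fin n) K →ₐ[K] H K ℓ n :=
  (yAlg K ℓ n).val.comp
    (aeval fun i => (⟨y K ℓ n i, Algebra.subset_adjoin ⟨i, rfl⟩⟩ : yAlg K ℓ n))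

variable {K ℓ n}

@[simp] theorem polyHom_X (i : Fin n) : polyHom K ℓ n (X i) = y K ℓ n i := by
  simp [polyHom]

theorem polyHom_C (c : K) : polyHom K ℓ n (C c) = algebraMap K _ c :=
  AlgHom.commutes (polyHom K ℓ n) c

theorem polyHom_mul_comm (p q : MvPolynomial (Fin n) K) :
    polyHom K ℓ n p * polyHom K ℓ n q = polyHom K ℓ n q * polyHom K ℓ n p := by
  rw [← map_mul, mul_comm, map_mul]

theorem psi_mul_y (r : Fin (n - 1)) (i : Fin n) :
    psi K ℓ n r * y K ℓ n i =
      y K ℓ n (simpleRefl r i) * psi K ℓ n r + polyHom K ℓ n (divDiff r (X i)) := by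
  by_cases h1 : i = lo r
  · rw [h1, simpleRefl_lo, divDiff_X_lo, psi_mul_y_lo, map_neg, map_one, sub_eq_add_neg]
  · by_cases h2 : i = hi r
    · rw [h2, simpleRefl_hi, divDiff_X_hi, psi_mul_y_hi, map_one]
    · rw [divDiff_X_of_ne h1 h2, psi_mul_y_of_ne h1 h2, map_zero, add_zero,
        simpleRefl_apply_of_ne (fun h => h1 (Fin.ext h)) (fun h => h2 (Fin.ext h))]

theorem psi_mul_polyHom (r : Fin (n - 1)) (p : MvPolynomial (Fin n) K) :
    psi K ℓ n r * polyHom K ℓ n p =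
      polyHom K ℓ n (polyRefl r p) * psi K ℓ n r + polyHom K ℓ n (divDiff r p) := by
  induction p using MvPolynomial.induction_on with
  | C c =>
    rw [rename_C, divDiff_eq_zero (rename_C _ c), map_zero, add_zero, polyHom_C,
      Algebra.commutes]
  | add p q hp hq =>
    simp only [map_add, mul_add, add_mul, hp, hq]
    abel
  | mul_X p i hp =>
    rw [map_mul, ← mul_assoc, hp, add_mul, mul_assoc, polyHom_X, psi_mul_y, divDiff_mul, map_mul,
      map_add, map_mul, map_mul, map_mul, polyHom_X, rename_X, polyHom_X, mul_add]
    simp only [mul_assoc, add_assoc]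

theorem psi_mul_polyHom_of_invariant {r : Fin (n - 1)} {p : MvPolynomial (Fin n) K}
    (h : polyRefl r p = p) :
    psi K ℓ n r * polyHom K ℓ n p = polyHom K ℓ n p * psi K ℓ n r := by
  rw [psi_mul_polyHom, h, divDiff_eq_zero h, map_zero, add_zero]

theorem polyHom_commute_of_isSymmetric {q : MvPolynomial (Fin n) K} (hq : q.IsSymmetric)
    (a : H K ℓ n) : Commute (polyHom K ℓ n q) a := by
  induction a using gen_induction with
  | one => exact Commute.one_right _
  | add a b ha hb => exact ha.add_right hb
  | smul c a ha => exact ha.smul_right c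
  | psi_mul r a ha => exact Commute.mul_right (psi_mul_polyHom_of_invariant (hq _)).symm ha
  | y_mul i a ha =>
    refine Commute.mul_right ?_ ha
    rw [← polyHom_X]
    exact polyHom_mul_comm _ _

/-- Let q = ∂_r(y_r^ℓ). Commuting ψ_r past y_r^ℓ = 0 gives y_{r+1}^ℓ ψ_r + q = 0. Right
multiplication by ψ_r gives qψ_r = 0, and then by y_{r+1} gives q = 0. Finally (y_{r+1} − y_r) q =
y_r^ℓ − y_{r+1}^ℓ. -/
theorem y_hi_pow {r : Fin (n - 1)} (h : y K ℓ n (lo r) ^ ℓ = 0) : y K ℓ n (hi r) ^ ℓ = 0 := by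
  set q : MvPolynomial (Fin n) K := divDiff r (X (lo r) ^ ℓ) with hq
  have h0 : polyHom K ℓ n (X (lo r) ^ ℓ) = 0 := by rw [map_pow, polyHom_X, h]
  have h1 := psi_mul_polyHom (ℓ := ℓ) r (X (lo r) ^ ℓ : MvPolynomial (Fin n) K)
  rw [h0, mul_zero, ← hq] at h1
  have h2 : polyHom K ℓ n q * psi K ℓ n r = 0 := by
    have := congrArg (· * psi K ℓ n r) h1
    simpa [add_mul, mul_assoc, psi_mul_self] using this.symm
  have h3 : polyHom K ℓ n q = 0 := by
    have := congrArg (· * y K ℓ n (hi r)) h2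
    simp only [zero_mul] at this
    rwa [mul_assoc, psi_mul_y_hi, mul_add, mul_one, ← mul_assoc, ← polyHom_X, polyHom_mul_comm,
      mul_assoc, h2, mul_zero, zero_add] at this
  have h4 := congrArg (polyHom K ℓ n) (polyRoot_mul_divDiff r (X (lo r) ^ ℓ))
  rw [map_mul, ← hq, h3, mul_zero, map_sub, h0, map_pow, rename_X, simpleRefl_lo, zero_sub,
    map_pow, polyHom_X] at h4
  exact neg_eq_zero.1 h4.symm

theorem y_pow_eq_zero (i : Fin n) : y K ℓ n i ^ ℓ = 0 := by
  obtain ⟨i, hi⟩ := i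
  induction i with
  | zero => exact y_zero_pow rfl
  | succ i ih => exact y_hi_pow (r := ⟨i, by omega⟩) (ih (by omega))

/-- The y_i are commuting nilpotents, so what remains without the constant term is nilpotent. -/
theorem isNilpotent_polyHom_sub (p : MvPolynomial (Fin n) K) :
    IsNilpotent (polyHom K ℓ n (p - C (constantCoeff p))) := by
  induction p using MvPolynomial.induction_on with
  | C c => simp
  | add p q hp hq =>
    have : p + q - C (constantCoeff (p + q)) =
        (p - C (constantCoeff p)) + (q - C (constantCoeff q)) := by
      rw [map_add, map_add]; ring
    rw [this, map_add]
    exact Commute.isNilpotent_add (polyHom_mul_comm _ _) hp hq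
  | mul_X p i hp =>
    have : p * X i - C (constantCoeff (p * X i)) = p * X i := by simp
    rw [this, map_mul]
    exact Commute.isNilpotent_mul_left (polyHom_mul_comm _ _)
      ⟨ℓ, by rw [polyHom_X, y_pow_eq_zero]⟩

theorem ofFn_pow_prod (a : Fin n → ℕ) :
    (List.ofFn fun i => y K ℓ n i ^ a i).prod = polyHom K ℓ n (∏ i, X i ^ a i) := by
  rw [← List.prod_ofFn, map_list_prod, List.map_ofFn]
  congr 2
  funext i
  simp

end PolynomialSubalgebra

/-! ### An explicit word for w₀, and the decomposition of 1 into n! terms. -/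

section NatIndexed

variable (K : Type*) [Field K] (ℓ n : ℕ)

/-- The generators `ψ_r`, indexed by all natural numbers (from `0`), with value `0` out of range. -/
def psiN (r : ℕ) : H K ℓ n := if h : r < n - 1 then psi K ℓ n ⟨r, h⟩ else 0

/-- The generators `y_i`, indexed by all natural numbers (from `0`), with value `0` out of range. -/
def yN (i : ℕ) : H K ℓ n := if h : i < n then y K ℓ n ⟨i, h⟩ else 0

variable {K ℓ n}

theorem psiN_of_lt {r : ℕ} (h : r < n - 1) : psiN K ℓ n r = psi K ℓ n ⟨r, h⟩ := dif_pos h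

theorem psiN_of_not_lt {r : ℕ} (h : ¬ r < n - 1) : psiN K ℓ n r = 0 := dif_neg h

theorem yN_of_lt {i : ℕ} (h : i < n) : yN K ℓ n i = y K ℓ n ⟨i, h⟩ := dif_pos h

theorem psiN_sq (r : ℕ) : psiN K ℓ n r * psiN K ℓ n r = 0 := by
  unfold psiN
  split_ifs
  · exact psi_mul_self _
  · exact mul_zero _

theorem psiN_comm {k r : ℕ} (h : k + 1 < r) :
    psiN K ℓ n r * psiN K ℓ n k = psiN K ℓ n k * psiN K ℓ n r := by
  unfold psiN
  split_ifs
  · exact psi_mul_psi_comm h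
  all_goals simp

theorem psiN_braid (r : ℕ) :
    psiN K ℓ n r * psiN K ℓ n (r + 1) * psiN K ℓ n r =
      psiN K ℓ n (r + 1) * psiN K ℓ n r * psiN K ℓ n (r + 1) := by
  unfold psiN
  split_ifs
  · exact psi_braid rfl
  all_goals simp

theorem yN_comm (i j : ℕ) : yN K ℓ n i * yN K ℓ n j = yN K ℓ n j * yN K ℓ n i := by
  unfold yN
  split_ifs
  · exact y_mul_y_comm _ _
  all_goals simp

theorem psiN_mul_yN_of_ne {r k : ℕ} (h₁ : k ≠ r) (h₂ : k ≠ r + 1) :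
    psiN K ℓ n r * yN K ℓ n k = yN K ℓ n k * psiN K ℓ n r := by
  unfold psiN yN
  split_ifs
  · exact psi_mul_y_of_ne (fun h => h₁ (congrArg Fin.val h)) (fun h => h₂ (congrArg Fin.val h))
  all_goals simp

theorem psiN_mul_yN_succ {r : ℕ} (h : r + 1 < n) :
    psiN K ℓ n r * yN K ℓ n (r + 1) = yN K ℓ n r * psiN K ℓ n r + 1 := by
  rw [psiN_of_lt (by omega), yN_of_lt h, yN_of_lt (by omega)]
  exact psi_mul_y_hi _

theorem psiN_mul_yN {r : ℕ} (h : r + 1 < n) :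
    psiN K ℓ n r * yN K ℓ n r = yN K ℓ n (r + 1) * psiN K ℓ n r - 1 := by
  rw [psiN_of_lt (by omega), yN_of_lt h, yN_of_lt (by omega)]
  exact psi_mul_y_lo _

theorem psiN_mul_yN_mul_yN (r : ℕ) :
    psiN K ℓ n r * (yN K ℓ n r * yN K ℓ n (r + 1)) =
      yN K ℓ n r * yN K ℓ n (r + 1) * psiN K ℓ n r := by
  by_cases h : r + 1 < n
  · have h1 : yN K ℓ n (r + 1) * psiN K ℓ n r = psiN K ℓ n r * yN K ℓ n r + 1 := by
      rw [psiN_mul_yN h, sub_add_cancel]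
    rw [mul_assoc (yN K ℓ n r), h1, yN_comm r, ← mul_assoc, psiN_mul_yN_succ h, add_mul, mul_add]
    simp only [mul_assoc, one_mul, mul_one]
  · rw [psiN_of_not_lt (by omega), zero_mul, mul_zero]

variable (K ℓ n)

/-- The product `ψ_j ψ_{j+1} ⋯ ψ_{j+k-1}`. -/
def psiChain : ℕ → ℕ → H K ℓ n
  | _, 0 => 1
  | j, k + 1 => psiN K ℓ n j * psiChain (j + 1) k

/-- The element `ψ_w` for the longest element `w` of the symmetric group on the first `m` letters,
along a particular word. -/
def psiTri : ℕ → H K ℓ n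
  | 0 => 1
  | m + 1 => psiChain K ℓ n 0 m * psiTri m

/-- The product `y_0 y_1 ⋯ y_{m-1}`. -/
def yProd : ℕ → H K ℓ n
  | 0 => 1
  | m + 1 => yProd m * yN K ℓ n m

/-- The product `y_0^{m-1} y_1^{m-2} ⋯ y_{m-2}`. -/
def yTri : ℕ → H K ℓ n
  | 0 => 1
  | m + 1 => yProd K ℓ n m * yTri m

variable {K ℓ n}

theorem psiChain_succ_right (j k : ℕ) :
    psiChain K ℓ n j (k + 1) = psiChain K ℓ n j k * psiN K ℓ n (j + k) := by
  induction k generalizing j with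
  | zero => simp [psiChain]
  | succ k ih =>
    rw [psiChain, ih, psiChain, mul_assoc]
    congr 3
    omega

theorem psiN_mul_psiChain_far {i j : ℕ} (h : i + 1 < j) (k : ℕ) :
    psiN K ℓ n i * psiChain K ℓ n j k = psiChain K ℓ n j k * psiN K ℓ n i := by
  induction k generalizing j with
  | zero => simp [psiChain]
  | succ k ih =>
    rw [psiChain, ← mul_assoc, ← psiN_comm h, mul_assoc, ih (by omega), mul_assoc]

theorem psiN_succ_mul_psiChain {i j k : ℕ} (h₁ : i ≤ j) (h₂ : j + 1 < i + k) :
    psiN K ℓ n (j + 1) * psiChain K ℓ n i k = psiChain K ℓ n i k * psiN K ℓ n j := by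
  induction k generalizing i with
  | zero => omega
  | succ k ih =>
    rcases h₁.lt_or_eq with h | rfl
    · rw [psiChain, ← mul_assoc, psiN_comm (by omega), mul_assoc, ih h (by omega), mul_assoc]
    · obtain ⟨k, rfl⟩ : ∃ k', k = k' + 1 := ⟨k - 1, by omega⟩
      rw [psiChain, psiChain]
      simp only [mul_assoc]
      rw [← psiN_mul_psiChain_far (by omega)]
      simp only [← mul_assoc]
      rw [psiN_braid]

/-- By braid relations ψ_j passes through the leading chain as ψ_{j-1} and meets the smaller
triangle; at index 0 it meets its own square. -/
theorem psiN_mul_psiTri {j m : ℕ} (h : j + 1 < m) : psiN K ℓ n j * psiTri K ℓ n m = 0 := by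
  induction m generalizing j with
  | zero => omega
  | succ m ih =>
    rw [psiTri, ← mul_assoc]
    cases j with
    | zero =>
      obtain ⟨m, rfl⟩ : ∃ m', m = m' + 1 := ⟨m - 1, by omega⟩
      rw [psiChain, ← mul_assoc (psiN K ℓ n 0), psiN_sq, zero_mul, zero_mul]
    | succ j =>
      rw [psiN_succ_mul_psiChain (by omega) (by omega), mul_assoc, ih (by omega), mul_zero]

theorem psiChain_mul_yN_far {j k i : ℕ} (h : j + k < i) :
    psiChain K ℓ n j k * yN K ℓ n i = yN K ℓ n i * psiChain K ℓ n j k := by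
  induction k generalizing j with
  | zero => simp [psiChain]
  | succ k ih =>
    rw [psiChain, mul_assoc, ih (by omega), ← mul_assoc, psiN_mul_yN_of_ne (by omega) (by omega),
      mul_assoc]

theorem psiTri_mul_yN_far {m i : ℕ} (h : m ≤ i) :
    psiTri K ℓ n m * yN K ℓ n i = yN K ℓ n i * psiTri K ℓ n m := by
  induction m with
  | zero => simp [psiTri]
  | succ m ih =>
    rw [psiTri, mul_assoc, ih (by omega), ← mul_assoc, psiChain_mul_yN_far (by omega), mul_assoc]

/-- Moving y_m to the left produces corrections with one ψ deleted. Only deletion of the first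
letter survives: otherwise some ψ left of the gap commutes past the rest and kills `psiTri`. -/
theorem psiChain_mul_yN_mul_psiTri {j k m : ℕ} (hm : j + k + 1 = m) (hn : m < n) :
    psiChain K ℓ n j (k + 1) * psiTri K ℓ n m * yN K ℓ n m =
      yN K ℓ n j * (psiChain K ℓ n j (k + 1) * psiTri K ℓ n m) +
        psiChain K ℓ n (j + 1) k * psiTri K ℓ n m := by
  induction k generalizing j with
  | zero =>
    subst hm
    simp only [psiChain, mul_one, one_mul, add_zero] at hn ⊢
    rw [mul_assoc, psiTri_mul_yN_far le_rfl, ← mul_assoc, psiN_mul_yN_succ hn, add_mul, one_mul,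
      mul_assoc]
  | succ k ih =>
    have h2 : psiN K ℓ n j * (psiChain K ℓ n (j + 1 + 1) k * psiTri K ℓ n m) = 0 := by
      rw [← mul_assoc, psiN_mul_psiChain_far (by omega), mul_assoc, psiN_mul_psiTri (by omega),
        mul_zero]
    rw [psiChain, mul_assoc, mul_assoc, ← mul_assoc (psiChain K ℓ n (j + 1) (k + 1)),
      ih (by omega), mul_add, h2, add_zero, ← mul_assoc (psiN K ℓ n j) (yN K ℓ n (j + 1)),
      psiN_mul_yN_succ (by omega), add_mul, one_mul, mul_assoc, mul_assoc]

/-- The previous identity recovers a chain shortened on the left from the longer one, at the cost of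
one more power of y_m; iterating it removes the whole chain. -/
theorem psiTri_eq_sum {j k m : ℕ} (hm : j + k = m) (hn : m < n) :
    ∃ a : ℕ → H K ℓ n, psiTri K ℓ n m = ∑ i ∈ Finset.range (k + 1),
      a i * (psiChain K ℓ n j k * psiTri K ℓ n m) * yN K ℓ n m ^ i := by
  induction k generalizing j with
  | zero => exact ⟨fun _ => 1, by simp [psiChain]⟩
  | succ k ih =>
    obtain ⟨a, ha⟩ := ih (j := j + 1) (by omega)
    have hc := psiChain_mul_yN_mul_psiTri (K := K) (ℓ := ℓ) (j := j) (k := k) (m := m)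
      (by omega) hn
    set c := psiChain K ℓ n j (k + 1) * psiTri K ℓ n m
    replace hc := eq_sub_of_add_eq' hc.symm
    -- Substituting (shorter chain) = c y_m − y_j c shifts the coefficients by one for the first
    -- term and multiplies them by y_j for the second.
    refine ⟨fun i => (if i = 0 then 0 else a (i - 1)) -
      if i ≤ k then a i * yN K ℓ n j else 0, ?_⟩
    simp only [sub_mul, Finset.sum_sub_distrib]
    rw [Finset.sum_range_succ', Finset.sum_range_succ (n := k + 1)]
    simp only [if_true, zero_mul, add_zero, Nat.succ_ne_zero, if_false, Nat.add_sub_cancel,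
      Nat.not_succ_le_self]
    rw [← Finset.sum_sub_distrib]
    nth_rewrite 1 [ha]
    refine Finset.sum_congr rfl fun i hi => ?_
    rw [if_pos (by have := Finset.mem_range.1 hi; omega), hc, pow_succ']
    simp only [mul_sub, sub_mul, mul_assoc]

/-- Passing from m to m + 1 replaces each term by m + 1 terms. The exact count m! matters: with n!
terms the later change-of-basis matrices are square. -/
theorem one_eq_sum_psiTri {m : ℕ} (hm : m ≤ n) :
    ∃ a c : Fin m.factorial → H K ℓ n, 1 = ∑ j, a j * psiTri K ℓ n m * c j := by
  induction m with
  | zero => exact ⟨fun _ => 1, fun _ => 1, by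
    simp only [psiTri, mul_one]
    exact (Fin.sum_univ_one fun _ => (1 : H K ℓ n)).symm⟩
  | succ m ih =>
    obtain ⟨a, c, h⟩ := ih (by omega)
    obtain ⟨b, hb⟩ := psiTri_eq_sum (K := K) (ℓ := ℓ) (n := n) (zero_add m) (by omega)
    let e : Fin (m + 1) × Fin m.factorial ≃ Fin (m + 1).factorial := finProdFinEquiv
    refine ⟨fun x => a (e.symm x).2 * b (e.symm x).1,
      fun x => yN K ℓ n m ^ ((e.symm x).1 : ℕ) * c (e.symm x).2, ?_⟩
    rw [← Equiv.sum_comp e]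
    simp only [Equiv.symm_apply_apply]
    rw [Fintype.sum_prod_type_right, h]
    refine Finset.sum_congr rfl fun j _ => ?_
    conv_lhs => rw [hb, Finset.sum_range]
    rw [Finset.mul_sum, Finset.sum_mul]
    refine Finset.sum_congr rfl fun i _ => ?_
    simp only [psiTri, mul_assoc]

theorem psiN_mul_yProd_far {j m : ℕ} (h : m ≤ j) :
    psiN K ℓ n j * yProd K ℓ n m = yProd K ℓ n m * psiN K ℓ n j := by
  induction m with
  | zero => simp [yProd]
  | succ m ih =>
    rw [yProd, ← mul_assoc, ih (by omega), mul_assoc, psiN_mul_yN_of_ne (by omega) (by omega),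
      mul_assoc]

theorem psiN_mul_yProd {j m : ℕ} (h : j + 1 < m) :
    psiN K ℓ n j * yProd K ℓ n m = yProd K ℓ n m * psiN K ℓ n j := by
  induction m with
  | zero => omega
  | succ m ih =>
    rcases (Nat.lt_succ_iff.1 h).lt_or_eq with h' | rfl
    · rw [yProd, ← mul_assoc, ih h', mul_assoc, psiN_mul_yN_of_ne (by omega) (by omega),
        mul_assoc]
    · rw [yProd, yProd, mul_assoc, ← mul_assoc, psiN_mul_yProd_far le_rfl, mul_assoc,
        psiN_mul_yN_mul_yN]
      simp only [mul_assoc]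

theorem psiChain_mul_yProd {j k m : ℕ} (h : j + k < m) :
    psiChain K ℓ n j k * yProd K ℓ n m = yProd K ℓ n m * psiChain K ℓ n j k := by
  induction k generalizing j with
  | zero => simp [psiChain]
  | succ k ih =>
    rw [psiChain, mul_assoc, ih (by omega), ← mul_assoc, psiN_mul_yProd (by omega), mul_assoc]

theorem psiTri_mul_yProd {k m : ℕ} (h : k ≤ m) :
    psiTri K ℓ n k * yProd K ℓ n m = yProd K ℓ n m * psiTri K ℓ n k := by
  induction k with
  | zero => simp [psiTri]
  | succ k ih =>
    rw [psiTri, mul_assoc, ih (by omega), ← mul_assoc, psiChain_mul_yProd (by omega), mul_assoc]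

/-- Each ψ_j y_j equals y_{j+1} ψ_j − 1, and ψ_j kills z, so every letter contributes −1. -/
theorem psiChain_mul_yProd_mul {m : ℕ} (hm : m < n) {z : H K ℓ n}
    (hz : ∀ j < m, psiN K ℓ n j * z = 0) :
    psiChain K ℓ n 0 m * (yProd K ℓ n m * z) = (-1) ^ m * z := by
  induction m with
  | zero => simp [psiChain, yProd]
  | succ m ih =>
    rw [psiChain_succ_right, zero_add, yProd, mul_assoc, mul_assoc, ← mul_assoc (psiN K ℓ n m),
      psiN_mul_yProd_far le_rfl, mul_assoc, ← mul_assoc (psiN K ℓ n m), psiN_mul_yN hm, sub_mul,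
      mul_assoc, hz m (by omega), mul_zero, one_mul, zero_sub, mul_neg, mul_neg,
      ih (by omega) fun j hj => hz j (by omega), pow_succ, mul_neg_one, neg_mul]

theorem psiTri_mul_yTri_mul {m : ℕ} (hm : m ≤ n) :
    ∃ ε : ℤˣ, ∀ z : H K ℓ n, (∀ j, j + 1 < m → psiN K ℓ n j * z = 0) →
      psiTri K ℓ n m * (yTri K ℓ n m * z) = (ε : ℤ) • z := by
  induction m with
  | zero => exact ⟨1, fun z _ => by simp [psiTri, yTri]⟩
  | succ m ih =>
    obtain ⟨ε, hε⟩ := ih (by omega)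
    refine ⟨(-1) ^ m * ε, fun z hz => ?_⟩
    rw [psiTri, yTri, mul_assoc, mul_assoc, ← mul_assoc (psiTri K ℓ n m),
      psiTri_mul_yProd le_rfl, mul_assoc, hε z fun j hj => hz j (by omega),
      mul_smul_comm, mul_smul_comm,
      psiChain_mul_yProd_mul (by omega) fun j hj => hz j (by omega)]
    rcases neg_one_pow_eq_or ℤ m with h | h <;> rcases Int.units_eq_one_or ε with h' | h' <;>
      rcases Nat.even_or_odd m with h'' | h'' <;> simp [h', h''.neg_one_pow]

theorem psiChain_eq_prod {j k : ℕ} (h : j + k ≤ n - 1) :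
    ∃ l : List (Fin (n - 1)), l.length = k ∧ psiChain K ℓ n j k = (l.map (psi K ℓ n)).prod := by
  induction k generalizing j with
  | zero => exact ⟨[], rfl, rfl⟩
  | succ k ih =>
    obtain ⟨l, h1, h2⟩ := ih (j := j + 1) (by omega)
    exact ⟨⟨j, by omega⟩ :: l, by simp [h1], by
      rw [psiChain, h2, psiN_of_lt (by omega), List.map_cons, List.prod_cons]⟩

theorem psiTri_eq_prod {m : ℕ} (hm : m ≤ n) :
    ∃ l : List (Fin (n - 1)), l.length = ∑ i ∈ Finset.range m, i ∧
      psiTri K ℓ n m = (l.map (psi K ℓ n)).prod := by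
  induction m with
  | zero => exact ⟨[], rfl, rfl⟩
  | succ m ih =>
    obtain ⟨l, h1, h2⟩ := ih (by omega)
    obtain ⟨l', h1', h2'⟩ := psiChain_eq_prod (K := K) (ℓ := ℓ) (n := n) (j := 0) (k := m)
      (by omega)
    exact ⟨l' ++ l, by rw [List.length_append, h1, h1', Finset.sum_range_succ, add_comm],
      by rw [psiTri, h2, h2', List.map_append, List.prod_append]⟩

/-- The word has the length of w₀. It is reduced, since otherwise its product would vanish and the
decomposition of 1 would give 1 = 0. -/
theorem psiTri_eq_psiW_longest (h : n ≤ ℓ) : psiTri K ℓ n n = psiW K ℓ n (longest n) := by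
  have := nontrivial_H (K := K) h
  obtain ⟨l, h1, h2⟩ := psiTri_eq_prod (K := K) (ℓ := ℓ) (le_refl n)
  have hN : ∑ i ∈ Finset.range n, i = len (longest n) := by
    rw [len_longest, ← Finset.sum_range_reflect, Finset.sum_range]
  have h3 : l.length = len (wordProd l) := by
    by_contra h3
    rw [isNilCoxeter_psi.prod_eq_zero h3] at h2
    obtain ⟨a, c, h4⟩ := one_eq_sum_psiTri (K := K) (ℓ := ℓ) (le_refl n)
    rw [h2] at h4
    simp at h4
  have h4 : wordProd l = longest n := eq_longest_of_len_eq (by rw [← h3, h1, hN])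
  rw [h2]
  exact isNilCoxeter_psi.prod_eq ⟨h4, by rw [h1, hN]⟩ (exists_reducedWord _).choose_spec

theorem yTri_eq_yDelta : yTri K ℓ n n = yDelta K ℓ n := by
  let x : ℕ → MvPolynomial (Fin n) K := fun i => if h : i < n then MvPolynomial.X ⟨i, h⟩ else 0
  have hx : ∀ i, yN K ℓ n i = polyHom K ℓ n (x i) := fun i => by
    unfold yN
    simp only [x]
    split_ifs <;> simp
  have h1 : ∀ m, yProd K ℓ n m = polyHom K ℓ n (∏ i ∈ Finset.range m, x i) := fun m => by
    induction m with
    | zero => simp [yProd]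
    | succ m ih => rw [yProd, ih, hx, Finset.prod_range_succ, map_mul]
  have h2 : ∀ m, yTri K ℓ n m = polyHom K ℓ n (∏ i ∈ Finset.range m, x i ^ (m - 1 - i)) := by
    intro m
    induction m with
    | zero => simp [yTri]
    | succ m ih =>
      rw [yTri, ih, h1, ← map_mul, ← Finset.prod_mul_distrib, Finset.prod_range_succ]
      congr 1
      simp only [Nat.add_sub_cancel, Nat.sub_self, pow_zero, mul_one]
      refine Finset.prod_congr rfl fun i hi => ?_
      have := Finset.mem_range.1 hi
      rw [← pow_succ']
      congr 1
      omega
  rw [h2, yDelta, ofFn_pow_prod, Finset.prod_range]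
  congr 1
  refine Finset.prod_congr rfl fun i _ => ?_
  simp [x]

end NatIndexed

/-! ### Gram–Schmidt over a noncommutative ring, and completeness. -/

section TriangularSystems

variable {A : Type*} [Ring A] {N : ℕ} {x : A} {β : Fin N → A}

/-- Gram–Schmidt: the pairing x β_j α_k x is unitriangular, and the recursion for F subtracts the
components along the earlier idempotents, which makes the pairing the identity. -/
theorem exists_dual_system {α : Fin N → A} {F : Fin N → Fin N → A}
    (hF : ∀ i j, F i j = α i * x * β j -
      ∑ k : {k : Fin N // k < i}, F k.1 k.1 * (α i * x * β j))
    (h0 : ∀ j k, k < j → x * β j * α k * x = 0) (h1 : ∀ j, x * β j * α j * x = x) :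
    ∃ γ : Fin N → A, (∀ k l, F k l = γ k * x * β l) ∧
      ∀ j k, x * β j * γ k * x = if j = k then x else 0 := by
  have key : ∀ k j l, x * β j * F k l = if j = k then x * β l else 0 := by
    intro k
    induction k using WellFoundedLT.induction with
    | _ k ih =>
    intro j l
    -- By induction only the summand m = j survives. For j < k it cancels the leading term; for j >
    -- k there is none, and triangularity applies.
    have hs : ∑ m : {m : Fin N // m < k}, x * β j * (F m.1 m.1 * (α k * x * β l)) =
        if j < k then x * β j * α k * x * β l else 0 := by
      have : ∀ m : {m : Fin N // m < k}, x * β j * (F m.1 m.1 * (α k * x * β l)) =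
          if j = m.1 then x * β j * α k * x * β l else 0 := by
        intro m
        rw [← mul_assoc, ih m.1 m.2]
        split_ifs with hjm
        · rw [hjm]
          simp only [mul_assoc]
        · rw [zero_mul]
      rw [Finset.sum_congr rfl fun m _ => this m]
      split_ifs with hjk
      · rw [Fintype.sum_eq_single (⟨j, hjk⟩ : {m : Fin N // m < k})
          fun m hm => if_neg fun he => hm (Subtype.ext he.symm), if_pos rfl]
      · exact Finset.sum_eq_zero fun m _ => if_neg fun (he : j = m.1) => hjk (he ▸ m.2)
    rw [hF, mul_sub, Finset.mul_sum, hs]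
    rcases lt_trichotomy j k with h | h | h
    · rw [if_pos h, if_neg h.ne]
      simp only [mul_assoc, sub_self]
    · rw [if_neg h.not_lt, if_pos h, sub_zero, ← h]
      simp only [← mul_assoc]
      rw [h1]
    · rw [if_neg h.not_gt, if_neg h.ne', sub_zero]
      simp only [← mul_assoc]
      rw [h0 j k h, zero_mul]
  have hP : ∀ i j, F i j = (1 - ∑ k : {k : Fin N // k < i}, F k.1 k.1) * α i * (x * β j) := by
    intro i j
    rw [hF, ← Finset.sum_mul, sub_mul, sub_mul, one_mul]
    simp only [mul_assoc]
  have hmul : ∀ i j k l, F i j * F k l = if j = k then F i l else 0 := by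
    intro i j k l
    rw [hP i j, mul_assoc, key]
    split_ifs
    · rw [hP i l]
    · rw [mul_zero]
  refine ⟨fun k => F k k * α k, fun k l => ?_, fun j k => ?_⟩
  · have := hmul k k k l
    rw [if_pos rfl, hF k l, mul_sub, Finset.mul_sum, Finset.sum_eq_zero, sub_zero, ← hF] at this
    · rw [← this]
      simp only [mul_assoc]
    · intro m _
      rw [← mul_assoc, hmul, if_neg m.2.ne', zero_mul]
  · have := congrArg (· * (α k * x)) (key k j k)
    simp only [mul_assoc] at this ⊢
    rw [this]
    split_ifs with hjk
    · have := h1 k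
      simp only [mul_assoc] at this ⊢
      exact this
    · rw [zero_mul]

/-- Pairing β with a and c with γ gives square matrices M and L over the commutative centre.
Inserting 1 = ∑ a_j x c_j into the duality gives ML = 1, hence LM = 1; sandwiching ∑ γ_k x β_k
between two copies of ∑ a_j x c_j then collapses it to 1. -/
theorem sum_dual_system_eq_one {γ a c : Fin N → A}
    (hγ : ∀ j k, x * β j * γ k * x = if j = k then x else 0)
    (hc : ∀ h : A, ∃ z ∈ Subring.center A, x * h * x = z * x)
    (hinj : ∀ z ∈ Subring.center A, z * x = 0 → z = 0)
    (hone : 1 = ∑ j, a j * x * c j) : ∑ k, γ k * x * β k = 1 := by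
  choose ζ hζ hζx using hc
  let M : Matrix (Fin N) (Fin N) (Subring.center A) := fun i j => ⟨ζ (β i * a j), hζ _⟩
  let L : Matrix (Fin N) (Fin N) (Subring.center A) := fun j k => ⟨ζ (c j * γ k), hζ _⟩
  have hM : ∀ i j, (M i j : A) * x = x * (β i * a j) * x := fun i j => (hζx _).symm
  have hL : ∀ j k, (L j k : A) * x = x * (c j * γ k) * x := fun j k => (hζx _).symm
  have hML : M * L = 1 := by
    ext i k
    rw [← sub_eq_zero]
    -- The entries are known only after multiplication by x; faithfulness of the centre on x allows
    -- x to be removed.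
    refine hinj _ (Subring.sub_mem _ ((M * L) i k).2 ((1 : Matrix (Fin N) (Fin N) (Subring.center A)) i k).2) ?_
    have h1 : ((M * L) i k : A) * x = x * β i * (∑ j, a j * x * c j) * γ k * x := by
      rw [Matrix.mul_apply, AddSubmonoidClass.coe_finsetSum, Finset.sum_mul, Finset.mul_sum,
        Finset.sum_mul, Finset.sum_mul]
      refine Finset.sum_congr rfl fun j _ => ?_
      rw [Subring.coe_mul, mul_assoc, hL]
      simp only [← mul_assoc]
      rw [hM]
      simp only [← mul_assoc]
    rw [sub_mul, h1, ← hone, mul_one, hγ, Matrix.one_apply]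
    split_ifs <;> simp
  have hLM : L * M = 1 := mul_eq_one_comm.1 hML
  have h2 : ∀ j l, x * c j * (∑ k, γ k * x * β k) * a l * x = if j = l then x else 0 := by
    intro j l
    have h3 := congrArg (fun z : Subring.center A => (z : A) * x) (congrFun (congrFun hLM j) l)
    simp only [Matrix.mul_apply, Matrix.one_apply, AddSubmonoidClass.coe_finsetSum,
      Finset.sum_mul] at h3
    have h4 : (((if j = l then 1 else 0 : Subring.center A) : A)) * x =
        if j = l then x else 0 := by
      split_ifs <;> simp
    rw [← h4, ← h3, Finset.mul_sum, Finset.sum_mul, Finset.sum_mul]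
    refine Finset.sum_congr rfl fun k _ => ?_
    rw [Subring.coe_mul, mul_assoc (L j k : A), hM]
    simp only [← mul_assoc]
    rw [hL]
    simp only [← mul_assoc]
  calc ∑ k, γ k * x * β k
      = (∑ j, a j * x * c j) * (∑ k, γ k * x * β k) * ∑ l, a l * x * c l := by
        rw [← hone, one_mul, mul_one]
    _ = ∑ j, ∑ l, a j * (x * c j * (∑ k, γ k * x * β k) * a l * x) * c l := by
        rw [Finset.sum_mul, Finset.sum_mul]
        refine Finset.sum_congr rfl fun j _ => ?_
        rw [Finset.mul_sum]
        refine Finset.sum_congr rfl fun l _ => ?_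
        simp only [mul_assoc]
    _ = 1 := by
        rw [hone]
        refine Finset.sum_congr rfl fun j _ => ?_
        rw [Fintype.sum_eq_single j]
        · rw [h2, if_pos rfl]
        · intro l hl
          rw [h2, if_neg hl.symm, mul_zero, zero_mul]

end TriangularSystems

/-! ### The element ψ_{w₀}. -/

section LongestElement

variable {K : Type*} [Field K] {ℓ n : ℕ}

theorem reducedWord_spec (w : Equiv.Perm (Fin n)) : IsReducedWord (reducedWord w) w :=
  (exists_reducedWord w).choose_spec

theorem psiW_eq_prod {w : Equiv.Perm (Fin n)} {l : List (Fin (n - 1))} (h : IsReducedWord l w) :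
    psiW K ℓ n w = (l.map (psi K ℓ n)).prod :=
  isNilCoxeter_psi.prod_eq (reducedWord_spec w) h

theorem psi_mul_psiW_longest (r : Fin (n - 1)) :
    psi K ℓ n r * psiW K ℓ n (longest n) = 0 := by
  have h := reducedWord_spec (longest n)
  have := isNilCoxeter_psi.prod_eq_zero (ψ := psi K ℓ n) (l := r :: reducedWord (longest n)) (by
    have := len_le_len_longest (wordProd (r :: reducedWord (longest n)))
    rw [List.length_cons, h.2]
    omega)
  rwa [List.map_cons, List.prod_cons] at this

theorem psiW_longest_mul_yDelta_mul (h : n ≤ ℓ) :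
    ∃ ε : ℤˣ, ∀ z : H K ℓ n, (∀ r, psi K ℓ n r * z = 0) →
      psiW K ℓ n (longest n) * (yDelta K ℓ n * z) = (ε : ℤ) • z := by
  obtain ⟨ε, hε⟩ := psiTri_mul_yTri_mul (K := K) (ℓ := ℓ) (le_refl n)
  rw [psiTri_eq_psiW_longest h, yTri_eq_yDelta] at hε
  exact ⟨ε, fun z hz => hε z fun j hj => by rw [psiN_of_lt (by omega)]; exact hz _⟩

/-- ψ_{w₀} D ψ_{w₀} is ±ψ_{w₀}; applying ψ_{w₀} D twice squares the sign away, which is why F'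
contains D twice. -/
theorem psiW_longest_yDelta_cancel (h : n ≤ ℓ) :
    psiW K ℓ n (longest n) * yDelta K ℓ n * psiW K ℓ n (longest n) * yDelta K ℓ n *
      psiW K ℓ n (longest n) = psiW K ℓ n (longest n) := by
  obtain ⟨ε, hε⟩ := psiW_longest_mul_yDelta_mul (K := K) h
  simp only [mul_assoc]
  rw [hε _ psi_mul_psiW_longest, mul_smul_comm, mul_smul_comm, hε _ psi_mul_psiW_longest]
  rcases Int.units_eq_one_or ε with h' | h' <;> simp [h']

theorem exists_polyHom_mul_psiW_longest (a : H K ℓ n) :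
    ∃ p, a * psiW K ℓ n (longest n) = polyHom K ℓ n p * psiW K ℓ n (longest n) := by
  induction a using gen_induction with
  | one => exact ⟨1, by rw [map_one]⟩
  | add a b ha hb =>
    obtain ⟨p, hp⟩ := ha
    obtain ⟨q, hq⟩ := hb
    exact ⟨p + q, by rw [add_mul, hp, hq, map_add, add_mul]⟩
  | smul c a ha =>
    obtain ⟨p, hp⟩ := ha
    exact ⟨c • p, by rw [smul_mul_assoc, hp, map_smul, smul_mul_assoc]⟩
  | psi_mul r a ha =>
    obtain ⟨p, hp⟩ := ha
    exact ⟨divDiff r p, by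
      rw [mul_assoc, hp, ← mul_assoc, psi_mul_polyHom, add_mul, mul_assoc, psi_mul_psiW_longest,
        mul_zero, zero_add]⟩
  | y_mul i a ha =>
    obtain ⟨p, hp⟩ := ha
    exact ⟨MvPolynomial.X i * p, by rw [mul_assoc, hp, map_mul, polyHom_X, mul_assoc]⟩

theorem prod_psi_mul_polyHom_mul (l : List (Fin (n - 1))) (p : MvPolynomial (Fin n) K) :
    (l.map (psi K ℓ n)).prod * (polyHom K ℓ n p * psiW K ℓ n (longest n)) =
      polyHom K ℓ n ((l.map divDiff).prod p) * psiW K ℓ n (longest n) := by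
  induction l with
  | nil => simp
  | cons r l ih =>
    rw [List.map_cons, List.prod_cons, mul_assoc, ih, List.map_cons, List.prod_cons,
      ← mul_assoc, psi_mul_polyHom, add_mul, mul_assoc, psi_mul_psiW_longest, mul_zero, zero_add]
    rfl

/-- Write aψ_{w₀} as pψ_{w₀} with p a polynomial; left multiplication by ψ_{w₀} then applies ∂_{w₀}
to p, whose values are symmetric. -/
theorem psiW_longest_mul_mul_psiW_longest (a : H K ℓ n) :
    ∃ q : MvPolynomial (Fin n) K, q.IsSymmetric ∧
      psiW K ℓ n (longest n) * a * psiW K ℓ n (longest n) =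
        polyHom K ℓ n q * psiW K ℓ n (longest n) := by
  obtain ⟨p, hp⟩ := exists_polyHom_mul_psiW_longest a
  exact ⟨_, isSymmetric_divDiff_longest (reducedWord_spec _) p, by
    rw [mul_assoc, hp, ← prod_psi_mul_polyHom_mul]; rfl⟩

theorem one_eq_sum_psiW_longest (h : n ≤ ℓ) : ∃ a c : Fin n.factorial → H K ℓ n,
    1 = ∑ j, a j * psiW K ℓ n (longest n) * c j := by
  rw [← psiTri_eq_psiW_longest h]
  exact one_eq_sum_psiTri le_rfl

/-- The two-sided ideal generated by ψ_{w₀} contains 1. -/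
theorem eq_zero_of_mul_psiW_longest (h : n ≤ ℓ) {z : H K ℓ n} (hz : z ∈ Subring.center (H K ℓ n))
    (h0 : z * psiW K ℓ n (longest n) = 0) : z = 0 := by
  obtain ⟨a, c, hac⟩ := one_eq_sum_psiW_longest (K := K) h
  rw [← mul_one z, hac, Finset.mul_sum]
  refine Finset.sum_eq_zero fun j _ => ?_
  rw [← mul_assoc, ← mul_assoc, ← Subring.mem_center_iff.1 hz, mul_assoc (a j), h0, mul_zero,
    zero_mul]

theorem antiAut_prod (l : List (Gen n)) :
    antiAut K ℓ n (l.map (gen K ℓ n)).prod = (l.reverse.map (gen K ℓ n)).prod := by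
  induction l with
  | nil => simp [antiAut]
  | cons g l ih =>
    rw [List.map_cons, List.prod_cons, antiAut_mul, ih, antiAut_gen, List.reverse_cons,
      List.map_append, List.prod_append, List.map_singleton, List.prod_singleton]

theorem antiAut_psiW (w : Equiv.Perm (Fin n)) :
    antiAut K ℓ n (psiW K ℓ n w) = ((reducedWord w).reverse.map (psi K ℓ n)).prod := by
  have := antiAut_prod (K := K) (ℓ := ℓ) ((reducedWord w).map (Sum.inl : _ → Gen n))
  rw [← List.map_reverse, List.map_map, List.map_map] at this
  exact this

theorem psiW_mul_antiAut_self (u : Equiv.Perm (Fin n)) :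
    psiW K ℓ n u * antiAut K ℓ n (psiW K ℓ n (longest n * u)) = psiW K ℓ n (longest n) := by
  have h1 := reducedWord_spec u
  have h2 := reducedWord_spec (longest n * u)
  rw [antiAut_psiW, psiW, ← List.prod_append, ← List.map_append]
  refine (psiW_eq_prod ⟨?_, ?_⟩).symm
  · rw [wordProd_append, wordProd_reverse, h1.1, h2.1, mul_inv_rev, longest_inv, ← mul_assoc,
      mul_inv_cancel, one_mul]
  · rw [List.length_append, List.length_reverse, h1.2, h2.2, len_longest, add_comm,
      len_longest_mul_add]

/-- If the concatenated word were reduced, comparing lengths would give ℓ(v) = ℓ(u) + ℓ(vu⁻¹), so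
that v⁻¹ = u⁻¹ · (uv⁻¹) would be a reduced factorization. -/
theorem psiW_mul_antiAut_eq_zero {u v : Equiv.Perm (Fin n)} (h : ¬ WeakGE u⁻¹ v⁻¹) :
    psiW K ℓ n u * antiAut K ℓ n (psiW K ℓ n (longest n * v)) = 0 := by
  have h1 := reducedWord_spec u
  have h2 := reducedWord_spec (longest n * v)
  rw [antiAut_psiW, psiW, ← List.prod_append, ← List.map_append]
  refine isNilCoxeter_psi.prod_eq_zero fun h3 => h ?_
  rw [wordProd_append, wordProd_reverse, h1.1, h2.1, List.length_append, List.length_reverse,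
    h1.2, h2.2, mul_inv_rev, longest_inv, ← len_inv (u * _), mul_inv_rev, mul_inv_rev, inv_inv,
    longest_inv, mul_assoc] at h3
  have h4 := len_longest_mul_add (v * u⁻¹)
  have h5 := len_longest_mul_add v
  obtain ⟨l₁, h6⟩ := exists_reducedWord u⁻¹
  obtain ⟨l₂, h7⟩ := exists_reducedWord (u * v⁻¹)
  refine ⟨l₁, l₂, ⟨by rw [wordProd_append, h6.1, h7.1, inv_mul_cancel_left], ?_⟩, h6.1⟩
  have h8 := len_inv (v * u⁻¹)
  rw [mul_inv_rev, inv_inv] at h8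
  rw [List.length_append, h6.2, h7.2, len_inv, len_inv, h8]
  omega

end LongestElement

/-! ### The f_{ij} are a complete system of matrix units. -/

section MatrixUnits

variable {K : Type*} [Field K] {ℓ n : ℕ}

/-- The right factor of `F'_{w_i,w_j}`. -/
abbrev rightFactor (K : Type*) [Field K] (ℓ : ℕ) (w : Fin n.factorial → Equiv.Perm (Fin n))
    (j : Fin n.factorial) : H K ℓ n :=
  yDelta K ℓ n * psiW K ℓ n (w j)

variable (w : Fin n.factorial ≃ Equiv.Perm (Fin n))

theorem exists_dual_rightFactor (h : n ≤ ℓ)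
    (hw : ∀ i j : Fin n.factorial, WeakGT (w i)⁻¹ (w j)⁻¹ → i < j) :
    ∃ γ : Fin n.factorial → H K ℓ n,
      (∀ k l, f K ℓ w k l = γ k * psiW K ℓ n (longest n) * rightFactor K ℓ w l) ∧
      ∀ j k, psiW K ℓ n (longest n) * rightFactor K ℓ w j * γ k * psiW K ℓ n (longest n) =
        if j = k then psiW K ℓ n (longest n) else 0 := by
  have hF : ∀ i j, Fprime K ℓ (w i) (w j) =
      antiAut K ℓ n (psiW K ℓ n (longest n * w i)) * yDelta K ℓ n * psiW K ℓ n (longest n) *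
        rightFactor K ℓ w j := fun i j => by rw [Fprime, mul_assoc _ (yDelta K ℓ n)]
  refine exists_dual_system
    (α := fun i => antiAut K ℓ n (psiW K ℓ n (longest n * w i)) * yDelta K ℓ n) ?_ ?_ ?_
  · intro i j
    rw [f, hF]
  · intro j k hkj
    have h1 := psiW_mul_antiAut_eq_zero (K := K) (ℓ := ℓ) (u := w j) (v := w k) fun hge =>
      hkj.not_gt (hw j k ⟨hge, fun he => hkj.ne' (w.injective (inv_injective he))⟩)
    simp only [mul_assoc]
    rw [← mul_assoc (psiW K ℓ n (w j)), h1, zero_mul, mul_zero, mul_zero]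
  · intro j
    have h1 := psiW_mul_antiAut_self (K := K) (ℓ := ℓ) (w j)
    have h2 := psiW_longest_yDelta_cancel (K := K) h
    simp only [mul_assoc] at h2 ⊢
    rwa [← mul_assoc (psiW K ℓ n (w j)), h1]

variable {w}

theorem f_mul_f (h : n ≤ ℓ) (hw : ∀ i j : Fin n.factorial, WeakGT (w i)⁻¹ (w j)⁻¹ → i < j)
    (i j k l : Fin n.factorial) :
    f K ℓ w i j * f K ℓ w k l = if j = k then f K ℓ w i l else 0 := by
  obtain ⟨γ, h1, h2⟩ := exists_dual_rightFactor (K := K) w h hw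
  rw [h1, h1 k, h1 i l]
  have := congrArg (fun z => γ i * z * rightFactor K ℓ w l) (h2 j k)
  simp only [mul_assoc] at this ⊢
  rw [this]
  split_ifs <;> simp

theorem sum_f (h : n ≤ ℓ) (hw : ∀ i j : Fin n.factorial, WeakGT (w i)⁻¹ (w j)⁻¹ → i < j) :
    ∑ i, f K ℓ w i i = 1 := by
  obtain ⟨γ, h1, h2⟩ := exists_dual_rightFactor (K := K) w h hw
  obtain ⟨a, c, hac⟩ := one_eq_sum_psiW_longest (K := K) h
  rw [Finset.sum_congr rfl fun i _ => h1 i i]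
  refine sum_dual_system_eq_one h2 (fun b => ?_)
    (fun z hz => eq_zero_of_mul_psiW_longest h hz) hac
  obtain ⟨q, hq, hqb⟩ := psiW_longest_mul_mul_psiW_longest b
  exact ⟨_, Subring.mem_center_iff.2 fun g => (polyHom_commute_of_isSymmetric hq g).eq.symm, hqb⟩

/-- Corners of the matrix units are multiples by central elements. -/
theorem f_mul_mul_f (h : n ≤ ℓ)
    (hw : ∀ i j : Fin n.factorial, WeakGT (w i)⁻¹ (w j)⁻¹ → i < j) (i j k l : Fin n.factorial)
    (a : H K ℓ n) : ∃ q : MvPolynomial (Fin n) K, q.IsSymmetric ∧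
      f K ℓ w i j * a * f K ℓ w k l = polyHom K ℓ n q * f K ℓ w i l := by
  obtain ⟨γ, h1, h2⟩ := exists_dual_rightFactor (K := K) w h hw
  obtain ⟨q, hq, hqb⟩ := psiW_longest_mul_mul_psiW_longest (rightFactor K ℓ w j * a * γ k)
  refine ⟨q, hq, ?_⟩
  have := congrArg (fun z => γ i * z * rightFactor K ℓ w l) hqb
  rw [h1, h1, h1]
  simp only [mul_assoc] at this ⊢
  rw [this, ← mul_assoc, ← (polyHom_commute_of_isSymmetric hq (γ i)).eq, mul_assoc]

/-- If one matrix unit vanished, so would every f_{kk} = f_{ki} f_{ij} f_{jk}, and hence their sum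
1. -/
theorem f_ne_zero (h : n ≤ ℓ)
    (hw : ∀ i j : Fin n.factorial, WeakGT (w i)⁻¹ (w j)⁻¹ → i < j) (i j : Fin n.factorial) :
    f K ℓ w i j ≠ 0 := by
  have := nontrivial_H (K := K) h
  intro h0
  refine one_ne_zero (α := H K ℓ n) ?_
  rw [← sum_f h hw]
  refine Finset.sum_eq_zero fun k _ => ?_
  have h1 := f_mul_f (K := K) h hw k i i j
  have h2 := f_mul_f (K := K) h hw k j j k
  rw [if_pos rfl] at h1 h2
  rw [← h2, ← h1, h0, mul_zero, zero_mul]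

end MatrixUnits

/-! ### The ℤ-grading of H and the degrees of the f_{ij}. -/

section Grading

variable (K : Type*) [Field K] (ℓ n : ℕ)

/-- The homomorphism that records the degree of homogeneous elements. -/
def gradeHom : H K ℓ n →ₐ[K] AddMonoidAlgebra (H K ℓ n) ℤ :=
  RingQuot.liftAlgHom K ⟨FreeAlgebra.lift K
    (fun g => AddMonoidAlgebra.single (genDeg g) (gen K ℓ n g)), by
    have R : ∀ {a b}, Rel K ℓ n a b → mk K ℓ n a = mk K ℓ n b :=
      fun h => RingQuot.mkAlgHom_rel K h
    intro a b h
    induction h with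
    | psi_sq r =>
      have := R (Rel.psi_sq r)
      simp only [map_mul, map_zero, FreeAlgebra.lift_ι_apply, gen,
        AddMonoidAlgebra.single_mul_single] at this ⊢
      rw [this, AddMonoidAlgebra.single_zero]
    | psi_comm k r h =>
      have := R (Rel.psi_comm k r h)
      simp only [map_mul, FreeAlgebra.lift_ι_apply, gen,
        AddMonoidAlgebra.single_mul_single] at this ⊢
      rw [this]
      rfl
    | braid r t h =>
      have := R (Rel.braid r t h)
      simp only [map_mul, FreeAlgebra.lift_ι_apply, gen,
        AddMonoidAlgebra.single_mul_single] at this ⊢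
      rw [this]
      rfl
    | y_comm r k =>
      have := R (Rel.y_comm r k)
      simp only [map_mul, FreeAlgebra.lift_ι_apply, gen,
        AddMonoidAlgebra.single_mul_single] at this ⊢
      rw [this]
      rfl
    | psi_y_far r k h₁ h₂ =>
      have := R (Rel.psi_y_far r k h₁ h₂)
      simp only [map_mul, FreeAlgebra.lift_ι_apply, gen,
        AddMonoidAlgebra.single_mul_single] at this ⊢
      rw [this]
      rfl
    | psi_y r =>
      have := R (Rel.psi_y r)
      simp only [map_mul, map_add, map_one, FreeAlgebra.lift_ι_apply, gen,
        AddMonoidAlgebra.single_mul_single] at this ⊢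
      rw [this, AddMonoidAlgebra.single_add]
      rfl
    | y_psi r =>
      have := R (Rel.y_psi r)
      simp only [map_mul, map_add, map_one, FreeAlgebra.lift_ι_apply, gen,
        AddMonoidAlgebra.single_mul_single] at this ⊢
      rw [this, AddMonoidAlgebra.single_add]
      rfl
    | cyclotomic i h =>
      have := R (Rel.cyclotomic i h)
      simp only [map_pow, map_zero, FreeAlgebra.lift_ι_apply, gen,
        AddMonoidAlgebra.single_pow] at this ⊢
      rw [this, AddMonoidAlgebra.single_zero]⟩

/-- The projection to the homogeneous component of degree `d`. -/
def homogProj (d : ℤ) : H K ℓ n →ₗ[K] H K ℓ n where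
  toFun x := (gradeHom K ℓ n x).coeff d
  map_add' x z := by rw [map_add, AddMonoidAlgebra.coeff_add, Finsupp.add_apply]
  map_smul' c x := by
    rw [map_smul, AddMonoidAlgebra.coeff_smul, Finsupp.smul_apply, RingHom.id_apply]

variable {K ℓ n}

theorem gradeHom_gen (g : Gen n) :
    gradeHom K ℓ n (gen K ℓ n g) = AddMonoidAlgebra.single (genDeg g) (gen K ℓ n g) := by
  change RingQuot.liftAlgHom K _ (RingQuot.mkAlgHom K (Rel K ℓ n) (FreeAlgebra.ι K g)) = _
  rw [RingQuot.liftAlgHom_mkAlgHom_apply, FreeAlgebra.lift_ι_apply]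

/-- The components `homog` are defined only as spans; this identity makes the projections
`homogProj` separate them. -/
theorem gradeHom_of_mem {d : ℤ} {x : H K ℓ n} (hx : x ∈ homog K ℓ n d) :
    gradeHom K ℓ n x = AddMonoidAlgebra.single d x := by
  induction hx using Submodule.span_induction with
  | mem x hx =>
    obtain ⟨l, rfl, rfl⟩ := hx
    induction l with
    | nil => simp only [List.map_nil, List.prod_nil, List.sum_nil, map_one, AddMonoidAlgebra.one_def]
    | cons g l ih =>
      rw [List.map_cons, List.prod_cons, map_mul, ih, gradeHom_gen,
        AddMonoidAlgebra.single_mul_single, List.map_cons, List.sum_cons]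
  | zero => simp
  | add x z _ _ hx hz => rw [map_add, hx, hz, AddMonoidAlgebra.single_add]
  | smul c x _ hx => rw [map_smul, hx, AddMonoidAlgebra.smul_single]

theorem homogProj_of_mem {d : ℤ} {x : H K ℓ n} (hx : x ∈ homog K ℓ n d) (e : ℤ) :
    homogProj K ℓ n e x = if d = e then x else 0 := by
  change (gradeHom K ℓ n x).coeff e = _
  rw [gradeHom_of_mem hx, AddMonoidAlgebra.coeff_single, Finsupp.single_apply]

theorem mem_homog_of_eq {d e : ℤ} {x : H K ℓ n} (hx : x ∈ homog K ℓ n d) (h : d = e) :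
    x ∈ homog K ℓ n e := h ▸ hx

theorem one_mem_homog : (1 : H K ℓ n) ∈ homog K ℓ n 0 :=
  Submodule.subset_span ⟨[], by simp⟩

theorem homog_mul_mem {d e : ℤ} {a b : H K ℓ n} (ha : a ∈ homog K ℓ n d)
    (hb : b ∈ homog K ℓ n e) : a * b ∈ homog K ℓ n (d + e) := by
  induction ha, hb using Submodule.span_induction₂ with
  | mem_mem x z hx hz =>
    obtain ⟨l, hl, rfl⟩ := hx
    obtain ⟨l', hl', rfl⟩ := hz
    exact Submodule.subset_span ⟨l ++ l', by simp [hl, hl'], by simp⟩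
  | zero_left => rw [zero_mul]; exact zero_mem _
  | zero_right => rw [mul_zero]; exact zero_mem _
  | add_left x z w _ _ _ hx hz => rw [add_mul]; exact add_mem hx hz
  | add_right x z w _ _ _ hx hz => rw [mul_add]; exact add_mem hx hz
  | smul_left c x z _ _ h => rw [smul_mul_assoc]; exact Submodule.smul_mem _ _ h
  | smul_right c x z _ _ h => rw [mul_smul_comm]; exact Submodule.smul_mem _ _ h

theorem gen_mem_homog (g : Gen n) : gen K ℓ n g ∈ homog K ℓ n (genDeg g) :=
  Submodule.subset_span ⟨[g], by simp⟩

theorem psi_mem_homog (r : Fin (n - 1)) : psi K ℓ n r ∈ homog K ℓ n (-2) :=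
  gen_mem_homog (Sum.inl r)

theorem y_mem_homog (i : Fin n) : y K ℓ n i ∈ homog K ℓ n 2 :=
  gen_mem_homog (Sum.inr i)

theorem iSup_homog : ⨆ d, homog K ℓ n d = ⊤ := by
  have hmul : ∀ (e : ℤ) (b : H K ℓ n), b ∈ homog K ℓ n e → ∀ a ∈ ⨆ d, homog K ℓ n d,
      b * a ∈ ⨆ d, homog K ℓ n d := by
    intro e b hb a ha
    induction ha using Submodule.iSup_induction' with
    | mem d x hx => exact Submodule.mem_iSup_of_mem (e + d) (homog_mul_mem hb hx)
    | zero => rw [mul_zero]; exact zero_mem _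
    | add x z _ _ hx hz => rw [mul_add]; exact add_mem hx hz
  rw [eq_top_iff]
  intro x _
  induction x using gen_induction with
  | one => exact Submodule.mem_iSup_of_mem 0 one_mem_homog
  | add a b ha hb => exact add_mem (ha trivial) (hb trivial)
  | smul c a ha => exact Submodule.smul_mem _ _ (ha trivial)
  | psi_mul r a ha => exact hmul _ _ (psi_mem_homog r) _ (ha trivial)
  | y_mul i a ha => exact hmul _ _ (y_mem_homog i) _ (ha trivial)

/-- Induction over sums of homogeneous elements. -/
theorem homog_induction {P : H K ℓ n → Prop} (mem : ∀ d, ∀ x ∈ homog K ℓ n d, P x)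
    (add : ∀ a b, P a → P b → P (a + b)) (x : H K ℓ n) : P x :=
  Submodule.iSup_induction (homog K ℓ n) (motive := P) (by rw [iSup_homog]; trivial) mem
    (mem 0 0 (zero_mem _)) add

theorem homogProj_mem (d : ℤ) (x : H K ℓ n) : homogProj K ℓ n d x ∈ homog K ℓ n d := by
  induction x using homog_induction with
  | mem e x hx =>
    rw [homogProj_of_mem hx]
    split_ifs with h
    · exact h ▸ hx
    · exact zero_mem _
  | add a b ha hb => rw [map_add]; exact add_mem ha hb

theorem exists_sum_homogProj (x : H K ℓ n) :
    ∃ s : Finset ℤ, ∑ d ∈ s, homogProj K ℓ n d x = x := by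
  refine ⟨(gradeHom K ℓ n x).coeff.support, ?_⟩
  change (gradeHom K ℓ n x).coeff.sum (fun _ a => a) = x
  induction x using homog_induction with
  | mem e x hx => rw [gradeHom_of_mem hx, AddMonoidAlgebra.coeff_single,
      Finsupp.sum_single_index rfl]
  | add a b ha hb =>
    rw [map_add, AddMonoidAlgebra.coeff_add, Finsupp.sum_add_index' (fun _ => rfl)
      (fun _ _ _ => rfl), ha, hb]

theorem homogProj_mul_mul {a b : H K ℓ n} {d e : ℤ} (ha : a ∈ homog K ℓ n d)
    (hb : b ∈ homog K ℓ n e) (c : ℤ) (x : H K ℓ n) :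
    homogProj K ℓ n (d + c + e) (a * x * b) = a * homogProj K ℓ n c x * b := by
  induction x using homog_induction with
  | mem c' x hx =>
    rw [homogProj_of_mem (homog_mul_mem (homog_mul_mem ha hx) hb), homogProj_of_mem hx]
    by_cases h : c' = c
    · rw [if_pos h, if_pos (by rw [h])]
    · rw [if_neg h, if_neg (by omega), mul_zero, zero_mul]
  | add x z hx hz => rw [mul_add, add_mul, map_add, hx, hz, map_add, mul_add, add_mul]

theorem polyHom_mem_homog {p : MvPolynomial (Fin n) K} {k : ℕ} (hp : p.IsHomogeneous k) :
    polyHom K ℓ n p ∈ homog K ℓ n (2 * k) := by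
  have hpow : ∀ (i : Fin n) (m : ℕ), y K ℓ n i ^ m ∈ homog K ℓ n (2 * m) := by
    intro i m
    induction m with
    | zero => simpa using one_mem_homog
    | succ m ih =>
      rw [pow_succ]
      refine mem_homog_of_eq (homog_mul_mem ih (y_mem_homog i)) ?_
      push_cast
      ring
  have hprod : ∀ (a : Fin n → ℕ) (s : Finset (Fin n)),
      polyHom K ℓ n (∏ i ∈ s, MvPolynomial.X i ^ a i) ∈ homog K ℓ n (2 * (∑ i ∈ s, a i : ℕ)) := by
    intro a s
    induction s using Finset.induction_on with
    | empty => simpa using one_mem_homog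
    | insert i s hi ih =>
      rw [Finset.prod_insert hi, Finset.sum_insert hi, map_mul, map_pow, polyHom_X]
      refine mem_homog_of_eq (homog_mul_mem (hpow i (a i)) ih) ?_
      push_cast
      ring
  rw [p.as_sum, map_sum]
  refine sum_mem fun s hs => ?_
  rw [MvPolynomial.monomial_eq, map_mul, polyHom_C, ← Algebra.smul_def]
  refine Submodule.smul_mem _ _ ?_
  rw [Finsupp.prod]
  have hk := hp (MvPolynomial.mem_support_iff.1 hs)
  rw [Finsupp.weight_apply, Finsupp.sum] at hk
  simp only [Pi.one_apply, smul_eq_mul, mul_one] at hk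
  rw [← hk]
  exact hprod _ _

theorem ofFn_pow_mem_homog (a : Fin n → ℕ) :
    (List.ofFn fun i => y K ℓ n i ^ a i).prod ∈ homog K ℓ n (2 * (∑ i, a i : ℕ)) := by
  rw [ofFn_pow_prod]
  exact polyHom_mem_homog (MvPolynomial.IsHomogeneous.prod _ _ _
    fun i _ => MvPolynomial.isHomogeneous_X_pow i (a i))

theorem yDelta_mem_homog : yDelta K ℓ n ∈ homog K ℓ n (2 * (len (longest n) : ℤ)) := by
  rw [len_longest]
  exact ofFn_pow_mem_homog _

theorem prod_psi_mem_homog (l : List (Fin (n - 1))) :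
    (l.map (psi K ℓ n)).prod ∈ homog K ℓ n (-2 * (l.length : ℤ)) := by
  induction l with
  | nil => simpa using one_mem_homog
  | cons r l ih =>
    rw [List.map_cons, List.prod_cons, List.length_cons]
    refine mem_homog_of_eq (homog_mul_mem (psi_mem_homog r) ih) ?_
    push_cast
    ring

theorem psiW_mem_homog (u : Equiv.Perm (Fin n)) :
    psiW K ℓ n u ∈ homog K ℓ n (-2 * (len u : ℤ)) := by
  rw [← (reducedWord_spec u).2]
  exact prod_psi_mem_homog _

theorem antiAut_psiW_mem_homog (u : Equiv.Perm (Fin n)) :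
    antiAut K ℓ n (psiW K ℓ n u) ∈ homog K ℓ n (-2 * (len u : ℤ)) := by
  rw [antiAut_psiW, ← (reducedWord_spec u).2, ← List.length_reverse]
  exact prod_psi_mem_homog _

theorem Fprime_mem_homog (u v : Equiv.Perm (Fin n)) :
    Fprime K ℓ u v ∈ homog K ℓ n (2 * (len u : ℤ) - 2 * (len v : ℤ)) := by
  have h := len_longest_mul_add u
  rw [← len_longest] at h
  refine mem_homog_of_eq (homog_mul_mem (homog_mul_mem (homog_mul_mem (homog_mul_mem
    (antiAut_psiW_mem_homog (longest n * u)) yDelta_mem_homog) (psiW_mem_homog (longest n)))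
    yDelta_mem_homog) (psiW_mem_homog v)) ?_
  rw [← h]
  push_cast
  ring

theorem f_mem_homog (w : Fin n.factorial → Equiv.Perm (Fin n)) (i j : Fin n.factorial) :
    f K ℓ w i j ∈ homog K ℓ n (2 * (len (w i) : ℤ) - 2 * (len (w j) : ℤ)) := by
  induction i using WellFoundedLT.induction generalizing j with
  | _ i ih =>
  rw [f]
  refine sub_mem (Fprime_mem_homog _ _) (sum_mem fun k _ => ?_)
  have := homog_mul_mem (ih k.1 k.2 k.1) (Fprime_mem_homog (K := K) (ℓ := ℓ) (w i) (w j))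
  rwa [sub_self, zero_add] at this

end Grading

/-! ### The ideal of central nilpotents, modulo which H is a matrix algebra. -/

section RadicalIdeal

variable (K : Type*) [Field K] (ℓ n : ℕ)

/-- The ideal generated by the elementary symmetric polynomials in `y_1, …, y_n` of positive
degree. -/
def radIdeal : Ideal (H K ℓ n) :=
  Ideal.span (Set.range fun k : Fin n => polyHom K ℓ n (MvPolynomial.esymm (Fin n) K (k + 1)))

variable {K ℓ n}

theorem polyHom_esymm_commute (k : ℕ) (a : H K ℓ n) :
    Commute (polyHom K ℓ n (MvPolynomial.esymm (Fin n) K k)) a :=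
  polyHom_commute_of_isSymmetric (MvPolynomial.esymm_isSymmetric _ _ _) a

theorem radIdeal_mul_mem_right {x : H K ℓ n} (hx : x ∈ radIdeal K ℓ n) (a : H K ℓ n) :
    x * a ∈ radIdeal K ℓ n := by
  induction hx using Submodule.span_induction with
  | mem x hx =>
    obtain ⟨k, rfl⟩ := hx
    rw [(polyHom_esymm_commute _ a).eq]
    exact Ideal.mul_mem_left _ _ (Ideal.subset_span ⟨k, rfl⟩)
  | zero => rw [zero_mul]; exact zero_mem _
  | add x z _ _ hx hz => rw [add_mul]; exact add_mem hx hz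
  | smul b x _ hx => rw [smul_eq_mul, mul_assoc]; exact Ideal.mul_mem_left _ _ hx

theorem radIdeal_smul_mem {x : H K ℓ n} (hx : x ∈ radIdeal K ℓ n) (c : K) :
    c • x ∈ radIdeal K ℓ n := by
  rw [Algebra.smul_def]
  exact Ideal.mul_mem_left _ _ hx

/-- The fundamental theorem of symmetric polynomials reduces this to elementary ones. -/
theorem polyHom_sub_mem_radIdeal {q : MvPolynomial (Fin n) K} (hq : q.IsSymmetric) :
    polyHom K ℓ n (q - MvPolynomial.C (MvPolynomial.constantCoeff q)) ∈ radIdeal K ℓ n := by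
  obtain ⟨P, hP⟩ := MvPolynomial.esymmAlgHom_surjective (σ := Fin n) K
    (Fintype.card_fin n).le ⟨q, hq⟩
  obtain rfl : (MvPolynomial.esymmAlgHom (Fin n) K n P : MvPolynomial (Fin n) K) = q :=
    congrArg Subtype.val hP
  clear hP hq
  induction P using MvPolynomial.induction_on with
  | C c =>
    rw [MvPolynomial.esymmAlgHom, MvPolynomial.aeval_C, Subalgebra.coe_algebraMap,
      MvPolynomial.algebraMap_eq, MvPolynomial.constantCoeff_C, sub_self, map_zero]
    exact zero_mem _
  | add p q hp hq =>
    have := add_mem hp hq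
    rw [← map_add] at this
    convert this using 2
    rw [map_add, Subalgebra.coe_add, map_add, map_add]
    ring
  | mul_X p i _ =>
    rw [map_mul, MvPolynomial.esymmAlgHom, MvPolynomial.aeval_X, Subalgebra.coe_mul, map_mul,
      constantCoeff_esymm (Nat.succ_ne_zero _), mul_zero, map_zero, sub_zero, map_mul]
    exact Ideal.mul_mem_left _ _ (Ideal.subset_span ⟨i, rfl⟩)

theorem homogProj_mul_left {b : H K ℓ n} {e : ℤ} (hb : b ∈ homog K ℓ n e) (c : ℤ) (x : H K ℓ n) :
    homogProj K ℓ n c (b * x) = b * homogProj K ℓ n (c - e) x := by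
  have := homogProj_mul_mul hb one_mem_homog (c - e) x
  rw [mul_one, mul_one] at this
  rw [← this]
  congr 2
  ring

theorem esymm_isHomogeneous (k : ℕ) : (MvPolynomial.esymm (Fin n) K k).IsHomogeneous k := by
  rw [MvPolynomial.esymm]
  refine MvPolynomial.IsHomogeneous.sum _ _ _ fun t ht => ?_
  have := MvPolynomial.IsHomogeneous.prod t (fun i => (MvPolynomial.X i : MvPolynomial (Fin n) K))
    (fun _ => 1) fun i _ => MvPolynomial.isHomogeneous_X K i
  rwa [Finset.sum_const, (Finset.mem_powersetCard.1 ht).2, smul_eq_mul, mul_one] at this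

theorem homogProj_mem_radIdeal {x : H K ℓ n} (hx : x ∈ radIdeal K ℓ n) (d : ℤ) :
    homogProj K ℓ n d x ∈ radIdeal K ℓ n := by
  induction hx using Submodule.span_induction generalizing d with
  | mem x hx =>
    obtain ⟨k, rfl⟩ := hx
    rw [homogProj_of_mem (polyHom_mem_homog (esymm_isHomogeneous _))]
    split_ifs
    · exact Ideal.subset_span ⟨k, rfl⟩
    · exact zero_mem _
  | zero => rw [map_zero]; exact zero_mem _
  | add x z _ _ hx hz => rw [map_add]; exact add_mem (hx d) (hz d)
  | smul b x _ hx =>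
    rw [smul_eq_mul]
    induction b using homog_induction generalizing d with
    | mem e b hb =>
      rw [homogProj_mul_left hb]
      exact Ideal.mul_mem_left _ _ (hx _)
    | add a b ha hb => rw [add_mul, map_add]; exact add_mem (ha d) (hb d)

theorem f_mul_f_same (h : n ≤ ℓ) {w : Fin n.factorial ≃ Equiv.Perm (Fin n)}
    (hw : ∀ i j : Fin n.factorial, WeakGT (w i)⁻¹ (w j)⁻¹ → i < j)
    (i j k : Fin n.factorial) :
    f K ℓ w i j * f K ℓ w j k = f K ℓ w i k := by
  rw [f_mul_f h hw, if_pos rfl]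

theorem corner_of_mem_radIdeal (h : n ≤ ℓ) {w : Fin n.factorial ≃ Equiv.Perm (Fin n)}
    (hw : ∀ i j : Fin n.factorial, WeakGT (w i)⁻¹ (w j)⁻¹ → i < j)
    {x : H K ℓ n} (hx : x ∈ radIdeal K ℓ n) (i : Fin n.factorial) :
    ∃ z : H K ℓ n, IsNilpotent z ∧ f K ℓ w i i * x * f K ℓ w i i = z * f K ℓ w i i := by
  -- The extra left factor a absorbs the coefficients occurring in a left ideal span.
  suffices ∀ a, ∃ q : MvPolynomial (Fin n) K, MvPolynomial.constantCoeff q = 0 ∧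
      f K ℓ w i i * (a * x) * f K ℓ w i i = polyHom K ℓ n q * f K ℓ w i i by
    obtain ⟨q, hq, h1⟩ := this 1
    rw [one_mul] at h1
    refine ⟨polyHom K ℓ n q, ?_, h1⟩
    have := isNilpotent_polyHom_sub (ℓ := ℓ) q
    rwa [hq, map_zero, sub_zero] at this
  induction hx using Submodule.span_induction with
  | mem x hx =>
    obtain ⟨k, rfl⟩ := hx
    intro a
    obtain ⟨q, -, h1⟩ := f_mul_mul_f (K := K) h hw i i i i a
    refine ⟨MvPolynomial.esymm (Fin n) K (k + 1) * q, ?_, ?_⟩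
    · rw [map_mul, constantCoeff_esymm (Nat.succ_ne_zero _), zero_mul]
    · rw [map_mul, mul_assoc (polyHom K ℓ n _), ← h1, ← (polyHom_esymm_commute _ a).eq,
        ← mul_assoc, ← mul_assoc, ← (polyHom_esymm_commute _ (f K ℓ w i i)).eq]
      simp only [mul_assoc]
  | zero => exact fun a => ⟨0, map_zero _, by simp⟩
  | add x z _ _ hx hz =>
    intro a
    obtain ⟨p, hp, h1⟩ := hx a
    obtain ⟨q, hq, h2⟩ := hz a
    exact ⟨p + q, by rw [map_add, hp, hq, add_zero], by
      rw [mul_add, mul_add, add_mul, h1, h2, map_add, add_mul]⟩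
  | smul b x _ hx =>
    intro a
    obtain ⟨q, hq, h1⟩ := hx (a * b)
    exact ⟨q, hq, by rw [smul_eq_mul, ← mul_assoc a, h1]⟩

/-- Otherwise f_{ii} would lie in the ideal too, so f_{ii} = z f_{ii} = z^m f_{ii} with z nilpotent.
-/
theorem f_notMem_radIdeal (h : n ≤ ℓ) {w : Fin n.factorial ≃ Equiv.Perm (Fin n)}
    (hw : ∀ i j : Fin n.factorial, WeakGT (w i)⁻¹ (w j)⁻¹ → i < j)
    (i j : Fin n.factorial) : f K ℓ w i j ∉ radIdeal K ℓ n := by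
  intro hm
  have h1 : f K ℓ w i i ∈ radIdeal K ℓ n := by
    rw [← f_mul_f_same h hw i j i]
    exact radIdeal_mul_mem_right hm _
  obtain ⟨z, ⟨m, hm⟩, hz⟩ := corner_of_mem_radIdeal h hw h1 i
  rw [f_mul_f_same h hw, f_mul_f_same h hw] at hz
  have h2 : ∀ m : ℕ, f K ℓ w i i = z ^ m * f K ℓ w i i := by
    intro m
    induction m with
    | zero => simp
    | succ m ih => rw [pow_succ, mul_assoc, ← hz, ← ih]
  refine f_ne_zero h hw i i ((h2 m).trans ?_)
  rw [hm, zero_mul]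

theorem exists_smul_f_sub_mem (h : n ≤ ℓ) {w : Fin n.factorial ≃ Equiv.Perm (Fin n)}
    (hw : ∀ i j : Fin n.factorial, WeakGT (w i)⁻¹ (w j)⁻¹ → i < j)
    (i j k l : Fin n.factorial) (a : H K ℓ n) :
    ∃ c : K, f K ℓ w i j * a * f K ℓ w k l - c • f K ℓ w i l ∈ radIdeal K ℓ n := by
  obtain ⟨q, hq, h1⟩ := f_mul_mul_f (K := K) h hw i j k l a
  refine ⟨MvPolynomial.constantCoeff q, ?_⟩
  have := radIdeal_mul_mem_right (polyHom_sub_mem_radIdeal (ℓ := ℓ) hq) (f K ℓ w i l)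
  rwa [map_sub, sub_mul, ← h1, polyHom_C, ← Algebra.smul_def] at this

/-- The ideal is homogeneous. If the degrees differed, projecting to the degree of f_{ij} would put
c f_{ij} in the ideal. -/
theorem exists_smul_f_sub_mem_of_mem_homog (h : n ≤ ℓ) {w : Fin n.factorial ≃ Equiv.Perm (Fin n)}
    (hw : ∀ i j : Fin n.factorial, WeakGT (w i)⁻¹ (w j)⁻¹ → i < j)
    {d : ℤ} {a : H K ℓ n} (ha : a ∈ homog K ℓ n d)
    (i j : Fin n.factorial) :
    ∃ c : K, f K ℓ w i i * a * f K ℓ w j j - c • f K ℓ w i j ∈ radIdeal K ℓ n ∧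
      (d ≠ 2 * (len (w i) : ℤ) - 2 * (len (w j) : ℤ) → c = 0) := by
  obtain ⟨c, hc⟩ := exists_smul_f_sub_mem (K := K) h hw i i j j a
  refine ⟨c, hc, fun hd => ?_⟩
  by_contra hc0
  have h1 := homogProj_mem_radIdeal hc (2 * (len (w i) : ℤ) - 2 * (len (w j) : ℤ))
  have h2 := homog_mul_mem (homog_mul_mem (f_mem_homog (K := K) (ℓ := ℓ) w i i) ha)
    (f_mem_homog (K := K) (ℓ := ℓ) w j j)
  rw [map_sub, map_smul, homogProj_of_mem (f_mem_homog (K := K) (ℓ := ℓ) w i j), if_pos rfl,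
    homogProj_of_mem h2, if_neg (by omega), zero_sub] at h1
  have h3 := radIdeal_smul_mem (neg_mem h1) c⁻¹
  rw [neg_neg, smul_smul, inv_mul_cancel₀ hc0, one_smul] at h3
  exact f_notMem_radIdeal h hw i j h3

theorem eq_sum_f_mul_mul_f (h : n ≤ ℓ) {w : Fin n.factorial ≃ Equiv.Perm (Fin n)}
    (hw : ∀ i j : Fin n.factorial, WeakGT (w i)⁻¹ (w j)⁻¹ → i < j)
    (a : H K ℓ n) : a = ∑ i, ∑ j, f K ℓ w i i * a * f K ℓ w j j := by
  simp_rw [← Finset.mul_sum, ← Finset.sum_mul]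
  rw [sum_f h hw, one_mul, mul_one]

theorem mem_radIdeal_of_degree (h : n ≤ ℓ) {w : Fin n.factorial ≃ Equiv.Perm (Fin n)}
    (hw : ∀ i j : Fin n.factorial, WeakGT (w i)⁻¹ (w j)⁻¹ → i < j)
    {d : ℤ} {a : H K ℓ n} (ha : a ∈ homog K ℓ n d)
    (hd : 2 * (len (longest n) : ℤ) < d) : a ∈ radIdeal K ℓ n := by
  rw [eq_sum_f_mul_mul_f h hw a]
  refine sum_mem fun i _ => sum_mem fun j _ => ?_
  obtain ⟨c, hc, hc0⟩ := exists_smul_f_sub_mem_of_mem_homog h hw ha i j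
  have := len_le_len_longest (w i)
  rwa [hc0 (by omega), zero_smul, sub_zero] at hc

/-- The degree 2ℓ(w_i) − 2ℓ(w_j) is maximal only for w_i = w₀ and w_j = 1. -/
theorem exists_smul_f_sub_mem_of_top_degree (h : n ≤ ℓ) {w : Fin n.factorial ≃ Equiv.Perm (Fin n)}
    (hw : ∀ i j : Fin n.factorial, WeakGT (w i)⁻¹ (w j)⁻¹ → i < j)
    {a : H K ℓ n}
    (ha : a ∈ homog K ℓ n (2 * (len (longest n) : ℤ))) :
    ∃ c : K, a - c • f K ℓ w (w.symm (longest n)) (w.symm 1) ∈ radIdeal K ℓ n := by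
  obtain ⟨c, hc, -⟩ := exists_smul_f_sub_mem_of_mem_homog h hw ha (w.symm (longest n)) (w.symm 1)
  refine ⟨c, ?_⟩
  have h1 : ∀ i j, ¬ (i = w.symm (longest n) ∧ j = w.symm 1) →
      f K ℓ w i i * a * f K ℓ w j j ∈ radIdeal K ℓ n := by
    intro i j hij
    obtain ⟨c, hc, hc0⟩ := exists_smul_f_sub_mem_of_mem_homog h hw ha i j
    have := len_le_len_longest (w i)
    rw [hc0, zero_smul, sub_zero] at hc
    · exact hc
    · intro hd
      refine hij ⟨(Equiv.eq_symm_apply w).2 (eq_longest_of_len_eq ?_),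
        (Equiv.eq_symm_apply w).2 (eq_one_of_len_eq_zero ?_)⟩ <;> omega
  have h2 : a - f K ℓ w (w.symm (longest n)) (w.symm (longest n)) * a *
      f K ℓ w (w.symm 1) (w.symm 1) ∈ radIdeal K ℓ n := by
    nth_rewrite 1 [eq_sum_f_mul_mul_f h hw a]
    rw [← Finset.sum_erase_add _ _ (Finset.mem_univ (w.symm (longest n))),
      ← Finset.sum_erase_add (Finset.univ : Finset (Fin n.factorial)) _
        (Finset.mem_univ (w.symm 1)), ← add_assoc, add_sub_cancel_right]
    refine add_mem (sum_mem fun i hi => sum_mem fun j _ => h1 i j fun hij => ?_)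
      (sum_mem fun j hj => h1 _ j fun hij => ?_)
    · exact (Finset.mem_erase.1 hi).1 hij.1
    · exact (Finset.mem_erase.1 hj).1 hij.2
  have := add_mem h2 hc
  rwa [sub_add_sub_cancel] at this

end RadicalIdeal

/-! ### The ideal H^> equals the ideal of central nilpotents. -/

section CellIdeal

variable {K : Type*} [Field K] {ℓ n : ℕ}

theorem homogProj_polyHom_of_neg {d : ℤ} (hd : d < 0) (p : MvPolynomial (Fin n) K) :
    homogProj K ℓ n d (polyHom K ℓ n p) = 0 := by
  rw [← MvPolynomial.sum_homogeneousComponent p, map_sum, map_sum]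
  refine Finset.sum_eq_zero fun k _ => ?_
  rw [homogProj_of_mem (polyHom_mem_homog (MvPolynomial.homogeneousComponent_isHomogeneous k p)),
    if_neg (by omega)]

/-- The product equals qψ_{w₀} with q a polynomial in the y_i; for degree reasons only the part of q
of negative degree could contribute, and that part is zero. -/
theorem psiW_longest_mul_polyHom_eq_zero {p : MvPolynomial (Fin n) K} {k : ℕ}
    (hp : p.IsHomogeneous k) (hk : k < len (longest n)) :
    psiW K ℓ n (longest n) * polyHom K ℓ n p * psiW K ℓ n (longest n) = 0 := by
  obtain ⟨q, -, hq⟩ := psiW_longest_mul_mul_psiW_longest (polyHom K ℓ n p)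
  have h1 := homog_mul_mem (homog_mul_mem (psiW_mem_homog (K := K) (ℓ := ℓ) (longest n))
    (polyHom_mem_homog (ℓ := ℓ) hp)) (psiW_mem_homog (longest n))
  have h2 := homogProj_of_mem h1
    (0 + (-2 * (len (longest n) : ℤ) + 2 * k) + -2 * (len (longest n) : ℤ))
  rw [if_pos (by ring)] at h2
  rw [← h2, hq, ← one_mul (polyHom K ℓ n q), homogProj_mul_mul one_mem_homog (psiW_mem_homog _),
    homogProj_polyHom_of_neg (by omega), mul_zero, zero_mul]

theorem mul_mem_cellIdeal (k : MPart ℓ n) {x : H K ℓ n} (hx : x ∈ cellIdeal K k) (b : H K ℓ n) :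
    b * x ∈ cellIdeal K k := by
  induction hx using Submodule.span_induction with
  | mem x hx =>
    obtain ⟨a, k', hk', rfl⟩ := hx
    exact Submodule.subset_span ⟨b * a, k', hk', (mul_assoc _ _ _).symm⟩
  | zero => rw [mul_zero]; exact zero_mem _
  | add x z _ _ hx hz => rw [mul_add]; exact add_mem hx hz
  | smul c x _ hx =>
    have := Submodule.smul_mem (cellIdeal K k) c hx
    rwa [← mul_smul_comm] at this

theorem cellIdeal_mul_mem (k : MPart ℓ n) {x : H K ℓ n} (hx : x ∈ cellIdeal K k) (b : H K ℓ n) :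
    x * b ∈ cellIdeal K k :=
  Submodule.smul_mem (cellIdeal K k) (op b) hx

theorem yPart_eq_polyHom (k : MPart ℓ n) :
    yPart K k = polyHom K ℓ n (∏ i, MvPolynomial.X i ^ (ℓ - ((k i).1 + 1))) :=
  ofFn_pow_prod _

theorem min_val (h : n ≤ ℓ) (i : Fin n) : (MPart.min h i).1 = ℓ - n + i.1 := rfl

theorem yPart_min (h : n ≤ ℓ) : yPart K (MPart.min h) = yDelta K ℓ n := by
  unfold yPart yDelta
  congr 2
  funext i
  rw [min_val]
  congr 1
  omega

theorem degree_lt_of_dom (h : n ≤ ℓ) {k : MPart ℓ n} (hk : k.Dom (MPart.min h)) :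
    len (longest n) < ∑ i, (ℓ - ((k i).1 + 1)) := by
  rw [len_longest]
  have hle : ∀ i, n - 1 - i.1 ≤ ℓ - ((k i).1 + 1) := fun i => by
    have := hk.1 i
    rw [Fin.le_def, min_val] at this
    omega
  refine Finset.sum_lt_sum (fun i _ => hle i) ?_
  by_contra hc
  push Not at hc
  refine hk.2 (RelEmbedding.ext fun i => Fin.ext ?_)
  have h1 := hc i (Finset.mem_univ i)
  have h2 := hk.1 i
  rw [Fin.le_def, min_val] at h2
  rw [min_val]
  have := (k i).2
  have := i.2
  omega

theorem polyHom_mem_cellIdeal (h : n ≤ ℓ) (i₀ : Fin n) (hi : i₀.1 = 0) {m : ℕ} (hm : n ≤ m) :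
    polyHom K ℓ n (MvPolynomial.X i₀ ^ m *
      ∏ i ∈ Finset.univ.erase i₀, MvPolynomial.X i ^ (n - 1 - i.1)) ∈
        cellIdeal K (MPart.min h) := by
  by_cases hℓ : ℓ ≤ m
  · rw [map_mul, map_pow, polyHom_X, pow_eq_zero_of_le hℓ (y_pow_eq_zero i₀), zero_mul]
    exact zero_mem _
  -- The minimal multipartition with its first component moved left, to the position that gives y_1
  -- the exponent m.
  · let k : MPart ℓ n := OrderEmbedding.ofStrictMono
      (fun i => (⟨if i.1 = 0 then ℓ - 1 - m else ℓ - n + i.1, by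
        have := i.2
        split_ifs <;> omega⟩ : Fin ℓ)) (fun i j hij => by
        rw [Fin.lt_def] at hij ⊢
        change (if i.1 = 0 then ℓ - 1 - m else ℓ - n + i.1) <
          if j.1 = 0 then ℓ - 1 - m else ℓ - n + j.1
        split_ifs <;> omega)
    have hkv : ∀ i, (k i).1 = if i.1 = 0 then ℓ - 1 - m else ℓ - n + i.1 := fun _ => rfl
    refine Submodule.subset_span ⟨1, k, ⟨fun i => ?_, fun he => ?_⟩, ?_⟩
    · rw [Fin.le_def, hkv, min_val]
      split_ifs <;> omega
    · have := congrArg (fun k : MPart ℓ n => (k i₀).1) he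
      simp only [hkv, min_val, hi, if_true] at this
      omega
    · rw [one_mul, yPart_eq_polyHom, ← Finset.mul_prod_erase _ _ (Finset.mem_univ i₀)]
      congr 2
      · rw [hkv, if_pos hi]
        congr 1
        omega
      · refine Finset.prod_congr rfl fun i hi' => ?_
        have hne : i.1 ≠ 0 := fun h0 => (Finset.mem_erase.1 hi').1 (Fin.ext (h0.trans hi.symm))
        have := i.2
        rw [hkv, if_neg hne]
        congr 1
        omega

/-- Vieta's relation for y_1, times y_1^{k-1} y_2^{n-2}⋯y_{n-1} and sandwiched between two ψ_{w₀},
has terms with y_1-exponent n − j + k − 1. For j < k this is at least n, so the term is in H^>; for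
j > k the degree is too small and the term vanishes; j = k gives e_k ψ_{w₀} D ψ_{w₀}. -/
theorem polyHom_esymm_mem_cellIdeal (h : n ≤ ℓ) {k : ℕ} (hk : 1 ≤ k) (hkn : k ≤ n) :
    polyHom K ℓ n (MvPolynomial.esymm (Fin n) K k) ∈ cellIdeal K (MPart.min h) := by
  set I := cellIdeal K (MPart.min h)
  set x := psiW K ℓ n (longest n) with hx
  let i₀ : Fin n := ⟨0, by omega⟩
  let d : MvPolynomial (Fin n) K :=
    ∏ i ∈ Finset.univ.erase i₀, MvPolynomial.X i ^ (n - 1 - i.1)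
  let p : ℕ → MvPolynomial (Fin n) K := fun m => MvPolynomial.X i₀ ^ m * d
  have hd : d.IsHomogeneous (∑ i ∈ Finset.univ.erase i₀, (n - 1 - i.1)) :=
    MvPolynomial.IsHomogeneous.prod _ _ _ fun i _ => MvPolynomial.isHomogeneous_X_pow i _
  have hN : len (longest n) = (n - 1) + ∑ i ∈ Finset.univ.erase i₀, (n - 1 - i.1) := by
    rw [len_longest, ← Finset.add_sum_erase _ _ (Finset.mem_univ i₀)]
    rfl
  have hlow : ∀ m, m < n - 1 → x * polyHom K ℓ n (p m) * x = 0 := fun m hm =>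
    psiW_longest_mul_polyHom_eq_zero ((MvPolynomial.isHomogeneous_X_pow i₀ m).mul hd) (by omega)
  have hhigh : ∀ m, n ≤ m → x * polyHom K ℓ n (p m) * x ∈ I := fun m hm =>
    cellIdeal_mul_mem _ (mul_mem_cellIdeal _ (polyHom_mem_cellIdeal h i₀ rfl hm) x) x
  have hmid : polyHom K ℓ n (p (n - 1)) = yDelta K ℓ n := by
    rw [yDelta, ofFn_pow_prod, ← Finset.mul_prod_erase _ _ (Finset.mem_univ i₀)]
    rfl
  have hrel : ∑ j ∈ Finset.range (n + 1), (-1) ^ j *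
      (polyHom K ℓ n (MvPolynomial.esymm (Fin n) K j) *
        (x * polyHom K ℓ n (p (n - j + (k - 1))) * x)) = 0 := by
    have h1 := congrArg (fun q => x * polyHom K ℓ n (q * p (k - 1)) * x)
      (sum_esymm_mul_X_pow (K := K) i₀)
    simp only [zero_mul, map_zero, mul_zero, Finset.sum_mul, map_sum, Finset.mul_sum] at h1
    rw [← h1]
    refine Finset.sum_congr rfl fun j _ => ?_
    have hp : p (n - j + (k - 1)) = MvPolynomial.X i₀ ^ (n - j) * p (k - 1) := by
      simp only [p, pow_add, mul_assoc]
    rw [hp]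
    simp only [map_mul, map_pow, map_neg, map_one]
    have h2 := (polyHom_esymm_commute (K := K) (ℓ := ℓ) (n := n) j x).eq
    rcases neg_one_pow_eq_or (H K ℓ n) j with h3 | h3 <;> rw [h3] <;>
      simp only [one_mul, neg_mul, mul_neg, ← mul_assoc, h2]
  have hmem : polyHom K ℓ n (MvPolynomial.esymm (Fin n) K k) * (x * yDelta K ℓ n * x) ∈ I := by
    rw [← Finset.sum_erase_add _ _ (Finset.mem_range.2 (Nat.lt_succ_of_le hkn)),
      show n - k + (k - 1) = n - 1 by omega, hmid] at hrel
    have h2 : (-1 : H K ℓ n) ^ k *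
        (polyHom K ℓ n (MvPolynomial.esymm (Fin n) K k) * (x * yDelta K ℓ n * x)) ∈ I := by
      rw [eq_neg_of_add_eq_zero_right hrel]
      refine neg_mem (sum_mem fun j hj => mul_mem_cellIdeal _ (mul_mem_cellIdeal _ ?_ _) _)
      obtain ⟨hj1, hj2⟩ := Finset.mem_erase.1 hj
      have := Finset.mem_range.1 hj2
      rcases lt_or_gt_of_ne hj1 with hlt | hgt
      · exact hhigh _ (by omega)
      · rw [hlow _ (by omega)]
        exact zero_mem _
    have h3 := mul_mem_cellIdeal _ h2 ((-1) ^ k)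
    rwa [← mul_assoc, ← pow_add, Even.neg_one_pow ⟨k, rfl⟩, one_mul] at h3
  -- Multiplying by D ψ_{w₀} on the right restores ψ_{w₀}; the decomposition of 1 then removes it.
  have hmem' : polyHom K ℓ n (MvPolynomial.esymm (Fin n) K k) * x ∈ I := by
    have h2 := cellIdeal_mul_mem _ hmem (yDelta K ℓ n * x)
    have h3 := psiW_longest_yDelta_cancel (K := K) h
    rw [← hx] at h3
    simp only [mul_assoc] at h2 h3
    rwa [h3] at h2
  obtain ⟨a, c, hac⟩ := one_eq_sum_psiW_longest (K := K) h
  rw [← mul_one (polyHom K ℓ n _), hac, Finset.mul_sum]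
  refine sum_mem fun j _ => ?_
  rw [← mul_assoc, ← mul_assoc, (polyHom_esymm_commute _ _).eq, mul_assoc (a j)]
  exact cellIdeal_mul_mem _ (mul_mem_cellIdeal _ hmem' _) _

/-- The generators y_k of H^> have degree above 2ℓ(w₀), the largest degree that survives modulo the
central nilpotents. -/
theorem mem_cellIdeal_iff (h : n ≤ ℓ) {w : Fin n.factorial ≃ Equiv.Perm (Fin n)}
    (hw : ∀ i j : Fin n.factorial, WeakGT (w i)⁻¹ (w j)⁻¹ → i < j) {x : H K ℓ n} :
    x ∈ cellIdeal K (MPart.min h) ↔ x ∈ radIdeal K ℓ n := by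
  constructor
  · intro hx
    induction hx using Submodule.span_induction with
    | mem x hx =>
      obtain ⟨a, k, hk, rfl⟩ := hx
      refine Ideal.mul_mem_left _ _ (mem_radIdeal_of_degree h hw (ofFn_pow_mem_homog _) ?_)
      have := degree_lt_of_dom h hk
      omega
    | zero => exact zero_mem _
    | add x z _ _ hx hz => exact add_mem hx hz
    | smul c x _ hx => exact radIdeal_mul_mem_right hx (unop c)
  · intro hx
    induction hx using Submodule.span_induction with
    | mem x hx =>
      obtain ⟨k, rfl⟩ := hx
      exact polyHom_esymm_mem_cellIdeal h (by omega) (by omega)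
    | zero => exact zero_mem _
    | add x z _ _ hx hz => exact add_mem hx hz
    | smul c x _ hx => exact mul_mem_cellIdeal _ hx c

end CellIdeal

/-! ### Right modules and idempotents with local corner. -/

section RightModules

variable {R : Type*} [Ring R] {M : Type*} [AddCommGroup M] [Module Rᵐᵒᵖ M]

/-- The homomorphism `a ↦ m a` from the regular right module to a right module. -/
def rightSMulHom (m : M) : R →ₗ[Rᵐᵒᵖ] M where
  toFun a := op a • m
  map_add' a b := by rw [op_add, add_smul]
  map_smul' c a := by
    change op (a * unop c) • m = c • op a • m
    rw [op_mul, op_unop, mul_smul]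

theorem rightSMulHom_apply (m : M) (a : R) : rightSMulHom m a = op a • m := rfl

theorem exists_op_smul_eq [IsSimpleModule Rᵐᵒᵖ M] {m : M} (hm : m ≠ 0) (x : M) :
    ∃ a : R, op a • m = x := by
  obtain ⟨c, hc⟩ := (isSimpleModule_iff_toSpanSingleton_surjective.1 ‹_›).2 m hm x
  exact ⟨unop c, hc⟩

/-- If mz ≠ 0, simplicity gives mza = m for some a; but za is nilpotent because z is central. -/
theorem smul_eq_zero_of_isNilpotent [IsSimpleModule Rᵐᵒᵖ M] {z : R} (hz : ∀ a, Commute z a)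
    (hn : IsNilpotent z) (m : M) : op z • m = 0 := by
  by_contra hm
  obtain ⟨k, hk⟩ := hn
  obtain ⟨a, ha⟩ := exists_op_smul_eq (R := R) hm m
  rw [smul_smul, ← op_mul] at ha
  have h1 : ∀ j : ℕ, op (z * a) ^ j • m = m := by
    intro j
    induction j with
    | zero => rw [pow_zero, one_smul]
    | succ j ih => rw [pow_succ, mul_smul, ha, ih]
  have h2 := h1 k
  rw [← op_pow, (hz a).mul_pow, hk, zero_mul, op_zero, zero_smul] at h2
  rw [← h2, smul_zero] at hm
  exact hm rfl

theorem mem_rightIdeal_iff {e : R} (he : IsIdempotentElem e) {x : R} :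
    x ∈ rightIdeal e ↔ e * x = x := by
  rw [rightIdeal, Submodule.mem_span_singleton]
  constructor
  · rintro ⟨c, rfl⟩
    rw [mul_smul_comm, he.eq]
  · exact fun hx => ⟨op x, hx⟩

theorem mul_mem_rightIdeal (e x : R) : e * x ∈ rightIdeal e :=
  Submodule.mem_span_singleton.2 ⟨op x, rfl⟩

theorem projective_rightIdeal {e : R} (he : IsIdempotentElem e) :
    Module.Projective Rᵐᵒᵖ (rightIdeal e) := by
  refine Module.Projective.of_lifting_property'' fun g hg => ?_
  obtain ⟨u, hu⟩ := hg ⟨e, Submodule.mem_span_singleton_self e⟩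
  refine ⟨(rightSMulHom u).comp (rightIdeal e).subtype, LinearMap.ext fun x => Subtype.ext ?_⟩
  change (g (op x.1 • u)).1 = x.1
  rw [map_smul, hu]
  exact (mem_rightIdeal_iff he).1 x.2

/-- Every element of the corner `e R e` is the product of `e` with a central element that is
nilpotent or invertible. -/
def HasLocalCorner (e : R) : Prop :=
  IsIdempotentElem e ∧ ∀ a, ∃ z, (∀ b, Commute z b) ∧ (IsNilpotent z ∨ IsUnit z) ∧
    e * a * e = z * e

theorem HasLocalCorner.isPrimitiveIdempotent {e : R} (he : HasLocalCorner e) (he0 : e ≠ 0) :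
    IsPrimitiveIdempotent e := by
  refine ⟨he.1, he0, ?_⟩
  rintro a b ha hb hab hba rfl
  obtain ⟨z, hz, hz', h1⟩ := he.2 a
  have h2 : (a + b) * a * (a + b) = a := by
    rw [add_mul, hba, add_zero, ha.eq, mul_add, ha.eq, hab, add_zero]
  rw [h2] at h1
  have h4 : a = z * a := by
    nth_rewrite 1 [← ha.eq]
    nth_rewrite 1 [h1]
    rw [mul_assoc, add_mul, hba, add_zero, ha.eq]
  rcases hz' with ⟨k, hk⟩ | hz'
  · have h5 : ∀ j : ℕ, a = z ^ j * a := by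
      intro j
      induction j with
      | zero => rw [pow_zero, one_mul]
      | succ j ih => rw [pow_succ, mul_assoc, ← h4, ← ih]
    left
    rw [h5 k, hk, zero_mul]
  · right
    have h5 := hz'.mul_left_cancel (h4.symm.trans h1)
    exact left_eq_add.1 h5

/-- Write e = a + b with a in N and b in the kernel, and ae = ze. If z is nilpotent then be = (1 −
z)e generates eR, so π = 0; if z is a unit then a generates eR, so N is everything. -/
theorem HasLocalCorner.eq_top {e : R} (he : HasLocalCorner e) (π : rightIdeal e →ₗ[Rᵐᵒᵖ] M)
    (hπ : π ≠ 0) (N : Submodule Rᵐᵒᵖ (rightIdeal e)) (hN : N ⊔ LinearMap.ker π = ⊤) : N = ⊤ := by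
  let e' : rightIdeal e := ⟨e, Submodule.mem_span_singleton_self e⟩
  have hspan : ∀ x : rightIdeal e, x = op x.1 • e' := fun x =>
    Subtype.ext ((mem_rightIdeal_iff he.1).1 x.2).symm
  obtain ⟨a, ha, b, hb, hab⟩ := Submodule.mem_sup.1 (hN ▸ Submodule.mem_top : e' ∈ N ⊔ _)
  obtain ⟨z, hz, hz', h1⟩ := he.2 a
  rw [(mem_rightIdeal_iff he.1).1 a.2] at h1
  have h1' : op e • a = op z • e' := Subtype.ext (h1.trans (hz e).eq)
  have h2 : op e • b = op (1 - z) • e' := by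
    have h3 : a.1 + b.1 = e := congrArg Subtype.val hab
    refine Subtype.ext ?_
    change b.1 * e = e * (1 - z)
    rw [eq_sub_of_add_eq' h3, sub_mul, he.1.eq, h1, mul_sub, mul_one, (hz e).eq]
  rcases hz' with hz' | hz'
  · obtain ⟨u, hu⟩ := hz'.isUnit_one_sub
    refine absurd (LinearMap.ext fun x => ?_) hπ
    have h3 := (LinearMap.ker π).smul_mem (op (u⁻¹).1 * op e) hb
    rw [mul_smul, h2, ← hu, smul_smul, ← op_mul, Units.mul_inv, op_one, one_smul] at h3
    rw [hspan x, map_smul, LinearMap.mem_ker.1 h3, smul_zero, LinearMap.zero_apply]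
  · obtain ⟨u, rfl⟩ := hz'
    refine eq_top_iff.2 fun x _ => ?_
    have h3 := N.smul_mem (op (u⁻¹).1 * op e) ha
    rw [mul_smul, h1', smul_smul, ← op_mul, Units.mul_inv, op_one, one_smul] at h3
    rw [hspan x]
    exact N.smul_mem _ h3

/-- The map ea ↦ pa onto the projective M has a section s, and s(p) = ze with z fixing p. Hence z is
not nilpotent but a unit, and the map is injective. -/
theorem HasLocalCorner.nonempty_linearEquiv {e : R} (he : HasLocalCorner e)
    [Module.Projective Rᵐᵒᵖ M] {p : M} (hp : op e • p = p) (hp0 : p ≠ 0)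
    (hspan : Submodule.span Rᵐᵒᵖ {p} = ⊤) : Nonempty (rightIdeal e ≃ₗ[Rᵐᵒᵖ] M) := by
  let φ : rightIdeal e →ₗ[Rᵐᵒᵖ] M := (rightSMulHom p).comp (rightIdeal e).subtype
  have hφ : ∀ x, φ x = op x.1 • p := fun _ => rfl
  have hsurj : Function.Surjective φ := by
    intro x
    obtain ⟨c, rfl⟩ := Submodule.mem_span_singleton.1 (hspan ▸ Submodule.mem_top : x ∈ _)
    refine ⟨⟨e * unop c, mul_mem_rightIdeal e _⟩, ?_⟩
    rw [hφ, op_mul, mul_smul, hp, op_unop]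
  obtain ⟨s, hs⟩ := Module.projective_lifting_property φ LinearMap.id hsurj
  have hs' : ∀ x, φ (s x) = x := fun x => LinearMap.congr_fun hs x
  have hu : (s p).1 * e = (s p).1 := by
    have := congrArg Subtype.val (map_smul s (op e) p)
    rw [hp] at this
    exact this.symm
  obtain ⟨z, hz, hz', h1⟩ := he.2 (s p).1
  rw [(mem_rightIdeal_iff he.1).1 (s p).2, hu] at h1
  have h2 : op z • p = p := by
    have h3 := hs' p
    rwa [hφ, h1, (hz e).eq, op_mul, mul_smul, hp] at h3
  rcases hz' with ⟨k, hk⟩ | hz'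
  · have h3 : ∀ j : ℕ, op z ^ j • p = p := by
      intro j
      induction j with
      | zero => rw [pow_zero, one_smul]
      | succ j ih => rw [pow_succ, mul_smul, h2, ih]
    have h4 := h3 k
    rw [← op_pow, hk, op_zero, zero_smul] at h4
    exact absurd h4.symm hp0
  · refine ⟨LinearEquiv.ofBijective φ ⟨(injective_iff_map_eq_zero φ).2 fun x hx => ?_, hsurj⟩⟩
    have h3 := congrArg Subtype.val (map_smul s (op x.1) p)
    rw [← hφ, hx, map_zero] at h3
    have h4 : (s p).1 * x.1 = 0 := h3.symm
    rw [h1, mul_assoc, (mem_rightIdeal_iff he.1).1 x.2] at h4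
    exact Subtype.ext (hz'.mul_right_eq_zero.1 h4)

end RightModules

/-! ### Graded quotients of the regular module. -/

section GradedModules

variable {K : Type*} [Field K] {ℓ n : ℕ} {M : Type*} [AddCommGroup M] [Module (H K ℓ n)ᵐᵒᵖ M]

/-- The grading of H descends along a surjection whose kernel is homogeneous; the generator is
placed in degree t. -/
theorem isGradedModule_of_surjective {gr : ℤ → AddSubgroup M} (t : ℤ)
    {θ : H K ℓ n →ₗ[(H K ℓ n)ᵐᵒᵖ] M} (hθ : Function.Surjective θ)
    (hker : ∀ a d, θ a = 0 → θ (homogProj K ℓ n d a) = 0)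
    (hgr : ∀ d x, x ∈ gr d ↔ ∃ a ∈ homog K ℓ n (d - t), θ a = x) :
    IsGradedModule K ℓ n gr := by
  classical
  refine ⟨⟨(injective_iff_map_eq_zero _).2 fun u hu => ?_, fun x => ?_⟩, fun d e x a hx ha => ?_⟩
  · choose a ha hau using fun d => (hgr d (u d)).1 (u d).2
    rw [DirectSum.coeAddMonoidHom_eq_dfinsuppSum, DFinsupp.sum] at hu
    refine DFinsupp.ext fun d => Subtype.ext ?_
    by_cases hd : d ∈ DFinsupp.support u
    · have h1 := hker (∑ i ∈ DFinsupp.support u, a i) (d - t) (by rw [map_sum, ← hu]; simp only [hau])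
      rw [map_sum, Finset.sum_eq_single_of_mem d hd, homogProj_of_mem (ha d), if_pos rfl, hau] at h1
      · exact h1
      · intro i _ hi
        rw [homogProj_of_mem (ha i), if_neg (by omega)]
    · rw [DFinsupp.notMem_support_iff.1 hd]
      rfl
  · obtain ⟨a, rfl⟩ := hθ x
    obtain ⟨s, hs⟩ := exists_sum_homogProj a
    change θ a ∈ (DirectSum.coeAddMonoidHom gr).range
    rw [← hs, map_sum]
    refine sum_mem fun d _ => ⟨DirectSum.of (fun i => gr i) (d + t) ⟨θ (homogProj K ℓ n d a),
      (hgr _ _).2 ⟨_, mem_homog_of_eq (homogProj_mem d a) (by ring), rfl⟩⟩, ?_⟩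
    rw [DirectSum.coeAddMonoidHom_of]
  · obtain ⟨b, hb, rfl⟩ := (hgr _ _).1 hx
    refine (hgr _ _).2 ⟨b * a, mem_homog_of_eq (homog_mul_mem hb ha) (by ring), ?_⟩
    exact map_smul θ (op a) b

theorem IsGradedModule.exists_mem_ne_zero {gr : ℤ → AddSubgroup M} (hgr : IsGradedModule K ℓ n gr)
    {N : Type*} [AddCommGroup N] (g : M →+ N) {m : M} (hm : g m ≠ 0) :
    ∃ d, ∃ x ∈ gr d, g x ≠ 0 := by
  classical
  by_contra! h
  obtain ⟨u, rfl⟩ := hgr.internal.2 m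
  rw [DirectSum.coeAddMonoidHom_eq_dfinsuppSum, DFinsupp.sum, map_sum] at hm
  exact hm (Finset.sum_eq_zero fun d _ => h d _ (u d).2)

theorem isGradedModule_rightIdeal {e : H K ℓ n} (he : IsIdempotentElem e)
    (he' : e ∈ homog K ℓ n 0) (t : ℤ) :
    IsGradedModule K ℓ n fun d =>
      ((homog K ℓ n (d - t)).toAddSubgroup.comap (rightIdeal e).subtype.toAddMonoidHom) := by
  refine isGradedModule_of_surjective t
    (θ := rightSMulHom ⟨e, Submodule.mem_span_singleton_self e⟩) ?_ ?_ ?_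
  · intro x
    exact ⟨x.1, Subtype.ext ((mem_rightIdeal_iff he).1 x.2)⟩
  · intro a d ha
    have h1 : e * a = 0 := congrArg Subtype.val ha
    refine Subtype.ext ?_
    change e * homogProj K ℓ n d a = 0
    have h2 := homogProj_mul_left he' d a
    rw [h1, map_zero, sub_zero] at h2
    exact h2.symm
  · intro d x
    constructor
    · exact fun hx => ⟨x.1, hx, Subtype.ext ((mem_rightIdeal_iff he).1 x.2)⟩
    · rintro ⟨a, ha, rfl⟩
      have := homog_mul_mem he' ha
      rw [zero_add] at this
      exact this

end GradedModules

/-! ### D_0 is graded and simple. -/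

section CellHead

variable {K : Type*} [Field K] {ℓ n : ℕ}

/-- The homomorphism from the regular module to `D^k` that maps `1` to the class of `y_k`. -/
def cellHeadHom (k : MPart ℓ n) : H K ℓ n →ₗ[(H K ℓ n)ᵐᵒᵖ] cellHead K k :=
  (spechtRad K k).mkQ.comp (rightSMulHom (spechtGen K k))

theorem cellHeadHom_surjective (k : MPart ℓ n) :
    Function.Surjective (cellHeadHom (K := K) k) := by
  intro x
  obtain ⟨x, rfl⟩ := Submodule.mkQ_surjective _ x
  obtain ⟨c, hc⟩ := Submodule.mem_span_singleton.1 x.2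
  exact ⟨unop c, congrArg _ (Subtype.ext hc)⟩

theorem cellHeadHom_eq_zero_iff (k : MPart ℓ n) (a : H K ℓ n) :
    cellHeadHom k a = 0 ↔ ∀ b, yPart K k * a * b * yPart K k ∈ cellIdeal K k := by
  have h1 : ∀ b, op (b * yPart K k) • op a • cellMk K k (yPart K k) =
      cellMk K k (yPart K k * a * b * yPart K k) := fun b =>
    congrArg (cellMk K k) (mul_assoc (yPart K k * a) b (yPart K k)).symm
  have h2 : cellHeadHom k a = 0 ↔
      ∀ b, op (antiAut K ℓ n b * yPart K k) • op a • cellMk K k (yPart K k) = 0 :=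
    Submodule.Quotient.mk_eq_zero _
  rw [h2]
  simp only [h1]
  constructor
  · intro h b
    have := h (antiAut K ℓ n b)
    rw [antiAut_antiAut] at this
    exact (Submodule.Quotient.mk_eq_zero _).1 this
  · exact fun h b => (Submodule.Quotient.mk_eq_zero _).2 (h _)

theorem cellHeadHom_min_eq_zero_iff (h : n ≤ ℓ) {w : Fin n.factorial ≃ Equiv.Perm (Fin n)}
    (hw : ∀ i j : Fin n.factorial, WeakGT (w i)⁻¹ (w j)⁻¹ → i < j) (a : H K ℓ n) :
    cellHeadHom (MPart.min h) a = 0 ↔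
      ∀ b, yDelta K ℓ n * a * b * yDelta K ℓ n ∈ radIdeal K ℓ n := by
  rw [cellHeadHom_eq_zero_iff]
  simp only [yPart_min h, mem_cellIdeal_iff h hw]

theorem isGradedModule_cellHead (h : n ≤ ℓ) {w : Fin n.factorial ≃ Equiv.Perm (Fin n)}
    (hw : ∀ i j : Fin n.factorial, WeakGT (w i)⁻¹ (w j)⁻¹ → i < j) :
    IsGradedModule K ℓ n (cellHeadGrading K (MPart.min h)) := by
  refine isGradedModule_of_surjective (topDeg (MPart.min h)) (cellHeadHom_surjective _) (fun a d ha => ?_)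
    fun d x => ?_
  · rw [cellHeadHom_min_eq_zero_iff h hw] at ha ⊢
    intro b
    induction b using homog_induction with
    | mem e b hb =>
      have h1 := homogProj_mul_mul yDelta_mem_homog (homog_mul_mem hb yDelta_mem_homog) d a
      have h2 := ha b
      rw [mul_assoc] at h2 ⊢
      rw [← h1]
      exact homogProj_mem_radIdeal h2 _
    | add a b ha hb => rw [mul_add, add_mul]; exact add_mem ha hb
  · constructor
    · rintro ⟨a, ha, rfl⟩
      exact ⟨a, ha, rfl⟩
    · rintro ⟨a, ha, rfl⟩
      exact ⟨a, ha, rfl⟩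

theorem psiW_longest_notMem_radIdeal (h : n ≤ ℓ) {w : Fin n.factorial ≃ Equiv.Perm (Fin n)}
    (hw : ∀ i j : Fin n.factorial, WeakGT (w i)⁻¹ (w j)⁻¹ → i < j) :
    psiW K ℓ n (longest n) ∉ radIdeal K ℓ n := by
  intro h1
  obtain ⟨a, c, hac⟩ := one_eq_sum_psiW_longest (K := K) h
  have h2 : (1 : H K ℓ n) ∈ radIdeal K ℓ n := by
    rw [hac]
    exact sum_mem fun j _ => radIdeal_mul_mem_right (Ideal.mul_mem_left _ _ h1) _
  refine f_notMem_radIdeal (K := K) h hw (w.symm 1) (w.symm 1) ?_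
  rw [← mul_one (f K ℓ w _ _)]
  exact Ideal.mul_mem_left _ _ h2

/-- By top degree, D is congruent to a multiple c g of the single matrix unit g = f_{w₀,1}, and g a
g is congruent to a multiple of g. -/
theorem exists_smul_yDelta_sub_mem (h : n ≤ ℓ) {w : Fin n.factorial ≃ Equiv.Perm (Fin n)}
    (hw : ∀ i j : Fin n.factorial, WeakGT (w i)⁻¹ (w j)⁻¹ → i < j) (a : H K ℓ n) :
    ∃ c : K, yDelta K ℓ n * a * yDelta K ℓ n - c • yDelta K ℓ n ∈ radIdeal K ℓ n := by
  obtain ⟨c, hc⟩ := exists_smul_f_sub_mem_of_top_degree h hw (yDelta_mem_homog (K := K) (ℓ := ℓ))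
  set D := yDelta K ℓ n
  set g := f K ℓ w (w.symm (longest n)) (w.symm 1)
  obtain ⟨b, hb⟩ := exists_smul_f_sub_mem (K := K) h hw (w.symm (longest n)) (w.symm 1)
    (w.symm (longest n)) (w.symm 1) a
  change g * a * g - b • g ∈ _ at hb
  refine ⟨c * b, ?_⟩
  have h1 := radIdeal_mul_mem_right (radIdeal_mul_mem_right hc a) D
  have h2 := radIdeal_smul_mem (Ideal.mul_mem_left _ (g * a) hc) c
  have h3 := radIdeal_smul_mem (radIdeal_smul_mem hb c) c
  have h4 := radIdeal_smul_mem hc (c * b)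
  have := sub_mem (add_mem (add_mem h1 h2) h3) h4
  convert this using 1
  simp only [sub_mul, mul_sub, smul_sub, smul_mul_assoc, mul_smul_comm, smul_smul, mul_comm b c,
    mul_assoc]
  abel

theorem isSimpleModule_cellHead (h : n ≤ ℓ) {w : Fin n.factorial ≃ Equiv.Perm (Fin n)}
    (hw : ∀ i j : Fin n.factorial, WeakGT (w i)⁻¹ (w j)⁻¹ → i < j) :
    IsSimpleModule (H K ℓ n)ᵐᵒᵖ (cellHead K (MPart.min h)) := by
  rw [isSimpleModule_iff_toSpanSingleton_surjective]
  refine ⟨⟨cellHeadHom (MPart.min h) 1, 0, fun h1 => ?_⟩, fun x hx m => ?_⟩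
  -- Were D_0 zero, the identity ψ_{w₀} D ψ_{w₀} D ψ_{w₀} = ψ_{w₀} would put ψ_{w₀} in the ideal.
  · rw [cellHeadHom_min_eq_zero_iff h hw] at h1
    refine psiW_longest_notMem_radIdeal (K := K) h hw ?_
    rw [← psiW_longest_yDelta_cancel h]
    have h2 := Ideal.mul_mem_left _ (psiW K ℓ n (longest n)) (h1 (psiW K ℓ n (longest n)))
    rw [mul_one, ← mul_assoc, ← mul_assoc] at h2
    exact radIdeal_mul_mem_right h2 _
  · obtain ⟨a, rfl⟩ := cellHeadHom_surjective _ x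
    obtain ⟨d, rfl⟩ := cellHeadHom_surjective _ m
    rw [Ne, cellHeadHom_min_eq_zero_iff h hw] at hx
    push Not at hx
    obtain ⟨b, hb⟩ := hx
    obtain ⟨c, hc⟩ := exists_smul_yDelta_sub_mem h hw (a * b)
    have hc0 : c ≠ 0 := by
      rintro rfl
      rw [zero_smul, sub_zero, ← mul_assoc] at hc
      exact hb hc
    -- A nonzero class of a pairs nontrivially with some b, so right multiplication by c⁻¹ b D
    -- recovers the generator.
    have h1 : cellHeadHom (MPart.min h) (1 - a * (c⁻¹ • (b * yDelta K ℓ n))) = 0 := by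
      rw [cellHeadHom_min_eq_zero_iff h hw]
      intro b'
      have := radIdeal_mul_mem_right (radIdeal_smul_mem (neg_mem hc) c⁻¹) (b' * yDelta K ℓ n)
      convert this using 1
      rw [neg_sub, smul_sub, smul_smul, inv_mul_cancel₀ hc0, one_smul]
      simp only [mul_sub, sub_mul, mul_one, mul_smul_comm, smul_mul_assoc, mul_assoc]
    rw [map_sub, sub_eq_zero] at h1
    refine ⟨op (c⁻¹ • (b * yDelta K ℓ n) * d), ?_⟩
    change op (c⁻¹ • (b * yDelta K ℓ n) * d) • cellHeadHom (MPart.min h) a = _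
    rw [op_mul, mul_smul, ← map_smul]
    change op d • cellHeadHom (MPart.min h) (a * (c⁻¹ • (b * yDelta K ℓ n))) = _
    rw [← h1, ← map_smul]
    exact congrArg _ (one_mul d)

end CellHead

/-! ### Uniqueness of the simple module. -/

section SimpleModules

variable {K : Type*} [Field K] {ℓ n : ℕ}

theorem smul_eq_zero_of_mem_radIdeal {M : Type*} [AddCommGroup M] [Module (H K ℓ n)ᵐᵒᵖ M]
    [IsSimpleModule (H K ℓ n)ᵐᵒᵖ M] {x : H K ℓ n} (hx : x ∈ radIdeal K ℓ n) (m : M) :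
    op x • m = 0 := by
  induction hx using Submodule.span_induction generalizing m with
  | mem x hx =>
    obtain ⟨k, rfl⟩ := hx
    refine smul_eq_zero_of_isNilpotent (fun a => polyHom_esymm_commute _ a) ?_ m
    have := isNilpotent_polyHom_sub (ℓ := ℓ) (MvPolynomial.esymm (Fin n) K (k + 1))
    rwa [constantCoeff_esymm (Nat.succ_ne_zero _), map_zero, sub_zero] at this
  | zero => rw [op_zero, zero_smul]
  | add x z _ _ hx hz => rw [op_add, add_smul, hx, hz, add_zero]
  | smul b x _ hx => rw [smul_eq_mul, op_mul, mul_smul, hx]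

theorem exists_f_smul_ne_zero (h : n ≤ ℓ) {w : Fin n.factorial ≃ Equiv.Perm (Fin n)}
    (hw : ∀ i j : Fin n.factorial, WeakGT (w i)⁻¹ (w j)⁻¹ → i < j) (M : Type*) [AddCommGroup M]
    [Module (H K ℓ n)ᵐᵒᵖ M] [Nontrivial M] (i : Fin n.factorial) :
    ∃ m : M, op (f K ℓ w i i) • m ≠ 0 := by
  obtain ⟨m, hm⟩ := exists_ne (0 : M)
  by_contra! h1
  refine hm ?_
  rw [← one_smul (H K ℓ n)ᵐᵒᵖ m, ← op_one, ← sum_f h hw, Finset.op_sum, Finset.sum_smul]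
  refine Finset.sum_eq_zero fun k _ => ?_
  rw [← f_mul_f_same h hw k i k, ← f_mul_f_same h hw k i i, op_mul, mul_smul, op_mul, mul_smul,
    h1, smul_zero]

/-- The kernel is described without reference to M, so any two simple modules are the same quotient
of H. With e = f_{ii} and v = ve ≠ 0, the element eabe acts on v by a scalar modulo an ideal that
kills M. -/
theorem exists_surjective_of_isSimpleModule (h : n ≤ ℓ)
    {w : Fin n.factorial ≃ Equiv.Perm (Fin n)}
    (hw : ∀ i j : Fin n.factorial, WeakGT (w i)⁻¹ (w j)⁻¹ → i < j) (M : Type*) [AddCommGroup M]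
    [Module (H K ℓ n)ᵐᵒᵖ M] [IsSimpleModule (H K ℓ n)ᵐᵒᵖ M] (i : Fin n.factorial) :
    ∃ θ : H K ℓ n →ₗ[(H K ℓ n)ᵐᵒᵖ] M, Function.Surjective θ ∧
      ∀ a, θ a = 0 ↔ ∀ b, f K ℓ w i i * a * b * f K ℓ w i i ∈ radIdeal K ℓ n := by
  have := IsSimpleModule.nontrivial (H K ℓ n)ᵐᵒᵖ M
  obtain ⟨m, hm⟩ := exists_f_smul_ne_zero (K := K) h hw M i
  set e := f K ℓ w i i
  have he : e * e = e := f_mul_f_same h hw i i i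
  set v := op e • m with hv
  have hev : op e • v = v := by rw [hv, smul_smul, ← op_mul, he]
  have hact : ∀ a b, op (e * a * b * e) • v = op e • op b • op a • v := fun a b => by
    rw [op_mul, op_mul, op_mul, mul_smul, mul_smul, mul_smul, hev]
  refine ⟨rightSMulHom v, exists_op_smul_eq hm, fun a => ⟨fun ha b => ?_, fun ha => ?_⟩⟩
  · rw [rightSMulHom_apply] at ha
    obtain ⟨c, hc⟩ := exists_smul_f_sub_mem (K := K) h hw i i i i (a * b)
    change e * (a * b) * e - c • e ∈ _ at hc
    rw [← mul_assoc] at hc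
    have h1 := smul_eq_zero_of_mem_radIdeal hc v
    rw [op_sub, sub_smul, hact, ha, smul_zero, smul_zero, zero_sub, neg_eq_zero] at h1
    have hc0 : c = 0 := by
      by_contra hc0
      have h2 : op (c • e * c⁻¹ • (1 : H K ℓ n)) • v = 0 := by
        rw [op_mul, mul_smul, h1, smul_zero]
      rw [smul_mul_smul_comm, mul_inv_cancel₀ hc0, mul_one, one_smul, hev] at h2
      exact hm h2
    rwa [hc0, zero_smul, sub_zero] at hc
  · by_contra h1
    obtain ⟨b, hb⟩ := exists_op_smul_eq (R := H K ℓ n) h1 v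
    have h2 := smul_eq_zero_of_mem_radIdeal (ha b) v
    rw [hact, ← rightSMulHom_apply v a, hb, hev] at h2
    exact hm h2

theorem nonempty_linearEquiv_of_isSimpleModule (h : n ≤ ℓ)
    {w : Fin n.factorial ≃ Equiv.Perm (Fin n)}
    (hw : ∀ i j : Fin n.factorial, WeakGT (w i)⁻¹ (w j)⁻¹ → i < j) (M N : Type*)
    [AddCommGroup M] [Module (H K ℓ n)ᵐᵒᵖ M] [IsSimpleModule (H K ℓ n)ᵐᵒᵖ M]
    [AddCommGroup N] [Module (H K ℓ n)ᵐᵒᵖ N] [IsSimpleModule (H K ℓ n)ᵐᵒᵖ N] :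
    Nonempty (M ≃ₗ[(H K ℓ n)ᵐᵒᵖ] N) := by
  obtain ⟨θ, hθ, hθ'⟩ := exists_surjective_of_isSimpleModule (K := K) h hw M (w.symm 1)
  obtain ⟨η, hη, hη'⟩ := exists_surjective_of_isSimpleModule (K := K) h hw N (w.symm 1)
  have hker : LinearMap.ker θ = LinearMap.ker η := by
    ext a
    rw [LinearMap.mem_ker, LinearMap.mem_ker, hθ', hη']
  exact ⟨(θ.quotKerEquivOfSurjective hθ).symm.trans
    ((Submodule.quotEquivOfEq _ _ hker).trans (η.quotKerEquivOfSurjective hη))⟩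

end SimpleModules

/-! ### The modules f_{ii} H as graded projective covers. -/

section ProjectiveCovers

variable {K : Type*} [Field K] {ℓ n : ℕ}

/-- The corner consists of symmetric polynomials times f_{ii}; such a polynomial is its constant
term plus a nilpotent. -/
theorem hasLocalCorner_f (h : n ≤ ℓ) {w : Fin n.factorial ≃ Equiv.Perm (Fin n)}
    (hw : ∀ i j : Fin n.factorial, WeakGT (w i)⁻¹ (w j)⁻¹ → i < j) (i : Fin n.factorial) :
    HasLocalCorner (f K ℓ w i i) := by
  refine ⟨f_mul_f_same h hw i i i, fun a => ?_⟩
  obtain ⟨q, hq, h1⟩ := f_mul_mul_f (K := K) h hw i i i i a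
  refine ⟨polyHom K ℓ n q, fun b => polyHom_commute_of_isSymmetric hq b, ?_, h1⟩
  have h2 := isNilpotent_polyHom_sub (ℓ := ℓ) q
  by_cases hc : MvPolynomial.constantCoeff q = 0
  · left
    rwa [hc, map_zero, sub_zero] at h2
  · right
    have h3 : IsUnit (polyHom K ℓ n (MvPolynomial.C (MvPolynomial.constantCoeff q))) :=
      ((isUnit_iff_ne_zero.2 hc).map MvPolynomial.C).map (polyHom K ℓ n)
    have h4 := h2.isUnit_add_left_of_commute h3 (polyHom_mul_comm _ _)
    rwa [← map_add, add_sub_cancel] at h4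

theorem f_self_mem_homog (w : Fin n.factorial → Equiv.Perm (Fin n)) (i : Fin n.factorial) :
    f K ℓ w i i ∈ homog K ℓ n 0 :=
  mem_homog_of_eq (f_mem_homog w i i) (sub_self _)

theorem exists_homogeneous_f_smul_ne_zero {M : Type*} [AddCommGroup M]
    [Module (H K ℓ n)ᵐᵒᵖ M] {gr : ℤ → AddSubgroup M} (hgr : IsGradedModule K ℓ n gr)
    {N : Type*} [AddCommGroup N] (g : M →+ N) {w : Fin n.factorial → Equiv.Perm (Fin n)}
    {i : Fin n.factorial} {m : M} (hm : g (op (f K ℓ w i i) • m) ≠ 0) :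
    ∃ d, ∃ x ∈ gr d, op (f K ℓ w i i) • x ∈ gr d ∧ g (op (f K ℓ w i i) • x) ≠ 0 := by
  obtain ⟨d, x, hx, hx'⟩ := hgr.exists_mem_ne_zero
    (g.comp (DistribSMul.toAddMonoidHom M (op (f K ℓ w i i)))) hm
  have := hgr.smul_mem d 0 x _ hx (f_self_mem_homog w i)
  rw [add_zero] at this
  exact ⟨d, x, hx, this, hx'⟩

theorem isGradedProjectiveCover_rightIdeal {D : Type*} [AddCommGroup D]
    [Module (H K ℓ n)ᵐᵒᵖ D] [IsSimpleModule (H K ℓ n)ᵐᵒᵖ D] {gr : ℤ → AddSubgroup D}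
    (hgr : IsGradedModule K ℓ n gr) {e : H K ℓ n} (he : HasLocalCorner e)
    (he' : e ∈ homog K ℓ n 0) {t : ℤ} {m : D} (hm : m ∈ gr t) (hem : op e • m ≠ 0) :
    IsGradedProjectiveCover K ℓ n gr
      (fun d => (homog K ℓ n (d - t)).toAddSubgroup.comap (rightIdeal e).subtype.toAddMonoidHom)
      ((rightSMulHom m).comp (rightIdeal e).subtype) where
  gradedSource := isGradedModule_rightIdeal he.1 he' t
  gradedTarget := hgr
  projective := projective_rightIdeal he.1
  map_mem d x hx := by
    have := hgr.smul_mem t (d - t) m x.1 hm hx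
    rwa [add_sub_cancel] at this
  surjective x := by
    obtain ⟨a, rfl⟩ := exists_op_smul_eq (R := H K ℓ n) hem x
    refine ⟨⟨e * a, mul_mem_rightIdeal e a⟩, ?_⟩
    change op (e * a) • m = _
    rw [op_mul, mul_smul]
  superfluous N _ hN := he.eq_top _ (fun h0 => hem
    (LinearMap.congr_fun h0 ⟨e, Submodule.mem_span_singleton_self e⟩)) N hN

/-- A homogeneous q = qe in P with π(q) ≠ 0 generates P, since D is simple and the kernel of π is
superfluous among graded submodules. Homogeneity of q is what makes its span graded. -/
theorem IsGradedProjectiveCover.nonempty_linearEquiv {D P : Type*} [AddCommGroup D]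
    [Module (H K ℓ n)ᵐᵒᵖ D] [IsSimpleModule (H K ℓ n)ᵐᵒᵖ D] [AddCommGroup P]
    [Module (H K ℓ n)ᵐᵒᵖ P] {grD : ℤ → AddSubgroup D} {gr : ℤ → AddSubgroup P}
    {π : P →ₗ[(H K ℓ n)ᵐᵒᵖ] D} (hπ : IsGradedProjectiveCover K ℓ n grD gr π) (h : n ≤ ℓ)
    {w : Fin n.factorial ≃ Equiv.Perm (Fin n)}
    (hw : ∀ i j : Fin n.factorial, WeakGT (w i)⁻¹ (w j)⁻¹ → i < j) (i : Fin n.factorial) :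
    Nonempty (rightIdeal (f K ℓ w i i) ≃ₗ[(H K ℓ n)ᵐᵒᵖ] P) := by
  have := IsSimpleModule.nontrivial (H K ℓ n)ᵐᵒᵖ D
  have := hπ.projective
  obtain ⟨m, hm⟩ := exists_f_smul_ne_zero (K := K) h hw D i
  obtain ⟨x, rfl⟩ := hπ.surjective m
  rw [← map_smul] at hm
  obtain ⟨d, p, -, hp, hp'⟩ := exists_homogeneous_f_smul_ne_zero hπ.gradedSource
    π.toAddMonoidHom hm
  set e := f K ℓ w i i
  set q := op e • p with hq
  have he := hasLocalCorner_f (K := K) h hw i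
  have heq : op e • q = q := by rw [hq, smul_smul, ← op_mul, he.1.eq]
  refine he.nonempty_linearEquiv heq (fun h0 => hp' (by rw [h0, map_zero]))
    (hπ.superfluous _ (le_antisymm ?_ ?_) (eq_top_iff.2 fun x _ => ?_))
  · exact Submodule.span_mono
      (Set.singleton_subset_iff.2 ⟨Submodule.mem_span_singleton_self q, d, hp⟩)
  · exact Submodule.span_le.2 fun x hx => hx.1
  · obtain ⟨a, ha⟩ := exists_op_smul_eq (R := H K ℓ n) hp' (π x)
    refine Submodule.mem_sup.2 ⟨op a • q, Submodule.smul_mem _ _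
      (Submodule.mem_span_singleton_self q), x - op a • q, ?_, add_sub_cancel _ _⟩
    rw [LinearMap.mem_ker, map_sub, map_smul, ← ha, sub_eq_zero]
    rfl

end ProjectiveCovers

end NilHecke

end

theorem mainTheorem5 {K : Type u} [Field K] (ℓ n : ℕ) (hn : n ≤ ℓ)
    (w : Fin n.factorial ≃ Equiv.Perm (Fin n))
    (hw : ∀ i j : Fin n.factorial, NilHecke.WeakGT (w i)⁻¹ (w j)⁻¹ → i < j) :
    (∀ i j : Fin n.factorial,
      NilHecke.f K ℓ w i j ≠ 0 ∧
      NilHecke.f K ℓ w i j ∈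
        NilHecke.homog K ℓ n (2 * (NilHecke.len (w i) : ℤ) - 2 * (NilHecke.len (w j) : ℤ))) ∧
    (∀ i j k l : Fin n.factorial,
      NilHecke.f K ℓ w i j * NilHecke.f K ℓ w k l =
        if j = k then NilHecke.f K ℓ w i l else 0) ∧
    -- `D₀` is the unique simple right module
    (IsSimpleModule (NilHecke.H K ℓ n)ᵐᵒᵖ (NilHecke.cellHead K (NilHecke.MPart.min hn)) ∧
      ∀ (M : Type v) [AddCommGroup M] [Module (NilHecke.H K ℓ n)ᵐᵒᵖ M],
        IsSimpleModule (NilHecke.H K ℓ n)ᵐᵒᵖ M →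
          Nonempty (M ≃ₗ[(NilHecke.H K ℓ n)ᵐᵒᵖ]
            NilHecke.cellHead K (NilHecke.MPart.min hn))) ∧
    -- `D₀` has a graded projective cover `P₀`
    (∃ (P₀ : Type u) (_ : AddCommGroup P₀) (_ : Module (NilHecke.H K ℓ n)ᵐᵒᵖ P₀)
      (gr : ℤ → AddSubgroup P₀)
      (π : P₀ →ₗ[(NilHecke.H K ℓ n)ᵐᵒᵖ] NilHecke.cellHead K (NilHecke.MPart.min hn)),
      NilHecke.IsGradedProjectiveCover K ℓ n
        (NilHecke.cellHeadGrading K (NilHecke.MPart.min hn)) gr π) ∧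
    -- and each `f_{w_i,w_i} H` is isomorphic to `P₀`
    (∀ (P₀ : Type v) [AddCommGroup P₀] [Module (NilHecke.H K ℓ n)ᵐᵒᵖ P₀]
      (gr : ℤ → AddSubgroup P₀)
      (π : P₀ →ₗ[(NilHecke.H K ℓ n)ᵐᵒᵖ] NilHecke.cellHead K (NilHecke.MPart.min hn)),
      NilHecke.IsGradedProjectiveCover K ℓ n
        (NilHecke.cellHeadGrading K (NilHecke.MPart.min hn)) gr π →
      ∀ i : Fin n.factorial,
        Nonempty (NilHecke.rightIdeal (NilHecke.f K ℓ w i i)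
          ≃ₗ[(NilHecke.H K ℓ n)ᵐᵒᵖ] P₀)) ∧
    ∑ i : Fin n.factorial, NilHecke.f K ℓ w i i = 1 ∧
    CompleteOrthogonalIdempotents (fun i : Fin n.factorial => NilHecke.f K ℓ w i i) ∧
    (∀ i : Fin n.factorial, NilHecke.IsPrimitiveIdempotent (NilHecke.f K ℓ w i i)) := by
  have := NilHecke.isSimpleModule_cellHead (K := K) hn hw
  have hgr := NilHecke.isGradedModule_cellHead (K := K) hn hw
  refine ⟨fun i j => ⟨NilHecke.f_ne_zero hn hw i j, NilHecke.f_mem_homog _ i j⟩,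
    NilHecke.f_mul_f hn hw, ⟨inferInstance, fun M _ _ _ =>
      NilHecke.nonempty_linearEquiv_of_isSimpleModule hn hw M _⟩, ?_,
    fun P₀ _ _ gr π hπ i => hπ.nonempty_linearEquiv hn hw i, NilHecke.sum_f hn hw,
    ⟨⟨fun i => NilHecke.f_mul_f_same hn hw i i i, fun i j hij =>
      (NilHecke.f_mul_f hn hw i i j j).trans (if_neg hij)⟩, NilHecke.sum_f hn hw⟩,
    fun i => (NilHecke.hasLocalCorner_f hn hw i).isPrimitiveIdempotent
      (NilHecke.f_ne_zero hn hw i i)⟩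
  -- For existence of the cover take f_{ii} H with generator placed in the degree t of a homogeneous
  -- element of D_0 not killed by f_{ii}; the choice w_i = 1 is arbitrary.
  have := IsSimpleModule.nontrivial (NilHecke.H K ℓ n)ᵐᵒᵖ
    (NilHecke.cellHead K (NilHecke.MPart.min hn))
  obtain ⟨m, hm⟩ := NilHecke.exists_f_smul_ne_zero (K := K) hn hw
    (NilHecke.cellHead K (NilHecke.MPart.min hn)) (w.symm 1)
  obtain ⟨t, x, hx, -, hx'⟩ := NilHecke.exists_homogeneous_f_smul_ne_zero hgr
    (AddMonoidHom.id _) hm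
  exact ⟨_, _, _, _, _, NilHecke.isGradedProjectiveCover_rightIdeal hgr
    (NilHecke.hasLocalCorner_f hn hw _) (NilHecke.f_self_mem_homog w _) hx hx'⟩
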